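/- **Theorem 4 (gate complexity of a block-encoding of $A^{(1\mathrm{st})}$).** An $(\alpha,a,\epsilon)$-block-encoding of an operator $M$ on a system register is a unitary $U$ on $a$ ancilla qubits and the system with $\|M-\alpha(\langle 0^a|\otimes I)U(|0^a\rangle\otimes I)\|\le\epsilon$ (operator norm). *The operator.* Let $d,m\ge 1$, $n=dm$, and consider a uniform grid with $2^m$ points and spacing $h_\mu>0$ in direction $\mu$, for $0\le\mu<d$; the system register has $n$ qubits, $m$ for each direction. Let $\kappa,\gamma,\beta_\mu$ be real functions, $\beta_\mu^+=\max(\beta_\mu,0)$, $\beta_\mu^-=\min(\beta_\mu,0)$, $C_f=\sum_j f(x^{[j]})|j\rangle\langle j|$, and let $D_\mu^{+}$, $D_\mu^{-}$ be the forward and backward difference operators $(u_{i+1}-u_i)/h_\mu$, $(u_i-u_{i-1})/h_\mu$ in direction $\mu$, including boundary conditions: the wrap-around entry and the first and last diagonal entry are multiplied by weights in $[-1,1]$ (periodic, homogeneous Dirichlet and Neumann conditions are special cases). For $s\in\{1,-1\}$ put $$A^{(1\mathrm{st})}=-\Big(\tfrac12\sum_{\mu}(D_\mu^+C_\kappa D_\mu^-+D_\mu^-C_\kappa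 D_\mu^+)+s\Big(\sum_{\mu}(C_{\beta_\mu^+}D_\mu^-+C_{\beta_\mu^-}D_\mu^+)+C_\gamma\Big)\Big).$$ *The ingredients.* Let $K\ge1$, $L_\mu>0$, and for each $f\in\{\kappa,\gamma,\beta_\mu^+,\beta_\mu^-\}$ let $\sum_{k\in\{-K,\dots,K\}^d}c^f_k\exp(2\pi i\sum_\mu k_\mu x_\mu/L_\mu)$ be a degree-$K$ Fourier sum that approximates $f$ within $\epsilon_f$ at all grid points, and let $\alpha_f\ge\sum_k|c^f_k|$, where $\alpha_{\beta_\mu^\pm}=\alpha_\beta$ and $\epsilon_{\beta_\mu^\pm}=\epsilon_\beta$ for all $\mu$. The LCU Fourier unitary of $f$ is $U_f=(P_L^\dagger\otimes I)\big(\sum_k|k\rangle\langle k|\otimes V_k\big)(P_R\otimes I)$ on $a_f=d\lceil\log_2(2K+1)\rceil$ ancilla qubits and the system. Here $k$ runs over all the frequencies $k_\mu=b_\mu-K$, $b_\mu$ being the integer stored in the $\mu$-th of $d$ ancilla registers of $\lceil\log_2(2K+1)\rceil$ qubits; $V_k$ multiplies each grid basis state by the $k$-th Fourier mode; and $P_L,P_R$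 are unitaries with $\alpha_f\overline{(P_L)_{k0}}(P_R)_{k0}=c^f_k$ for $k\in\{-K,\dots,K\}^d$ and $\overline{(P_L)_{k0}}(P_R)_{k0}=0$ for all other $k$. Let $\alpha_D\ge 2/h_\mu$ for all $\mu$ (for instance $\alpha_D=3d/h$ if all $h_\mu=h$) and $a_D\ge2$. *The claim.* There is an absolute constant $c$ such that for all such data there are state-preparation pairs as above, for which each $U_f$ is an $(\alpha_f,a_f,\epsilon_f)$-block-encoding of $C_f$, and $(\alpha_D,a_D,0)$-block-encodings $U_{D_\mu^\pm}$ of all $D_\mu^\pm$, with the following property. Form the $4d+1$ products $U_t$ of these unitaries corresponding to the terms $D_\mu^+C_\kappa D_\mu^-$, $D_\mu^-C_\kappa D_\mu^+$, $C_{\beta_\mu^+}D_\mu^-$, $C_{\beta_\mu^-}D_\mu^+$, $C_\gamma$ (different factors of a product use disjoint ancilla qubits), let $y_t$ be the coefficient of the term $t$ in $A^{(1\mathrm{st})}$ and $\alpha_t$ the product of the normalizations of its factors, and combine them as $$(G_L^\dagger\otimes I)\Big(\sum_t|t\rangle\langle t|\otimes U_t+\big(I-\sum_t|t\rangle\langle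 t|\big)\otimes I\Big)(G_R\otimes I)$$ with $\lceil\log_2(4d+1)\rceil$ selector qubits and suitable unitaries $G_L,G_R$ such that $(3d+1)\overline{(G_L)_{t0}}(G_R)_{t0}=y_t\alpha_t/\max_{t'}\alpha_{t'}$ for every term $t$ (read as $0$ if $\max_{t'}\alpha_{t'}=0$) and $\overline{(G_L)_{j0}}(G_R)_{j0}=0$ for all other selector states $j$. This unitary is a $$\Big((3d+1)\max(\alpha_\kappa\alpha_D^2,\alpha_\beta\alpha_D,\alpha_\gamma),\ d\lceil\log_2(2K+1)\rceil+2a_D+\lceil\log_2(4d+1)\rceil,\ (3d+1)\max(\alpha_D^2\epsilon_\kappa,\alpha_D\epsilon_\beta,\epsilon_\gamma)\Big)$$ block-encoding of $A^{(1\mathrm{st})}$, and it is implemented exactly, possibly with additional work qubits that start in $|0\rangle$ and are returned to $|0\rangle$, by a circuit of at most $$c\,\big(d(2K+1)^d+dn\log K+n^2\big)$$ two-qubit gates. In particular, for each fixed $d$ the number of two-qubit gates is $\mathcal O(dK^d+dn\log K+n^2)$. -/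

import Mathlib

/-! ### Registers of qubits and circuits of two-qubit gates

A register is a finite type `W` of wires, its computational basis is `W → Bool`, and an operator on
it is a matrix indexed by `W → Bool`. -/

/-- The all-zero basis state. -/
def zeroKet (W : Type) : W → Bool := fun _ => false

/-- `U ⊗ I`: the operator `U` on the wires `f v` (`f` injective), the identity on all others. -/
def onWires {V W : Type} [Fintype V] [Fintype W] [DecidableEq W] (f : V → W)
    (U : Matrix (V → Bool) (V → Bool) ℂ) : Matrix (W → Bool) (W → Bool) ℂ :=
  fun x y => if ∀ w, (∀ v, f v ≠ w) → x w = y w then U (x ∘ f) (y ∘ f) else 0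

/-- A two-qubit gate: an arbitrary unitary on an ordered pair of distinct wires. -/
structure TwoQubitGate (W : Type) where
  fst : W
  snd : W
  ne : fst ≠ snd
  mat : Matrix (Fin 2 → Bool) (Fin 2 → Bool) ℂ
  unitary : mat ∈ Matrix.unitaryGroup (Fin 2 → Bool) ℂ

/-- The operator of a circuit; the head of the list is the gate applied first.
The number of two-qubit gates of the circuit is the length of the list. -/
noncomputable def circuitOp {W : Type} [Fintype W] [DecidableEq W] :
    List (TwoQubitGate W) → Matrix (W → Bool) (W → Bool) ℂ
  | [] => 1
  | g :: C => circuitOp C * onWires ![g.fst, g.snd] g.mat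

/-- The circuit `C` implements `U` exactly, with the help of `w` work qubits which start in `|0⟩`
and are returned to `|0⟩`: `C (|0⟩ ⊗ ψ) = |0⟩ ⊗ U ψ` for all `ψ`. -/
def Implements {W : Type} [Fintype W] [DecidableEq W] {w : ℕ}
    (C : List (TwoQubitGate (Fin w ⊕ W))) (U : Matrix (W → Bool) (W → Bool) ℂ) : Prop :=
  ∀ (z : Fin w → Bool) (x y : W → Bool),
    circuitOp C (Sum.elim z x) (Sum.elim (zeroKet (Fin w)) y) =
      if z = zeroKet (Fin w) then U x y else 0

/-! ### Block-encodings -/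

/-- `(⟨0| ⊗ I) U (|0⟩ ⊗ I)`, with the ancilla wires `A` projected on `|0⟩`. -/
def zeroBlock {A S : Type} (U : Matrix (A ⊕ S → Bool) (A ⊕ S → Bool) ℂ) :
    Matrix (S → Bool) (S → Bool) ℂ :=
  fun x y => U (Sum.elim (zeroKet A) x) (Sum.elim (zeroKet A) y)

/-- `U` is an `(α, a, ε)`-block-encoding of `M`, the norm being the spectral (operator) norm. -/
def IsBlockEncoding {A S : Type} [Fintype A] [DecidableEq A] [Fintype S] [DecidableEq S]
    (α : ℝ) (a : ℕ) (ε : ℝ) (U : Matrix (A ⊕ S → Bool) (A ⊕ S → Bool) ℂ)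
    (M : Matrix (S → Bool) (S → Bool) ℂ) : Prop :=
  Fintype.card A = a ∧ U ∈ Matrix.unitaryGroup (A ⊕ S → Bool) ℂ ∧
    ‖Matrix.toEuclideanCLM (n := S → Bool) (𝕜 := ℂ) (M - (α : ℂ) • zeroBlock U)‖ ≤ ε

/-- The integer with binary digits `b` (`b 0` is the lowest one). -/
def bitsVal {r : ℕ} (b : Fin r → Bool) : ℕ := ∑ i, if b i then 2 ^ (i : ℕ) else 0

/-! ### The discretized first-order equation -/

/-- System register: `m` qubits for each of the `d` spatial directions. -/
abbrev SysW (d m : ℕ) : Type := Fin d × Fin m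

/-- The index in `{0, …, 2 ^ m - 1}` of a grid point in direction `μ`. -/
def gridIdx {d m : ℕ} (x : SysW d m → Bool) (μ : Fin d) : ℕ := bitsVal fun i => x (μ, i)

/-- How a one-dimensional difference operator on the points `0, …, N - 1` is closed at the boundary:
`wrap` is the weight of the coupling between the points `0` and `N - 1`; `first` and `last` are the
weights of the diagonal entries there.  For the forward difference, periodic is `(1, 1, 1)`,
homogeneous Dirichlet (`u_N = 0`) is `(0, 1, 1)`, homogeneous Neumann (`u_N = u_{N-1}`) is
`(0, 1, 0)`; for the backward difference `first` and `last` change roles. -/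
structure BoundaryClosure where
  wrap : ℝ
  first : ℝ
  last : ℝ
  wrap_mem : wrap ∈ Set.Icc (-1 : ℝ) 1
  first_mem : first ∈ Set.Icc (-1 : ℝ) 1
  last_mem : last ∈ Set.Icc (-1 : ℝ) 1

/-- The diagonal weight at the point `i` of `0, …, N - 1`. -/
noncomputable def BoundaryClosure.diag (B : BoundaryClosure) (N i : ℕ) : ℝ :=
  if i = 0 then B.first else if i + 1 = N then B.last else 1

/-- Entry `(i, j)` of the one-dimensional forward difference `u ↦ (u_{i+1} - u_i) / h`. -/
noncomputable def forwardEntry (B : BoundaryClosure) (N : ℕ) (h : ℝ) (i j : ℕ) : ℝ :=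
  ((if j = i + 1 then 1 else if i + 1 = N ∧ j = 0 then B.wrap else 0)
    - (if i = j then B.diag N i else 0)) / h

/-- Entry `(i, j)` of the one-dimensional backward difference `u ↦ (u_i - u_{i-1}) / h`. -/
noncomputable def backwardEntry (B : BoundaryClosure) (N : ℕ) (h : ℝ) (i j : ℕ) : ℝ :=
  ((if i = j then B.diag N i else 0)
    - (if i = j + 1 then 1 else if i = 0 ∧ j + 1 = N then B.wrap else 0)) / h

/-- The data of the discretized equation `∂ₜu = ∇·κ∇u - β·∇u - γu`: a uniform grid with `2 ^ m`
points in each of the `d` directions, the coefficients, and the boundary closures of the forward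
and backward differences. -/
structure FirstOrderPDE (d m : ℕ) where
  origin : Fin d → ℝ
  spacing : Fin d → ℝ
  spacing_pos : ∀ μ, 0 < spacing μ
  kappa : (Fin d → ℝ) → ℝ
  gamma : (Fin d → ℝ) → ℝ
  beta : Fin d → (Fin d → ℝ) → ℝ
  bcPlus : Fin d → BoundaryClosure
  bcMinus : Fin d → BoundaryClosure

namespace FirstOrderPDE

variable {d m : ℕ} (E : FirstOrderPDE d m)

/-- The grid point belonging to a basis state. -/
noncomputable def point (x : SysW d m → Bool) : Fin d → ℝ :=
  fun μ => E.origin μ + E.spacing μ * (gridIdx x μ : ℝ)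

/-- The diagonal operator `C_f = ∑ⱼ f(xⱼ) |j⟩⟨j|`. -/
noncomputable def diagOp (f : (Fin d → ℝ) → ℝ) : Matrix (SysW d m → Bool) (SysW d m → Bool) ℂ :=
  Matrix.diagonal fun x => (f (E.point x) : ℂ)

/-- The forward difference in direction `μ`, boundary conditions included. -/
noncomputable def diffPlus (μ : Fin d) : Matrix (SysW d m → Bool) (SysW d m → Bool) ℂ :=
  fun x y => if ∀ ν, ν ≠ μ → gridIdx x ν = gridIdx y ν then
    (forwardEntry (E.bcPlus μ) (2 ^ m) (E.spacing μ) (gridIdx x μ) (gridIdx y μ) : ℂ) else 0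

/-- The backward difference in direction `μ`, boundary conditions included. -/
noncomputable def diffMinus (μ : Fin d) : Matrix (SysW d m → Bool) (SysW d m → Bool) ℂ :=
  fun x y => if ∀ ν, ν ≠ μ → gridIdx x ν = gridIdx y ν then
    (backwardEntry (E.bcMinus μ) (2 ^ m) (E.spacing μ) (gridIdx x μ) (gridIdx y μ) : ℂ) else 0

/-- The positive part of the `μ`-th velocity component. -/
noncomputable def betaPos (μ : Fin d) : (Fin d → ℝ) → ℝ := fun x => max (E.beta μ x) 0

/-- The negative part `min (β_μ, 0)` of the `μ`-th velocity component. -/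
noncomputable def betaNeg (μ : Fin d) : (Fin d → ℝ) → ℝ := fun x => min (E.beta μ x) 0

/-- The operator `A^(1st)`; `s` is the sign (`1` or `-1`) of the terms of order one and zero. -/
noncomputable def opA (s : ℝ) : Matrix (SysW d m → Bool) (SysW d m → Bool) ℂ :=
  -((1 / 2 : ℂ) • ∑ μ, (E.diffPlus μ * E.diagOp E.kappa * E.diffMinus μ
        + E.diffMinus μ * E.diagOp E.kappa * E.diffPlus μ)
    + (s : ℂ) • (∑ μ, (E.diagOp (E.betaPos μ) * E.diffMinus μ
        + E.diagOp (E.betaNeg μ) * E.diffPlus μ) + E.diagOp E.gamma))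

end FirstOrderPDE

/-! ### LCU Fourier -/

/-- The frequencies `k ∈ ℤ^d` with `|k_μ| ≤ K` for all `μ`. -/
noncomputable def freqs (d K : ℕ) : Finset (Fin d → ℤ) :=
  Fintype.piFinset fun _ => Finset.Icc (-(K : ℤ)) (K : ℤ)

/-- The Fourier mode `exp (2πi ∑_μ k_μ x_μ / L_μ)` of periods `L_μ`. -/
noncomputable def fourierMode {d : ℕ} (L : Fin d → ℝ) (k : Fin d → ℤ) (x : Fin d → ℝ) : ℂ :=
  Complex.exp (2 * Real.pi * Complex.I * ((∑ μ, (k μ : ℝ) * x μ / L μ : ℝ) : ℂ))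

/-- The degree-`K` Fourier sum with coefficients `c`. -/
noncomputable def fourierSum {d : ℕ} (L : Fin d → ℝ) (K : ℕ) (c : (Fin d → ℤ) → ℂ)
    (x : Fin d → ℝ) : ℂ :=
  ∑ k ∈ freqs d K, c k * fourierMode L k x

/-- The degree-`K` Fourier sum with coefficients `c` approximates `f` within `ε` at all grid points,
and `α` bounds the `ℓ¹` norm of its coefficients. -/
def IsFourierApprox {d m : ℕ} (E : FirstOrderPDE d m) (L : Fin d → ℝ) (K : ℕ)
    (f : (Fin d → ℝ) → ℝ) (c : (Fin d → ℤ) → ℂ) (α ε : ℝ) : Prop :=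
  ∑ k ∈ freqs d K, ‖c k‖ ≤ α ∧
    ∀ x : SysW d m → Bool, ‖(f (E.point x) : ℂ) - fourierSum L K c (E.point x)‖ ≤ ε

/-- Ancilla register of LCU Fourier: `⌈log₂ (2K+1)⌉` qubits for each direction. -/
abbrev FouW (d K : ℕ) : Type := Fin d × Fin (Nat.clog 2 (2 * K + 1))

/-- The frequency `b_μ - K` in direction `μ` stored in the ancilla register. -/
def freqOf {d K : ℕ} (b : FouW d K → Bool) (μ : Fin d) : ℤ :=
  (bitsVal fun i => b (μ, i) : ℤ) - (K : ℤ)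

/-- `∑_k |k⟩⟨k| ⊗ V_k`, where `V_k` multiplies `|x⟩` by the Fourier mode `k` at the point `x`. -/
noncomputable def fourierSelect {d m : ℕ} (E : FirstOrderPDE d m) (L : Fin d → ℝ) (K : ℕ) :
    Matrix (FouW d K ⊕ SysW d m → Bool) (FouW d K ⊕ SysW d m → Bool) ℂ :=
  Matrix.diagonal fun z =>
    fourierMode L (freqOf (K := K) (z ∘ Sum.inl)) (E.point (z ∘ Sum.inr))

/-- `(P_L, P_R)` is an exact state-preparation pair with normalization `α` for the coefficients `c`
of the frequencies `|k_μ| ≤ K`. -/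
def IsFourierPrep {d K : ℕ} (α : ℝ) (c : (Fin d → ℤ) → ℂ)
    (PL PR : Matrix (FouW d K → Bool) (FouW d K → Bool) ℂ) : Prop :=
  PL ∈ Matrix.unitaryGroup (FouW d K → Bool) ℂ ∧
  PR ∈ Matrix.unitaryGroup (FouW d K → Bool) ℂ ∧
  ∀ b : FouW d K → Bool,
    (freqOf b ∈ freqs d K →
      (α : ℂ) * (star (PL b (zeroKet _)) * PR b (zeroKet _)) = c (freqOf b)) ∧
    (freqOf b ∉ freqs d K → star (PL b (zeroKet _)) * PR b (zeroKet _) = 0)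

/-- The LCU Fourier unitary `(P_L† ⊗ I) SELECT (P_R ⊗ I)`. -/
noncomputable def lcuFourier {d m K : ℕ} (E : FirstOrderPDE d m) (L : Fin d → ℝ)
    (PL PR : Matrix (FouW d K → Bool) (FouW d K → Bool) ℂ) :
    Matrix (FouW d K ⊕ SysW d m → Bool) (FouW d K ⊕ SysW d m → Bool) ℂ :=
  (onWires Sum.inl PL).conjTranspose * fourierSelect E L K * onWires Sum.inl PR

/-! ### The block-encoding of `A^(1st)` as a linear combination of products -/

/-- The `4d + 1` terms `D_μ⁺ C_κ D_μ⁻`, `D_μ⁻ C_κ D_μ⁺`, `C_{β_μ⁺} D_μ⁻`, `C_{β_μ⁻} D_μ⁺`, `C_γ`. -/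
abbrev TermIdx (d : ℕ) : Type := (Fin d ⊕ Fin d) ⊕ (Fin d ⊕ Fin d) ⊕ Unit

/-- The numbering of the terms by `0, …, 4d`. -/
def termNum {d : ℕ} : TermIdx d → ℕ
  | .inl (.inl μ) => μ
  | .inl (.inr μ) => d + μ
  | .inr (.inl (.inl μ)) => 2 * d + μ
  | .inr (.inl (.inr μ)) => 3 * d + μ
  | .inr (.inr ()) => 4 * d

/-- The coefficient `y_t` of a term in `A^(1st)`. -/
noncomputable def termCoeff {d : ℕ} (s : ℝ) : TermIdx d → ℝ
  | .inl _ => -(1 / 2)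
  | .inr _ => -s

/-- The normalization `α_t` of the block-encoding of a term. -/
noncomputable def termNorm {d : ℕ} (aKappa aBeta aGamma aDiff : ℝ) : TermIdx d → ℝ
  | .inl _ => aKappa * aDiff ^ 2
  | .inr (.inl _) => aBeta * aDiff
  | .inr (.inr _) => aGamma

/-- The selector register of `⌈log₂ (4d+1)⌉` qubits. -/
abbrev SelW (d : ℕ) : Type := Fin (Nat.clog 2 (4 * d + 1))

/-- All ancilla qubits: selector, LCU Fourier, and two registers for difference operators. -/
abbrev AncW (d K a : ℕ) : Type := SelW d ⊕ FouW d K ⊕ Fin a ⊕ Fin a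

/-- The wires of the selector. -/
def selWires {d m K a : ℕ} : SelW d → AncW d K a ⊕ SysW d m := fun q => .inl (.inl q)

/-- The wires on which a block-encoding of a coefficient acts. -/
def fouWires {d m K a : ℕ} : FouW d K ⊕ SysW d m → AncW d K a ⊕ SysW d m :=
  Sum.elim (fun q => .inl (.inr (.inl q))) .inr

/-- The wires of a block-encoding of a difference operator, with the first ancilla register. -/
def diffWires₁ {d m K a : ℕ} : Fin a ⊕ SysW d m → AncW d K a ⊕ SysW d m :=
  Sum.elim (fun q => .inl (.inr (.inr (.inl q)))) .inr

/-- The wires of a block-encoding of a difference operator, with the second ancilla register. -/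
def diffWires₂ {d m K a : ℕ} : Fin a ⊕ SysW d m → AncW d K a ⊕ SysW d m :=
  Sum.elim (fun q => .inl (.inr (.inr (.inr q)))) .inr

/-- The unitaries from which the block-encoding of `A^(1st)` is assembled: block-encodings of the
coefficients and of the difference operators, and the state-preparation pair of the selector. -/
structure Unitaries (d m K a : ℕ) where
  uKappa : Matrix (FouW d K ⊕ SysW d m → Bool) (FouW d K ⊕ SysW d m → Bool) ℂ
  uGamma : Matrix (FouW d K ⊕ SysW d m → Bool) (FouW d K ⊕ SysW d m → Bool) ℂ
  uBetaPos : Fin d → Matrix (FouW d K ⊕ SysW d m → Bool) (FouW d K ⊕ SysW d m → Bool) ℂ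
  uBetaNeg : Fin d → Matrix (FouW d K ⊕ SysW d m → Bool) (FouW d K ⊕ SysW d m → Bool) ℂ
  uPlus : Fin d → Matrix (Fin a ⊕ SysW d m → Bool) (Fin a ⊕ SysW d m → Bool) ℂ
  uMinus : Fin d → Matrix (Fin a ⊕ SysW d m → Bool) (Fin a ⊕ SysW d m → Bool) ℂ
  selL : Matrix (SelW d → Bool) (SelW d → Bool) ℂ
  selR : Matrix (SelW d → Bool) (SelW d → Bool) ℂ

namespace Unitaries

variable {d m K a : ℕ} (V : Unitaries d m K a)

/-- The block-encoding of a term, as the product of the block-encodings of its factors, each with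
ancilla qubits of its own. -/
noncomputable def term : TermIdx d →
    Matrix (AncW d K a ⊕ SysW d m → Bool) (AncW d K a ⊕ SysW d m → Bool) ℂ
  | .inl (.inl μ) =>
      onWires diffWires₁ (V.uPlus μ) * onWires fouWires V.uKappa * onWires diffWires₂ (V.uMinus μ)
  | .inl (.inr μ) =>
      onWires diffWires₁ (V.uMinus μ) * onWires fouWires V.uKappa * onWires diffWires₂ (V.uPlus μ)
  | .inr (.inl (.inl μ)) => onWires fouWires (V.uBetaPos μ) * onWires diffWires₁ (V.uMinus μ)
  | .inr (.inl (.inr μ)) => onWires fouWires (V.uBetaNeg μ) * onWires diffWires₁ (V.uPlus μ)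
  | .inr (.inr ()) => onWires fouWires V.uGamma

/-- The projector on the states whose selector is in the state `|j⟩`. -/
noncomputable def selProj (d m K a j : ℕ) :
    Matrix (AncW d K a ⊕ SysW d m → Bool) (AncW d K a ⊕ SysW d m → Bool) ℂ :=
  Matrix.diagonal fun z => if bitsVal (z ∘ selWires) = j then 1 else 0

/-- `W = ∑_t |t⟩⟨t| ⊗ U_t + (I - ∑_t |t⟩⟨t|) ⊗ I`. -/
noncomputable def select :
    Matrix (AncW d K a ⊕ SysW d m → Bool) (AncW d K a ⊕ SysW d m → Bool) ℂ :=
  ∑ t : TermIdx d, selProj d m K a (termNum t) * V.term t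
    + (1 - ∑ t : TermIdx d, selProj d m K a (termNum t))

/-- The assembled unitary `(P_L† ⊗ I) W (P_R ⊗ I)`. -/
noncomputable def assembled :
    Matrix (AncW d K a ⊕ SysW d m → Bool) (AncW d K a ⊕ SysW d m → Bool) ℂ :=
  (onWires selWires V.selL).conjTranspose * V.select * onWires selWires V.selR

/-- The pair `(P_L, P_R)` of the selector is an exact state-preparation pair with normalization
`‖y‖₁ = 3d + 1` for the numbers `y_t α_t / max_t α_t`. -/
def IsSelPrep (s aKappa aBeta aGamma aDiff : ℝ) : Prop :=
  V.selL ∈ Matrix.unitaryGroup (SelW d → Bool) ℂ ∧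
  V.selR ∈ Matrix.unitaryGroup (SelW d → Bool) ℂ ∧
  ∀ b : SelW d → Bool,
    (∀ t : TermIdx d, termNum t = bitsVal b →
      (3 * d + 1 : ℂ) * (star (V.selL b (zeroKet _)) * V.selR b (zeroKet _)) =
        ((termCoeff s t * (termNorm aKappa aBeta aGamma aDiff t /
          max (aKappa * aDiff ^ 2) (max (aBeta * aDiff) aGamma)) : ℝ) : ℂ)) ∧
    ((∀ t : TermIdx d, termNum t ≠ bitsVal b) →
      star (V.selL b (zeroKet _)) * V.selR b (zeroKet _) = 0)

end Unitaries

/-- `U` is the LCU Fourier unitary, with normalization `α`, of the degree-`K` Fourier sum with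
coefficients `c`, for some choice of the state-preparation pair. -/
def IsLCUFourier {d m K : ℕ} (E : FirstOrderPDE d m) (L : Fin d → ℝ) (α : ℝ)
    (c : (Fin d → ℤ) → ℂ)
    (U : Matrix (FouW d K ⊕ SysW d m → Bool) (FouW d K ⊕ SysW d m → Bool) ℂ) : Prop :=
  ∃ PL PR : Matrix (FouW d K → Bool) (FouW d K → Bool) ℂ,
    IsFourierPrep α c PL PR ∧ U = lcuFourier E L PL PR

/-! Every unitary in the construction arises from smaller ones by products, by embedding into more
wires, and by block-diagonal (multiplexed) sums. The proof therefore rests on a cost calculus that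
is stable under these operations. Its invariant is the cost of the controlled operator,
`CtrlCircuit`. A further control costs 10 gates, however long the circuit is: a Toffoli writes the
conjunction of the two controls into a work qubit, the work qubit controls the old circuit, and it
is then uncomputed (`CtrlCircuit.ctrl`). Descending a binary tree of selector bits, a multiplexer
costs the sum of its branches plus 22 per node (`MuxCost.fin`), while an operator applied at a
single basis state costs only 12 extra per bit (`PointCost.fin`).

The ingredients are then cheap. A state is prepared by preparing the amplitudes of one register and,
multiplexed on it, the conditional states of the rest. Branches are charged individually, so
branches without support are free; this gives a cost of order (2K+1)^d instead of the number of all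
ancilla basis states, which can be larger by a factor close to 2^d (`Prepable.rows`). A
state-preparation pair exists for every normalization at least the ℓ¹ norm, because the slack can be
put on an unused junk state (`exists_prep_pair`); one exists since 2K+1 and 4d+1 are odd and greater
than 1, hence not powers of two. The select operator of LCU Fourier is diagonal, and its phase is a
sum over directions of products of two affine functions of bits, so that one- and two-bit phases
suffice (`fourierSelect_circuit`). A difference operator is ±1/h times a cyclic shift with one
reweighted row minus a diagonal, a combination of two terms whose weights come from rotations of an
ancilla (`exists_difference_circuit`).

For the error, zero blocks of operators on disjoint ancillas multiply (`zeroBlock_mul`). The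
difference operators are encoded exactly and have norm at most α_D, so only the coefficient error
enters, multiplied by α_D once per difference factor; the moduli of the y_t sum to 3d+1
(`Unitaries.norm_opA_sub_le`). For the count, each of the 4d+1 branches costs O((2K+1)^d + n log K +
n), and n² absorbs everything that carries neither (2K+1)^d nor log K. -/

section

open Matrix Function
open scoped Kronecker
set_option linter.unusedSectionVars false

/-- Operators on a register with wires `W`. -/
abbrev QOp (W : Type) := Matrix (W → Bool) (W → Bool) ℂ

/-! ### Embedding operators into larger registers -/

section OnWires

variable {V W X : Type} [Fintype V] [Fintype W] [Fintype X]
  [DecidableEq V] [DecidableEq W] [DecidableEq X]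

/-- A basis state splits into its part on the wires in the range of `f` and the rest. -/
noncomputable def splitWires (f : V → W) (hf : Injective f) :
    (W → Bool) ≃ (V → Bool) × ({w // ∀ v, f v ≠ w} → Bool) :=
  Equiv.ofBijective (fun x => (x ∘ f, fun w => x w)) <| by
    constructor
    · intro x y h
      simp only [Prod.mk.injEq, funext_iff, Function.comp_apply, Subtype.forall] at h
      funext w
      by_cases hw : ∀ v, f v ≠ w
      · exact h.2 w hw
      · push Not at hw
        obtain ⟨v, rfl⟩ := hw
        exact h.1 v
    · rintro ⟨u, z⟩
      classical
      refine ⟨fun w => if h : ∃ v, f v = w then u h.choose else z ⟨w, fun v hv => h ⟨v, hv⟩⟩, ?_⟩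
      simp only [Prod.mk.injEq]
      constructor
      · funext v
        have h : ∃ v', f v' = f v := ⟨v, rfl⟩
        simp only [Function.comp_apply, dif_pos h]
        rw [hf h.choose_spec]
      · funext w
        have h : ¬ ∃ v, f v = w := by
          rintro ⟨v, hv⟩
          exact w.2 v hv
        simp only [dif_neg h]

/-- Up to a relabelling of the basis the embedding is a Kronecker product with the identity, so
multiplicativity and unitality follow from those of `⊗ₖ`. -/
theorem onWires_eq_kronecker (f : V → W) (hf : Injective f) (U : QOp V) :
    onWires f U = (U ⊗ₖ (1 : Matrix ({w // ∀ v, f v ≠ w} → Bool) _ ℂ)).submatrix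
      (splitWires f hf) (splitWires f hf) := by
  ext x y
  have h (x : W → Bool) : splitWires f hf x =
      (x ∘ f, fun w : {w // ∀ v, f v ≠ w} => x w) := rfl
  simp only [onWires, h, submatrix_apply, kroneckerMap_apply,
    one_apply, mul_ite, mul_one, mul_zero, funext_iff, Subtype.forall]

theorem onWires_mul (f : V → W) (hf : Injective f) (U U' : QOp V) :
    onWires f (U * U') = onWires f U * onWires f U' := by
  simp only [onWires_eq_kronecker f hf, submatrix_mul_equiv, ← mul_kronecker_mul, mul_one]

theorem onWires_one (f : V → W) (hf : Injective f) : onWires f (1 : QOp V) = 1 := by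
  simp only [onWires_eq_kronecker f hf, one_kronecker_one, submatrix_one_equiv]

theorem onWires_conjTranspose (f : V → W) (U : QOp V) :
    onWires f Uᴴ = (onWires f U)ᴴ := by
  ext x y
  simp only [onWires, conjTranspose_apply]
  by_cases h : ∀ w, (∀ v, f v ≠ w) → x w = y w
  · rw [if_pos h, if_pos fun w hw => (h w hw).symm]
  · rw [if_neg h, if_neg fun h' => h fun w hw => (h' w hw).symm, star_zero]

theorem onWires_comp (f : V → W) (g : W → X) (hg : Injective g) (U : QOp V) :
    onWires g (onWires f U) = onWires (g ∘ f) U := by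
  ext x y
  simp only [onWires]
  by_cases h : ∀ w, (∀ v, (g ∘ f) v ≠ w) → x w = y w
  · rw [if_pos h, if_pos, if_pos]
    · rfl
    · intro w hw
      exact h _ fun v hv => hw v (hg hv)
    · intro w hw
      exact h w fun v hv => hw (f v) hv
  · rw [if_neg h]
    by_cases h1 : ∀ w, (∀ v, g v ≠ w) → x w = y w
    · rw [if_pos h1, if_neg]
      intro h2
      apply h
      intro w hw
      by_cases hwg : ∀ v, g v ≠ w
      · exact h1 w hwg
      · push Not at hwg
        obtain ⟨v, rfl⟩ := hwg
        exact h2 v fun u hu => hw u (by simp [hu])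
    · rw [if_neg h1]

theorem onWires_equiv (e : V ≃ W) (U : QOp V) :
    onWires e U = fun x y => U (x ∘ e) (y ∘ e) := by
  ext x y
  simp only [onWires]
  rw [if_pos]
  intro w hw
  exact absurd (e.apply_symm_apply w) (hw _)

theorem onWires_mem_unitary (f : V → W) (hf : Injective f) {U : QOp V}
    (hU : U ∈ unitaryGroup (V → Bool) ℂ) : onWires f U ∈ unitaryGroup (W → Bool) ℂ := by
  rw [mem_unitaryGroup_iff, star_eq_conjTranspose] at hU ⊢
  rw [← onWires_conjTranspose, ← onWires_mul f hf, hU, onWires_one f hf]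

theorem conjTranspose_mem_unitary {n : Type} [Fintype n] [DecidableEq n] {U : Matrix n n ℂ}
    (hU : U ∈ unitaryGroup n ℂ) : Uᴴ ∈ unitaryGroup n ℂ := by
  rw [← star_eq_conjTranspose]
  exact Unitary.star_mem hU

theorem sum_sumArrow {M : Type} [AddCommMonoid M] (g : (V ⊕ W → Bool) → M) :
    ∑ z, g z = ∑ s, ∑ x, g (Sum.elim s x) := by
  rw [← Fintype.sum_prod_type' (f := fun s x => g (Sum.elim s x))]
  exact Fintype.sum_equiv (Equiv.sumArrowEquivProdArrow V W Bool) _ _ fun z => by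
    simp [Equiv.sumArrowEquivProdArrow]

theorem qop_sum_ext {A B : QOp (V ⊕ W)}
    (h : ∀ s x t y, A (Sum.elim s x) (Sum.elim t y) = B (Sum.elim s x) (Sum.elim t y)) :
    A = B := by
  ext z z'
  rw [← Sum.elim_comp_inl_inr z, ← Sum.elim_comp_inl_inr z']
  exact h _ _ _ _

theorem sumElim_eq_iff (s t : V → Bool) (x y : W → Bool) :
    Sum.elim s x = Sum.elim t y ↔ s = t ∧ x = y := Sum.elim_eq_iff

theorem onWires_inl_apply (U : QOp V) (s t : V → Bool) (x y : W → Bool) :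
    onWires (Sum.inl : V → V ⊕ W) U (Sum.elim s x) (Sum.elim t y) =
      if x = y then U s t else 0 := by
  simp only [onWires, Sum.elim_comp_inl]
  congr 1
  simp [funext_iff]

theorem onWires_inr_apply (U : QOp W) (s t : V → Bool) (x y : W → Bool) :
    onWires (Sum.inr : W → V ⊕ W) U (Sum.elim s x) (Sum.elim t y) =
      if s = t then U x y else 0 := by
  simp only [onWires, Sum.elim_comp_inr]
  congr 1
  simp [funext_iff]

end OnWires

/-! ### Multiplexed and controlled operators, linear combinations of unitaries -/

section Mux

variable {S V W : Type} [Fintype S] [Fintype V] [Fintype W]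
  [DecidableEq S] [DecidableEq V] [DecidableEq W]

/-- The block-diagonal operator `∑ₛ |s⟩⟨s| ⊗ F s`. -/
def mux (F : (S → Bool) → QOp W) : QOp (S ⊕ W) :=
  fun x y => if x ∘ Sum.inl = y ∘ Sum.inl then F (x ∘ Sum.inl) (x ∘ Sum.inr) (y ∘ Sum.inr) else 0

theorem mux_apply (F : (S → Bool) → QOp W) (s t : S → Bool) (x y : W → Bool) :
    mux F (Sum.elim s x) (Sum.elim t y) = if s = t then F s x y else 0 := rfl

theorem mux_mul (F G : (S → Bool) → QOp W) : mux F * mux G = mux fun s => F s * G s := by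
  apply qop_sum_ext
  intro s x t y
  simp only [mul_apply, sum_sumArrow, mux_apply]
  rw [Finset.sum_eq_single s]
  · by_cases h : s = t <;> simp [h]
  · intro b _ hb
    simp [Ne.symm hb]
  · simp

theorem mux_one : mux (fun _ : S → Bool => (1 : QOp W)) = 1 := by
  apply qop_sum_ext
  intro s x t y
  simp only [mux_apply, one_apply, sumElim_eq_iff]
  by_cases h : s = t <;> simp [h]

theorem mux_conjTranspose (F : (S → Bool) → QOp W) : (mux F)ᴴ = mux fun s => (F s)ᴴ := by
  apply qop_sum_ext
  intro s x t y
  simp only [conjTranspose_apply, mux_apply]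
  by_cases h : s = t
  · simp [h]
  · simp [h, Ne.symm h]

theorem mux_mem_unitary {F : (S → Bool) → QOp W}
    (hF : ∀ s, F s ∈ unitaryGroup (W → Bool) ℂ) : mux F ∈ unitaryGroup (S ⊕ W → Bool) ℂ := by
  rw [mem_unitaryGroup_iff, star_eq_conjTranspose, mux_conjTranspose, mux_mul, ← mux_one]
  congr 1
  funext s
  exact mem_unitaryGroup_iff.1 (hF s)

theorem mux_const (U : QOp W) : mux (fun _ : S → Bool => U) = onWires Sum.inr U := by
  apply qop_sum_ext
  intro s x t y
  rw [mux_apply, onWires_inr_apply]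

theorem mux_onWires (f : V → W) (F : (S → Bool) → QOp V) :
    mux (fun s => onWires f (F s)) = onWires (Sum.map id f) (mux F) := by
  apply qop_sum_ext
  intro s x t y
  have h1 : ∀ (s : S → Bool) (x : W → Bool), Sum.elim s x ∘ Sum.map id f = Sum.elim s (x ∘ f) := by
    intro s x
    funext i
    cases i <;> rfl
  simp only [onWires, mux_apply, h1]
  have h2 : (∀ w, (∀ v, Sum.map (id : S → S) f v ≠ w) →
      (Sum.elim s x w : Bool) = Sum.elim t y w) ↔ ∀ w, (∀ v, f v ≠ w) → x w = y w := by
    simp only [Sum.forall, Sum.map_inl, Sum.map_inr, Sum.elim_inl, Sum.elim_inr, id, ne_eq,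
      Sum.inl.injEq, Sum.inr.injEq, reduceCtorEq, not_false_eq_true, implies_true, and_true,
      true_and, and_iff_right_iff_imp]
    intro _ w hw
    exact absurd rfl (hw w)
  simp only [h2]
  split_ifs <;> rfl

/-- The operator applied if the control wire carries `true`. -/
def ctrl (U : QOp W) : QOp (Unit ⊕ W) := mux fun s => if s () then U else 1

theorem ctrl_mul (U U' : QOp W) : ctrl U * ctrl U' = ctrl (U * U') := by
  rw [ctrl, ctrl, mux_mul, ctrl]
  congr 1
  funext s
  split_ifs <;> simp

theorem ctrl_one : ctrl (1 : QOp W) = 1 := by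
  rw [ctrl]
  simp only [ite_self]
  exact mux_one

theorem ctrl_onWires (f : V → W) (hf : Injective f) (U : QOp V) :
    ctrl (onWires f U) = onWires (Sum.map id f) (ctrl U) := by
  rw [ctrl, ctrl, ← mux_onWires]
  congr 1
  funext s
  split_ifs
  · rfl
  · rw [onWires_one f hf]

theorem ctrl_conjTranspose (U : QOp W) : (ctrl U)ᴴ = ctrl Uᴴ := by
  rw [ctrl, mux_conjTranspose, ctrl]
  congr 1
  funext s
  split_ifs <;> simp

theorem ctrl_mem_unitary {U : QOp W} (hU : U ∈ unitaryGroup (W → Bool) ℂ) :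
    ctrl U ∈ unitaryGroup (Unit ⊕ W → Bool) ℂ := by
  apply mux_mem_unitary
  intro s
  split_ifs
  · exact hU
  · exact one_mem _

/-- The entry on `|0⟩` ancillas of a linear combination of the operators `F b`. -/
theorem lcu_apply (UL UR : QOp S) (F : (S → Bool) → QOp W) (s t : S → Bool) (x y : W → Bool) :
    ((onWires Sum.inl UL)ᴴ * mux F * onWires Sum.inl UR : QOp (S ⊕ W)) (Sum.elim s x) (Sum.elim t y) =
      ∑ b, star (UL b s) * UR b t * F b x y := by
  rw [← onWires_conjTranspose]
  simp only [mul_apply, sum_sumArrow, onWires_inl_apply, mux_apply, conjTranspose_apply]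
  refine Finset.sum_congr rfl fun b _ => ?_
  rw [Finset.sum_eq_single y]
  · rw [Finset.sum_eq_single b, Finset.sum_eq_single x]
    · simp only [if_true]
      ring
    · intro z _ hz
      simp [Ne.symm hz]
    · simp
    · intro c _ hc
      simp [hc]
    · simp
  · intro z _ hz
    simp [hz]
  · simp

end Mux

/-! ### Circuits with work qubits -/

section Circuits

variable {V W X T : Type} [Fintype V] [Fintype W] [Fintype X] [Fintype T]
  [DecidableEq V] [DecidableEq W] [DecidableEq X] [DecidableEq T]

/-- The gate moved along an injection of wires. -/
def TwoQubitGate.map (f : V → W) (hf : Injective f) (g : TwoQubitGate V) : TwoQubitGate W :=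
  ⟨f g.fst, f g.snd, hf.ne g.ne, g.mat, g.unitary⟩

/-- The inverse gate. -/
def TwoQubitGate.inv (g : TwoQubitGate W) : TwoQubitGate W :=
  ⟨g.fst, g.snd, g.ne, g.matᴴ, conjTranspose_mem_unitary g.unitary⟩

theorem TwoQubitGate.wires_injective (g : TwoQubitGate W) : Injective ![g.fst, g.snd] := by
  intro i j h
  have := g.ne
  fin_cases i <;> fin_cases j <;> simp_all

theorem circuitOp_map (f : V → W) (hf : Injective f) (C : List (TwoQubitGate V)) :
    circuitOp (C.map (TwoQubitGate.map f hf)) = onWires f (circuitOp C) := by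
  induction C with
  | nil => simp [circuitOp, onWires_one f hf]
  | cons g C ih =>
    simp only [List.map_cons, circuitOp, ih, onWires_mul f hf, onWires_comp _ _ hf]
    congr 2
    funext i
    fin_cases i <;> rfl

theorem circuitOp_append (C D : List (TwoQubitGate W)) :
    circuitOp (C ++ D) = circuitOp D * circuitOp C := by
  induction C with
  | nil => simp [circuitOp]
  | cons g C ih => simp only [List.cons_append, circuitOp, ih, Matrix.mul_assoc]

theorem circuitOp_mem_unitary (C : List (TwoQubitGate W)) :
    circuitOp C ∈ unitaryGroup (W → Bool) ℂ := by
  induction C with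
  | nil => exact one_mem _
  | cons g C ih => exact mul_mem ih (onWires_mem_unitary _ g.wires_injective g.unitary)

theorem circuitOp_reverse_inv (C : List (TwoQubitGate W)) :
    circuitOp (C.map TwoQubitGate.inv).reverse = (circuitOp C)ᴴ := by
  induction C with
  | nil => simp [circuitOp]
  | cons g C ih =>
    simp only [List.map_cons, List.reverse_cons, circuitOp_append, ih, circuitOp,
      conjTranspose_mul, Matrix.one_mul, ← onWires_conjTranspose]
    rfl

/-- `U' (|0⟩ ⊗ ψ) = |0⟩ ⊗ U ψ` for all `ψ`. -/
def Dilates (U' : QOp (T ⊕ W)) (U : QOp W) : Prop :=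
  ∀ (z : T → Bool) (x y : W → Bool),
    U' (Sum.elim z x) (Sum.elim (zeroKet T) y) = if z = zeroKet T then U x y else 0

theorem Dilates.mul {A' B' : QOp (T ⊕ W)} {A B : QOp W} (hA : Dilates A' A) (hB : Dilates B' B) :
    Dilates (A' * B') (A * B) := by
  intro z x y
  simp only [mul_apply, sum_sumArrow, hB _ _ y]
  rw [Finset.sum_eq_single (zeroKet T)]
  · simp only [if_true, hA z]
    split_ifs <;> simp
  · intro t _ ht
    simp [ht]
  · simp

theorem Dilates.one : Dilates (1 : QOp (T ⊕ W)) 1 := by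
  intro z x y
  simp only [one_apply, sumElim_eq_iff]
  split_ifs <;> simp_all

/-- The isometry `ψ ↦ |0⟩ ⊗ ψ`. -/
def zeroInj (T W : Type) [Fintype T] [Fintype W] : Matrix (T ⊕ W → Bool) (W → Bool) ℂ :=
  fun z y => if z = Sum.elim (zeroKet T) y then 1 else 0

/-- With the isometry J : ψ ↦ |0⟩ ⊗ ψ the condition is the intertwining relation U'J = JU, which can
be passed to adjoints without coordinates. -/
theorem dilates_iff {U' : QOp (T ⊕ W)} {U : QOp W} :
    Dilates U' U ↔ U' * zeroInj T W = zeroInj T W * U := by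
  have key : ∀ z x y,
      (U' * zeroInj T W) (Sum.elim z x) y = U' (Sum.elim z x) (Sum.elim (zeroKet T) y) ∧
      (zeroInj T W * U) (Sum.elim z x) y = if z = zeroKet T then U x y else 0 := by
    intro z x y
    simp only [mul_apply, zeroInj, mul_ite, mul_one, mul_zero, Finset.sum_ite_eq',
      Finset.mem_univ, if_true, sumElim_eq_iff, ite_mul, one_mul, zero_mul, true_and]
    by_cases h : z = zeroKet T <;> simp [h]
  constructor
  · intro h
    ext z y
    rw [← Sum.elim_comp_inl_inr z, (key _ _ _).1, (key _ _ _).2]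
    exact h _ _ _
  · intro h z x y
    rw [← (key z x y).1, h, (key z x y).2]

/-- Multiplying U'J = JU by U'† from the left and by U† from the right gives JU† = U'†J; unitarity
of both operators is what cancels the other factors. -/
theorem Dilates.conjTranspose {U' : QOp (T ⊕ W)} {U : QOp W} (h : Dilates U' U)
    (hU' : U' ∈ unitaryGroup (T ⊕ W → Bool) ℂ) (hU : U ∈ unitaryGroup (W → Bool) ℂ) :
    Dilates U'ᴴ Uᴴ := by
  rw [dilates_iff] at h ⊢
  rw [mem_unitaryGroup_iff', star_eq_conjTranspose] at hU'
  rw [mem_unitaryGroup_iff, star_eq_conjTranspose] at hU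
  calc U'ᴴ * zeroInj T W = U'ᴴ * (zeroInj T W * U) * Uᴴ := by
        simp only [Matrix.mul_assoc, hU, Matrix.mul_one]
    _ = (U'ᴴ * U') * zeroInj T W * Uᴴ := by rw [← h, Matrix.mul_assoc U'ᴴ U']
    _ = zeroInj T W * Uᴴ := by rw [hU', Matrix.one_mul]

theorem Dilates.onWires {U' : QOp (T ⊕ V)} {U : QOp V} (h : Dilates U' U) (f : V → W) :
    Dilates (_root_.onWires (Sum.map id f) U') (_root_.onWires f U) := by
  intro z x y
  have h1 : ∀ (s : T → Bool) (x : W → Bool), Sum.elim s x ∘ Sum.map id f = Sum.elim s (x ∘ f) := by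
    intro s x
    funext i
    cases i <;> rfl
  simp only [_root_.onWires, h1, h _ _ _]
  have h2 : (∀ w, (∀ v, Sum.map (id : T → T) f v ≠ w) →
      (Sum.elim z x w : Bool) = Sum.elim (zeroKet T) y w) ↔
        ∀ w, (∀ v, f v ≠ w) → x w = y w := by
    simp only [Sum.forall, Sum.map_inl, Sum.map_inr, Sum.elim_inl, Sum.elim_inr, id, ne_eq,
      Sum.inl.injEq, Sum.inr.injEq, reduceCtorEq, not_false_eq_true, implies_true, and_true,
      true_and, and_iff_right_iff_imp]
    intro _ w hw
    exact absurd rfl (hw w)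
  simp only [h2]
  split_ifs <;> rfl

/-- Spectator ancillas can be added. -/
theorem Dilates.extend {U' : QOp (T ⊕ W)} {U : QOp W} (h : Dilates U' U) (f : T → X) :
    Dilates (_root_.onWires (Sum.map f id) U') U := by
  intro z x y
  have h1 : ∀ (s : X → Bool) (x : W → Bool), Sum.elim s x ∘ Sum.map f id = Sum.elim (s ∘ f) x := by
    intro s x
    funext i
    cases i <;> rfl
  have h0 : zeroKet X ∘ f = zeroKet T := rfl
  simp only [_root_.onWires, h1, h0, h _ _ _]
  have h2 : (∀ w, (∀ v, Sum.map f (id : W → W) v ≠ w) →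
      (Sum.elim z x w : Bool) = Sum.elim (zeroKet X) y w) ↔
        ∀ w, (∀ v, f v ≠ w) → z w = false := by
    simp only [Sum.forall, Sum.map_inl, Sum.map_inr, Sum.elim_inl, Sum.elim_inr, id, ne_eq,
      Sum.inl.injEq, Sum.inr.injEq, reduceCtorEq, not_false_eq_true, implies_true, and_true,
      true_and, and_iff_left_iff_imp, zeroKet]
    intro _ w hw
    exact absurd rfl (hw w)
  simp only [h2]
  have h3 : z = zeroKet X ↔ (∀ w, (∀ v, f v ≠ w) → z w = false) ∧ z ∘ f = zeroKet T := by
    simp only [funext_iff, Function.comp_apply, zeroKet]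
    constructor
    · exact fun h => ⟨fun w _ => h w, fun v => h _⟩
    · rintro ⟨ha, hb⟩ w
      by_cases hw : ∀ v, f v ≠ w
      · exact ha w hw
      · push Not at hw
        obtain ⟨v, rfl⟩ := hw
        exact hb v
  simp only [h3]
  split_ifs <;> simp_all

/-- The wires `T`, which the intermediate operator already returns to zero, join the work qubits `X`
of the outer dilation. -/
theorem Dilates.trans {U'' : QOp (X ⊕ (T ⊕ W))} {U' : QOp (T ⊕ W)} {U : QOp W}
    (h' : Dilates U'' U') (h : Dilates U' U) :
    Dilates (_root_.onWires (Equiv.sumAssoc X T W).symm U'') U := by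
  intro z x y
  rw [onWires_equiv]
  have h1 : ∀ (s : X ⊕ T → Bool) (x : W → Bool), Sum.elim s x ∘ (Equiv.sumAssoc X T W).symm =
      Sum.elim (s ∘ Sum.inl) (Sum.elim (s ∘ Sum.inr) x) := by
    intro s x
    funext i
    rcases i with i | i | i <;> rfl
  have h2 : zeroKet (X ⊕ T) ∘ Sum.inl = zeroKet X := rfl
  have h3 : zeroKet (X ⊕ T) ∘ Sum.inr = zeroKet T := rfl
  simp only [h1, h2, h3, h' _ _ _, h _ _ _]
  have h4 : z = zeroKet (X ⊕ T) ↔ z ∘ Sum.inl = zeroKet X ∧ z ∘ Sum.inr = zeroKet T := by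
    simp [funext_iff, zeroKet]
  simp only [h4]
  split_ifs <;> simp_all

/-- `U` is implemented exactly by a circuit of at most `n` two-qubit gates. -/
def HasCircuit (U : QOp W) (n : ℕ) : Prop :=
  ∃ (T : Type) (_ : Fintype T) (_ : DecidableEq T) (C : List (TwoQubitGate (T ⊕ W))),
    Dilates (circuitOp C) U ∧ C.length ≤ n

theorem HasCircuit.mono {U : QOp W} {n n' : ℕ} (h : HasCircuit U n) (hn : n ≤ n') :
    HasCircuit U n' := by
  obtain ⟨T, i1, i2, C, hC, hl⟩ := h
  exact ⟨T, i1, i2, C, hC, hl.trans hn⟩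

theorem HasCircuit.one : HasCircuit (1 : QOp W) 0 :=
  ⟨Empty, inferInstance, inferInstance, [], Dilates.one, le_rfl⟩

/-- The two circuits receive disjoint work qubits. Only gates are counted, so nothing is gained by
sharing them. -/
theorem HasCircuit.mul {A B : QOp W} {n n' : ℕ} (hA : HasCircuit A n) (hB : HasCircuit B n') :
    HasCircuit (A * B) (n + n') := by
  obtain ⟨T, i1, i2, C, hC, hl⟩ := hA
  obtain ⟨X, i3, i4, D, hD, hl'⟩ := hB
  refine ⟨T ⊕ X, inferInstance, inferInstance,
    D.map (TwoQubitGate.map (Sum.map Sum.inr id) (Sum.inr_injective.sumMap injective_id)) ++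
    C.map (TwoQubitGate.map (Sum.map Sum.inl id) (Sum.inl_injective.sumMap injective_id)), ?_, ?_⟩
  · rw [circuitOp_append, circuitOp_map, circuitOp_map]
    exact (hC.extend _).mul (hD.extend _)
  · simp only [List.length_append, List.length_map]
    omega

theorem HasCircuit.onWires {U : QOp V} {n : ℕ} (h : HasCircuit U n) (f : V → W)
    (hf : Injective f) : HasCircuit (_root_.onWires f U) n := by
  obtain ⟨T, i1, i2, C, hC, hl⟩ := h
  refine ⟨T, i1, i2, C.map (TwoQubitGate.map (Sum.map id f) (injective_id.sumMap hf)), ?_, ?_⟩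
  · rw [circuitOp_map]
    exact hC.onWires f
  · simpa using hl

theorem HasCircuit.of_dilates {U' : QOp (T ⊕ W)} {U : QOp W} {n : ℕ} (h : HasCircuit U' n)
    (hd : Dilates U' U) : HasCircuit U n := by
  obtain ⟨X, i1, i2, C, hC, hl⟩ := h
  refine ⟨X ⊕ T, inferInstance, inferInstance,
    C.map (TwoQubitGate.map (Equiv.sumAssoc X T W).symm (Equiv.injective _)), ?_, ?_⟩
  · rw [circuitOp_map]
    exact hC.trans hd
  · simpa using hl

theorem HasCircuit.conjTranspose {U : QOp W} {n : ℕ} (h : HasCircuit U n)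
    (hU : U ∈ unitaryGroup (W → Bool) ℂ) : HasCircuit Uᴴ n := by
  obtain ⟨T, i1, i2, C, hC, hl⟩ := h
  refine ⟨T, i1, i2, (C.map TwoQubitGate.inv).reverse, ?_, ?_⟩
  · rw [circuitOp_reverse_inv]
    exact hC.conjTranspose (circuitOp_mem_unitary C) hU
  · simpa using hl

theorem HasCircuit.two_qubit {U : QOp (Unit ⊕ Unit)}
    (hU : U ∈ unitaryGroup (Unit ⊕ Unit → Bool) ℂ) : HasCircuit U 1 := by
  let e : Unit ⊕ Unit ≃ Fin 2 :=
    ⟨Sum.elim (fun _ => 0) (fun _ => 1), ![Sum.inl (), Sum.inr ()],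
      by rintro (_ | _) <;> rfl, by intro i; fin_cases i <;> rfl⟩
  refine ⟨Empty, inferInstance, inferInstance,
    [⟨Sum.inr (Sum.inl ()), Sum.inr (Sum.inr ()), by simp, _root_.onWires e U,
      onWires_mem_unitary e e.injective hU⟩], ?_, le_rfl⟩
  have hinj : Injective (![Sum.inr (Sum.inl ()), Sum.inr (Sum.inr ())] :
      Fin 2 → Empty ⊕ (Unit ⊕ Unit)) := by
    intro i j h
    fin_cases i <;> fin_cases j <;> simp_all
  have h1 : (![Sum.inr (Sum.inl ()), Sum.inr (Sum.inr ())] :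
      Fin 2 → Empty ⊕ (Unit ⊕ Unit)) ∘ e = Sum.inr := by
    funext i
    rcases i with _ | _ <;> rfl
  simp only [circuitOp, Matrix.one_mul]
  rw [onWires_comp _ _ hinj, h1]
  intro z x y
  rw [onWires_inr_apply]

theorem HasCircuit.of_fin {U : QOp W} {n : ℕ} (h : HasCircuit U n) :
    ∃ (w : ℕ) (C : List (TwoQubitGate (Fin w ⊕ W))), Implements C U ∧ C.length ≤ n := by
  obtain ⟨T, i1, i2, C, hC, hl⟩ := h
  have e := Fintype.equivFin T
  refine ⟨Fintype.card T,
    C.map (TwoQubitGate.map (Sum.map e id) (e.injective.sumMap injective_id)), ?_, ?_⟩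
  · have := hC.extend e
    rw [← circuitOp_map _ (e.injective.sumMap injective_id)] at this
    exact this
  · simpa using hl

end Circuits

/-! ### The cost of controls and multiplexers -/

section Gates

variable {V W X T S S' : Type} [Fintype V] [Fintype W] [Fintype X] [Fintype T] [Fintype S]
  [Fintype S'] [DecidableEq V] [DecidableEq W] [DecidableEq X] [DecidableEq T] [DecidableEq S]
  [DecidableEq S']

/-- A single-qubit operator. -/
def oneQ (M : Matrix Bool Bool ℂ) : QOp Unit := fun x y => M (x ()) (y ())

theorem oneQ_eq (M : Matrix Bool Bool ℂ) :
    oneQ M = M.submatrix (Equiv.funUnique Unit Bool) (Equiv.funUnique Unit Bool) := rfl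

theorem oneQ_mul (M N : Matrix Bool Bool ℂ) : oneQ M * oneQ N = oneQ (M * N) := by
  simp only [oneQ_eq, submatrix_mul_equiv]

theorem oneQ_one : oneQ 1 = 1 := by
  simp only [oneQ_eq, submatrix_one_equiv]

theorem oneQ_conjTranspose (M : Matrix Bool Bool ℂ) : (oneQ M)ᴴ = oneQ Mᴴ := rfl

theorem oneQ_mem_unitary {M : Matrix Bool Bool ℂ} (hM : M ∈ unitaryGroup Bool ℂ) :
    oneQ M ∈ unitaryGroup (Unit → Bool) ℂ := by
  rw [mem_unitaryGroup_iff, star_eq_conjTranspose] at hM ⊢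
  rw [oneQ_conjTranspose, oneQ_mul, hM, oneQ_one]

/-- The Pauli operator `X`. -/
def pauliX : Matrix Bool Bool ℂ := fun a b => if a = !b then 1 else 0

theorem pauliX_unitary : pauliX ∈ unitaryGroup Bool ℂ := by
  rw [mem_unitaryGroup_iff]
  ext a b
  cases a <;> cases b <;> simp [pauliX, mul_apply, star_apply]

/-- A square root of the Pauli operator `X`. -/
noncomputable def sqrtX : Matrix Bool Bool ℂ :=
  fun a b => if a = b then (1 + Complex.I) / 2 else (1 - Complex.I) / 2

theorem sqrtX_unitary : sqrtX ∈ unitaryGroup Bool ℂ := by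
  rw [mem_unitaryGroup_iff]
  ext a b
  have h2 : (starRingEnd ℂ) 2 = 2 := Complex.conj_ofNat 2
  cases a <;> cases b <;> simp [sqrtX, mul_apply, star_apply, h2] <;> ring_nf <;> simp <;> norm_num

theorem sqrtX_mul_self : sqrtX * sqrtX = pauliX := by
  ext a b
  cases a <;> cases b <;> simp [sqrtX, pauliX, mul_apply] <;> ring_nf <;> simp <;> norm_num

/-- The operator `|x⟩ ↦ |σ x⟩`. -/
def permOp (σ : (W → Bool) → (W → Bool)) : QOp W := fun x y => if x = σ y then 1 else 0

theorem mul_permOp (σ : (W → Bool) → (W → Bool)) (U : QOp W) (x y : W → Bool) :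
    (U * permOp σ) x y = U x (σ y) := by
  simp [permOp, mul_apply]

theorem permOp_mul {σ : (W → Bool) → (W → Bool)} (hσ : Involutive σ) (U : QOp W)
    (x y : W → Bool) : (permOp σ * U) x y = U (σ x) y := by
  simp only [permOp, mul_apply, ite_mul, one_mul, zero_mul]
  rw [Finset.sum_eq_single (σ x)]
  · simp [hσ x]
  · intro z _ hz
    rw [if_neg]
    rintro rfl
    exact hz (hσ z).symm
  · simp

theorem permOp_conj {σ : (W → Bool) → (W → Bool)} (hσ : Involutive σ) (U : QOp W)
    (x y : W → Bool) : (permOp σ * U * permOp σ) x y = U (σ x) (σ y) := by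
  rw [mul_permOp, permOp_mul hσ]

theorem permOp_mem_unitary {σ : (W → Bool) → (W → Bool)} (hσ : Bijective σ) :
    permOp σ ∈ unitaryGroup (W → Bool) ℂ := by
  rw [mem_unitaryGroup_iff']
  ext x y
  simp only [star_eq_conjTranspose, mul_permOp, conjTranspose_apply, permOp, one_apply,
    hσ.injective.eq_iff, eq_comm (a := y)]
  split_ifs <;> simp

theorem flip_eq_permOp : onWires (Sum.inl : Unit → Unit ⊕ W) (oneQ pauliX) =
    permOp fun z => Sum.elim (fun _ => !z (Sum.inl ())) (z ∘ Sum.inr) := by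
  apply qop_sum_ext
  intro s x t y
  rw [onWires_inl_apply]
  simp only [oneQ, pauliX, permOp, Sum.elim_inl, Sum.elim_comp_inr, sumElim_eq_iff]
  have hs : (s = fun _ => !t ()) ↔ s () = !t () := ⟨fun h => congrFun h (), fun h => funext fun _ => h⟩
  simp only [hs]
  by_cases h : x = y <;> simp [h]

theorem flip_mux_flip (F : (Unit → Bool) → QOp W) :
    onWires Sum.inl (oneQ pauliX) * mux F * onWires Sum.inl (oneQ pauliX) =
      mux fun s => F fun _ => !s () := by
  rw [flip_eq_permOp]
  have hi : Involutive fun z : Unit ⊕ W → Bool =>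
      Sum.elim (fun _ => !z (Sum.inl ())) (z ∘ Sum.inr) := by
    intro z
    funext i
    rcases i with i | i <;> simp
  apply qop_sum_ext
  intro s x t y
  rw [permOp_conj hi, mux_apply, mux_apply]
  simp only [funext_iff, Sum.elim_inl, Sum.elim_comp_inr, Bool.not_inj_iff]

theorem HasCircuit.ctrl_oneQ {M : Matrix Bool Bool ℂ} (hM : M ∈ unitaryGroup Bool ℂ) :
    HasCircuit (ctrl (oneQ M)) 1 :=
  .two_qubit (ctrl_mem_unitary (oneQ_mem_unitary hM))

theorem HasCircuit.oneQ {M : Matrix Bool Bool ℂ} (hM : M ∈ unitaryGroup Bool ℂ) :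
    HasCircuit (oneQ M) 1 := by
  have h : HasCircuit (_root_.onWires (Sum.inr : Unit → Unit ⊕ Unit) (_root_.oneQ M)) 1 :=
    .two_qubit (onWires_mem_unitary _ Sum.inr_injective (oneQ_mem_unitary hM))
  refine h.of_dilates fun z x y => ?_
  rw [onWires_inr_apply]

/-- The standard decomposition of a doubly controlled square. If both controls are set, A† is
switched off by the flip and A acts twice; if only the outer one is set, A meets A†; if the outer
one is not set, the two inner controlled gates cancel. For a single-qubit A this makes five
two-qubit gates. -/
theorem ctrl_ctrl_mul_self {A : QOp W} (hA : A ∈ unitaryGroup (W → Bool) ℂ) :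
    ctrl (ctrl (A * A)) =
      ctrl (onWires Sum.inr A) * onWires Sum.inr (ctrl A) * ctrl (onWires Sum.inl (oneQ pauliX)) *
        onWires Sum.inr (ctrl Aᴴ) * ctrl (onWires Sum.inl (oneQ pauliX)) := by
  rw [mem_unitaryGroup_iff, star_eq_conjTranspose] at hA
  simp only [← mux_const (S := Unit) (ctrl A), ← mux_const (S := Unit) (ctrl Aᴴ)]
  simp only [ctrl, mux_mul]
  congr 1
  funext s
  by_cases hs : s ()
  · simp only [hs, if_true]
    simp only [Matrix.mul_assoc]
    rw [← Matrix.mul_assoc (onWires Sum.inl (oneQ pauliX)), flip_mux_flip, ← mux_const (S := Unit),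
      mux_mul, mux_mul]
    congr 1
    funext t
    by_cases ht : t () <;> simp [ht, hA]
  · simp only [hs]
    simp only [Bool.false_eq_true, if_false, Matrix.one_mul, Matrix.mul_one, mux_mul]
    symm
    rw [← mux_one]
    congr 1
    funext t
    by_cases ht : t () <;> simp [ht, hA]

/-- The controlled operator is implemented by a circuit of at most `n` two-qubit gates. -/
def CtrlCircuit (U : QOp W) (n : ℕ) : Prop := HasCircuit (ctrl U) n

theorem CtrlCircuit.mono {U : QOp W} {n n' : ℕ} (h : CtrlCircuit U n) (hn : n ≤ n') :
    CtrlCircuit U n' := HasCircuit.mono h hn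

theorem CtrlCircuit.one : CtrlCircuit (1 : QOp W) 0 := by
  rw [CtrlCircuit, ctrl_one]
  exact HasCircuit.one

theorem CtrlCircuit.mul {A B : QOp W} {n n' : ℕ} (hA : CtrlCircuit A n)
    (hB : CtrlCircuit B n') : CtrlCircuit (A * B) (n + n') := by
  rw [CtrlCircuit, ← ctrl_mul]
  exact HasCircuit.mul hA hB

theorem CtrlCircuit.onWires {U : QOp V} {n : ℕ} (h : CtrlCircuit U n) (f : V → W)
    (hf : Injective f) : CtrlCircuit (_root_.onWires f U) n := by
  rw [CtrlCircuit, ctrl_onWires f hf]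
  exact HasCircuit.onWires h _ (injective_id.sumMap hf)

theorem CtrlCircuit.conjTranspose {U : QOp W} {n : ℕ} (h : CtrlCircuit U n)
    (hU : U ∈ unitaryGroup (W → Bool) ℂ) : CtrlCircuit Uᴴ n := by
  rw [CtrlCircuit, ← ctrl_conjTranspose]
  exact HasCircuit.conjTranspose h (ctrl_mem_unitary hU)

theorem CtrlCircuit.oneQ {M : Matrix Bool Bool ℂ} (hM : M ∈ unitaryGroup Bool ℂ) :
    CtrlCircuit (oneQ M) 1 := HasCircuit.ctrl_oneQ hM

/-- A controlled global phase is a phase gate on the control wire alone. -/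
theorem CtrlCircuit.phase {c : ℂ} (hc : ‖c‖ = 1) : CtrlCircuit (c • (1 : QOp W)) 1 := by
  let M : Matrix Bool Bool ℂ := diagonal fun b => if b then c else 1
  have hM : M ∈ unitaryGroup Bool ℂ := by
    rw [mem_unitaryGroup_iff, star_eq_conjTranspose, diagonal_conjTranspose, diagonal_mul_diagonal,
      ← diagonal_one]
    congr 1
    funext b
    cases b
    · simp
    · simp [Complex.mul_conj, Complex.normSq_eq_norm_sq, hc]
  have h : ctrl (c • (1 : QOp W)) = _root_.onWires Sum.inl (_root_.oneQ M) := by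
    apply qop_sum_ext
    intro s x t y
    rw [onWires_inl_apply, ctrl, mux_apply]
    simp only [_root_.oneQ, M, diagonal_apply, funext_iff]
    cases hs : s () <;> cases ht : t () <;> simp [hs, ht, one_apply, funext_iff]
  rw [CtrlCircuit, h]
  exact (HasCircuit.oneQ hM).onWires _ Sum.inl_injective

theorem CtrlCircuit.smul {U : QOp W} {n : ℕ} {c : ℂ} (h : CtrlCircuit U n) (hc : ‖c‖ = 1) :
    CtrlCircuit (c • U) (n + 1) := by
  have := h.mul (CtrlCircuit.phase (W := W) hc)
  rwa [Matrix.mul_smul, Matrix.mul_one] at this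

theorem HasCircuit.toffoli : HasCircuit (ctrl (ctrl (_root_.oneQ pauliX))) 5 := by
  rw [← sqrtX_mul_self, ← oneQ_mul, ctrl_ctrl_mul_self (oneQ_mem_unitary sqrtX_unitary)]
  have h1 : HasCircuit (ctrl (_root_.onWires (Sum.inr : Unit → Unit ⊕ Unit) (_root_.oneQ sqrtX)))
      1 := (CtrlCircuit.oneQ sqrtX_unitary).onWires _ Sum.inr_injective
  have h2 : HasCircuit (_root_.onWires (Sum.inr : Unit ⊕ Unit → Unit ⊕ (Unit ⊕ Unit))
      (ctrl (_root_.oneQ sqrtX))) 1 :=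
    (HasCircuit.ctrl_oneQ sqrtX_unitary).onWires _ Sum.inr_injective
  have h3 : HasCircuit (ctrl (_root_.onWires (Sum.inl : Unit → Unit ⊕ Unit)
      (_root_.oneQ pauliX))) 1 := (CtrlCircuit.oneQ pauliX_unitary).onWires _ Sum.inl_injective
  have h4 : HasCircuit (_root_.onWires (Sum.inr : Unit ⊕ Unit → Unit ⊕ (Unit ⊕ Unit))
      (ctrl (_root_.oneQ sqrtX)ᴴ)) 1 := by
    rw [oneQ_conjTranspose]
    exact (HasCircuit.ctrl_oneQ (conjTranspose_mem_unitary sqrtX_unitary)).onWires _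
      Sum.inr_injective
  exact (((h1.mul h2).mul h3).mul h4).mul h3

/-- The basis state with `b` on the first wire and `x` on the others. -/
def qcons (b : Bool) (x : W → Bool) : Unit ⊕ W → Bool := Sum.elim (fun _ => b) x

theorem exists_qcons (z : Unit ⊕ W → Bool) : ∃ b x, z = qcons b x :=
  ⟨z (Sum.inl ()), z ∘ Sum.inr, (Sum.elim_comp_inl_inr z).symm⟩

theorem qcons_inj {a b : Bool} {x y : W → Bool} : qcons a x = qcons b y ↔ a = b ∧ x = y := by
  rw [qcons, qcons, sumElim_eq_iff]
  exact and_congr_left' ⟨fun h => congrFun h (), fun h => funext fun _ => h⟩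

theorem ctrl_qcons (U : QOp W) (a b : Bool) (x y : W → Bool) :
    ctrl U (qcons a x) (qcons b y) =
      if a = b then (if a then U x y else if x = y then 1 else 0) else 0 := by
  rw [ctrl, qcons, qcons, mux_apply]
  have h : ((fun _ : Unit => a) = fun _ => b) ↔ a = b :=
    ⟨fun h => congrFun h (), fun h => funext fun _ => h⟩
  simp only [h]
  cases a <;> simp [one_apply]

theorem onWires_apply_of_iff (f : V → W) (U : QOp V) (x y : W → Bool) {p : Prop} [Decidable p]
    (hp : (∀ w, (∀ v, f v ≠ w) → x w = y w) ↔ p) :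
    onWires f U x y = if p then U (x ∘ f) (y ∘ f) else 0 := by
  simp only [onWires, hp]

/-- The ancilla is flipped if both control wires carry `true`. -/
def andFlip (z : Unit ⊕ (Unit ⊕ (Unit ⊕ W)) → Bool) : Unit ⊕ (Unit ⊕ (Unit ⊕ W)) → Bool :=
  qcons (xor (z (Sum.inl ())) (z (Sum.inr (Sum.inl ())) && z (Sum.inr (Sum.inr (Sum.inl ())))))
    (z ∘ Sum.inr)

theorem andFlip_qcons (a b c : Bool) (x : W → Bool) :
    andFlip (qcons a (qcons b (qcons c x))) = qcons (xor a (b && c)) (qcons b (qcons c x)) := rfl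

theorem andFlip_involutive : Involutive (andFlip (W := W)) := by
  intro z
  obtain ⟨a, z, rfl⟩ := exists_qcons z
  obtain ⟨b, z, rfl⟩ := exists_qcons z
  obtain ⟨c, z, rfl⟩ := exists_qcons z
  simp [andFlip_qcons]

theorem HasCircuit.andFlip : HasCircuit (permOp (andFlip (W := W))) 5 := by
  let f : Unit ⊕ (Unit ⊕ Unit) → Unit ⊕ (Unit ⊕ (Unit ⊕ W)) :=
    Sum.elim (fun _ => Sum.inr (Sum.inl ())) (Sum.elim (fun _ => Sum.inr (Sum.inr (Sum.inl ())))
      (fun _ => Sum.inl ()))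
  have hf : Injective f := by
    rintro (_ | _ | _) (_ | _ | _) h <;> simp_all [f]
  have h := HasCircuit.toffoli.onWires f hf
  convert h using 1
  ext z z'
  obtain ⟨a, z, rfl⟩ := exists_qcons z
  obtain ⟨b, z, rfl⟩ := exists_qcons z
  obtain ⟨c, x, rfl⟩ := exists_qcons z
  obtain ⟨a', z', rfl⟩ := exists_qcons z'
  obtain ⟨b', z', rfl⟩ := exists_qcons z'
  obtain ⟨c', y, rfl⟩ := exists_qcons z'
  have hp : (∀ w, (∀ v, f v ≠ w) → qcons a (qcons b (qcons c x)) w =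
      qcons a' (qcons b' (qcons c' y)) w) ↔ x = y := by
    constructor
    · intro h
      funext w
      exact h (Sum.inr (Sum.inr (Sum.inr w))) (by rintro (_ | _ | _) <;> simp [f])
    · rintro rfl (_ | _ | _ | w) hw
      · exact absurd rfl (hw (Sum.inr (Sum.inr ())))
      · exact absurd rfl (hw (Sum.inl ()))
      · exact absurd rfl (hw (Sum.inr (Sum.inl ())))
      · rfl
  have hc : ∀ (a b c : Bool) (x : W → Bool), qcons a (qcons b (qcons c x)) ∘ f =
      qcons b (qcons c fun _ => a) := by
    intro a b c x
    funext i
    rcases i with _ | _ | _ <;> rfl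
  have hu : ((fun _ : Unit => a) = fun _ => a') ↔ a = a' :=
    ⟨fun h => congrFun h (), fun h => funext fun _ => h⟩
  rw [onWires_apply_of_iff _ _ _ _ hp, hc, hc, permOp, andFlip_qcons]
  simp only [ctrl_qcons, qcons_inj, _root_.oneQ, pauliX, hu]
  by_cases hx : x = y
  · cases a <;> cases b <;> cases c <;> cases a' <;> cases b' <;> cases c' <;> simp [hx]
  · simp [hx]

/-- A work qubit is set to the conjunction of the two controls, serves as the control of the given
circuit, and is reset by the same Toffoli: 5 + 5 extra gates, independently of `n`. That the
overhead is additive is what keeps nested controls affordable. -/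
theorem CtrlCircuit.ctrl {U : QOp W} {n : ℕ} (h : CtrlCircuit U n) :
    CtrlCircuit (ctrl U) (n + 10) := by
  let f : Unit ⊕ W → Unit ⊕ (Unit ⊕ (Unit ⊕ W)) :=
    Sum.elim (fun _ => Sum.inl ()) fun w => Sum.inr (Sum.inr (Sum.inr w))
  have hf : Injective f := by
    rintro (_ | _) (_ | _) h <;> simp_all [f]
  have h1 := (HasCircuit.andFlip.mul (HasCircuit.onWires h f hf)).mul HasCircuit.andFlip
  refine (h1.of_dilates ?_).mono (by omega)
  intro z' z z''
  have hz' : z' = fun _ => z' () := rfl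
  rw [hz']
  generalize z' () = a
  obtain ⟨b, z, rfl⟩ := exists_qcons z
  obtain ⟨c, x, rfl⟩ := exists_qcons z
  obtain ⟨b', z'', rfl⟩ := exists_qcons z''
  obtain ⟨c', y, rfl⟩ := exists_qcons z''
  rw [permOp_conj andFlip_involutive]
  change _root_.onWires f (_root_.ctrl U) (_root_.andFlip (qcons a (qcons b (qcons c x))))
    (_root_.andFlip (qcons false (qcons b' (qcons c' y)))) = _
  rw [andFlip_qcons, andFlip_qcons]
  have hu : ((fun _ : Unit => a) = zeroKet Unit) ↔ a = false :=
    ⟨fun h => congrFun h (), fun h => funext fun _ => h⟩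
  have hp : ∀ a a', (∀ w, (∀ v, f v ≠ w) → qcons a (qcons b (qcons c x)) w =
      qcons a' (qcons b' (qcons c' y)) w) ↔ b = b' ∧ c = c' := by
    intro a a'
    constructor
    · intro h
      exact ⟨h (Sum.inr (Sum.inl ())) (by rintro (_ | _) <;> simp [f]),
        h (Sum.inr (Sum.inr (Sum.inl ()))) (by rintro (_ | _) <;> simp [f])⟩
    · rintro ⟨rfl, rfl⟩ (_ | _ | _ | w) hw
      · exact absurd rfl (hw (Sum.inl ()))
      · rfl
      · rfl
      · exact absurd rfl (hw (Sum.inr w))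
  have hc : ∀ (a b c : Bool) (x : W → Bool), qcons a (qcons b (qcons c x)) ∘ f = qcons a x := by
    intro a b c x
    funext i
    rcases i with _ | _ <;> rfl
  rw [onWires_apply_of_iff _ _ _ _ (hp _ _), hc, hc]
  simp only [ctrl_qcons, qcons_inj, hu]
  cases a <;> cases b <;> cases c <;> cases b' <;> cases c' <;> simp

/-- A work qubit flipped to `true` plays the control and is flipped back afterwards. -/
theorem CtrlCircuit.hasCircuit {U : QOp W} {n : ℕ} (h : CtrlCircuit U n) :
    HasCircuit U (n + 2) := by
  have hX : HasCircuit (_root_.onWires (Sum.inl : Unit → Unit ⊕ W) (_root_.oneQ pauliX)) 1 :=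
    (HasCircuit.oneQ pauliX_unitary).onWires _ Sum.inl_injective
  have h1 := (hX.mul h).mul hX
  rw [_root_.ctrl, flip_mux_flip] at h1
  refine (h1.of_dilates ?_).mono (by omega)
  intro z x y
  rw [mux_apply]
  by_cases hz : z = zeroKet Unit
  · simp [hz, zeroKet]
  · simp [hz]

theorem CtrlCircuit.flip : CtrlCircuit
    (_root_.onWires (Sum.inl : Unit → Unit ⊕ W) (_root_.oneQ pauliX)) 1 :=
  (CtrlCircuit.oneQ pauliX_unitary).onWires _ Sum.inl_injective

theorem CtrlCircuit.ctrl_false {U : QOp W} {n : ℕ} (h : CtrlCircuit U n) :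
    CtrlCircuit (mux fun s : Unit → Bool => if s () then 1 else U) (n + 12) := by
  have h1 := (CtrlCircuit.flip.mul h.ctrl).mul CtrlCircuit.flip
  rw [_root_.ctrl, flip_mux_flip] at h1
  convert h1.mono (show _ ≤ n + 12 by omega) using 3 with s
  cases s () <;> simp

/-- Any multiplexed operator with controls `S` has the cost of the operators it applies plus `κ`. -/
def MuxCost (S : Type) [Fintype S] [DecidableEq S] (κ : ℕ) : Prop :=
  ∀ (W : Type) [Fintype W] [DecidableEq W] (F : (S → Bool) → QOp W) (n : (S → Bool) → ℕ),
    (∀ s, CtrlCircuit (F s) (n s)) → CtrlCircuit (mux F) (∑ s, n s + κ)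

/-- An operator applied in one state of the control wires `S` has an overhead of `κ`. -/
def PointCost (S : Type) [Fintype S] [DecidableEq S] (κ : ℕ) : Prop :=
  ∀ (W : Type) [Fintype W] [DecidableEq W] (s₀ : S → Bool) (U : QOp W) (n : ℕ),
    CtrlCircuit U n → CtrlCircuit (mux fun s => if s = s₀ then U else 1) (n + κ)

theorem mux_reindex (e : S ≃ S') (F : (S' → Bool) → QOp W) :
    mux F = onWires (Equiv.sumCongr e (Equiv.refl W)) (mux fun s => F (s ∘ e.symm)) := by
  rw [onWires_equiv]
  apply qop_sum_ext
  intro s x t y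
  have h : ∀ (s : S' → Bool) (x : W → Bool), Sum.elim s x ∘ Equiv.sumCongr e (Equiv.refl W) =
      Sum.elim (s ∘ e) x := by
    intro s x
    funext i
    rcases i with i | i <;> rfl
  have h2 : s ∘ e = t ∘ e ↔ s = t := e.surjective.injective_comp_right.eq_iff
  have h3 : (s ∘ e) ∘ e.symm = s := by
    funext i
    simp
  rw [h, h, mux_apply, mux_apply, h3]
  simp only [h2]

theorem mux_sum (F : (S ⊕ S' → Bool) → QOp W) :
    mux F = onWires (Equiv.sumAssoc S S' W).symm
      (mux fun s => mux fun t => F (Sum.elim s t)) := by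
  rw [onWires_equiv]
  apply qop_sum_ext
  intro s x t y
  obtain ⟨s₁, s₂, rfl⟩ : ∃ s₁ s₂, s = Sum.elim s₁ s₂ := ⟨_, _, (Sum.elim_comp_inl_inr s).symm⟩
  obtain ⟨t₁, t₂, rfl⟩ : ∃ t₁ t₂, t = Sum.elim t₁ t₂ := ⟨_, _, (Sum.elim_comp_inl_inr t).symm⟩
  have h : ∀ (s₁ : S → Bool) (s₂ : S' → Bool) (x : W → Bool),
      Sum.elim (Sum.elim s₁ s₂) x ∘ (Equiv.sumAssoc S S' W).symm =
        Sum.elim s₁ (Sum.elim s₂ x) := by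
    intro s₁ s₂ x
    funext i
    rcases i with i | i | i <;> rfl
  rw [h, h, mux_apply, mux_apply, mux_apply]
  simp only [sumElim_eq_iff]
  by_cases h1 : s₁ = t₁ <;> simp [h1]

theorem MuxCost.reindex {κ : ℕ} (h : MuxCost S κ) (e : S ≃ S') : MuxCost S' κ := by
  intro W _ _ F n hF
  rw [mux_reindex e]
  have := (h W (fun s => F (s ∘ e.symm)) (fun s => n (s ∘ e.symm)) fun s => hF _).onWires
    (Equiv.sumCongr e (Equiv.refl W)) (Equiv.injective _)
  have hs : ∑ s : S → Bool, n (s ∘ e.symm) = ∑ s, n s :=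
    Fintype.sum_equiv (e.arrowCongr (Equiv.refl Bool)) _ _ fun s => rfl
  rwa [hs] at this

theorem PointCost.reindex {κ : ℕ} (h : PointCost S κ) (e : S ≃ S') : PointCost S' κ := by
  intro W _ _ s₀ U n hU
  rw [mux_reindex e]
  have h2 : ∀ s : S → Bool, s ∘ e.symm = s₀ ↔ s = s₀ ∘ e := by
    intro s
    constructor
    · rintro rfl
      funext i
      simp
    · rintro rfl
      funext i
      simp
  simp only [h2]
  exact (h W (s₀ ∘ e) U n hU).onWires _ (Equiv.injective _)

/-- Multiplex over the first register, with multiplexers over the second as branches. The overhead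
of the second is paid once for each of the `2 ^ card S` states of the first. -/
theorem MuxCost.sum {κ κ' : ℕ} (h : MuxCost S κ) (h' : MuxCost S' κ') :
    MuxCost (S ⊕ S') (κ + 2 ^ Fintype.card S * κ') := by
  intro W _ _ F n hF
  rw [mux_sum]
  have := (h (S' ⊕ W) (fun s => mux fun t => F (Sum.elim s t))
    (fun s => ∑ t, n (Sum.elim s t) + κ') fun s => h' W _ _ fun t => hF _).onWires
    (Equiv.sumAssoc S S' W).symm (Equiv.injective _)
  refine this.mono (le_of_eq ?_)
  rw [sum_sumArrow, Finset.sum_add_distrib]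
  simp
  ring

/-- Here only one branch of the outer register is nontrivial, so overheads add and none is
multiplied; the total is linear in the number of wires. -/
theorem PointCost.sum {κ κ' : ℕ} (h : PointCost S κ) (h' : PointCost S' κ') :
    PointCost (S ⊕ S') (κ' + κ) := by
  intro W _ _ s₀ U n hU
  rw [mux_sum]
  have := (h (S' ⊕ W) (s₀ ∘ Sum.inl) _ _ (h' W (s₀ ∘ Sum.inr) U n hU)).onWires
    (Equiv.sumAssoc S S' W).symm (Equiv.injective _)
  rw [add_assoc] at this
  convert this using 4 with s
  have h1 : ∀ t : S' → Bool, Sum.elim s t = s₀ ↔ s = s₀ ∘ Sum.inl ∧ t = s₀ ∘ Sum.inr := by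
    intro t
    conv_lhs => rw [← Sum.elim_comp_inl_inr s₀, sumElim_eq_iff]
  simp only [h1]
  by_cases hs : s = s₀ ∘ Sum.inl
  · simp [hs]
  · simp [hs, mux_one]

/-- One more control for the branch `true` (10 gates), and one more conjugated by two flips for the
branch `false` (12 gates). -/
theorem MuxCost.unit : MuxCost Unit 22 := by
  intro W _ _ F n hF
  have h1 := (hF fun _ => true).ctrl.mul (hF fun _ => false).ctrl_false
  have h2 : ∑ s, n s = n (fun _ => true) + n fun _ => false := by
    rw [← Fintype.sum_bool fun b => n fun _ => b]
    exact Fintype.sum_equiv (Equiv.funUnique Unit Bool) _ _ fun s => rfl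
  rw [_root_.ctrl, mux_mul] at h1
  convert h1.mono (show _ ≤ ∑ s, n s + 22 by omega) using 2
  funext s
  have hs : s = fun _ => s () := rfl
  rw [hs]
  cases s () <;> simp

theorem PointCost.unit : PointCost Unit 12 := by
  intro W _ _ s₀ U n hU
  have hs : ∀ s : Unit → Bool, s = s₀ ↔ s () = s₀ () := fun s =>
    ⟨fun h => congrFun h (), fun h => funext fun _ => h⟩
  simp only [hs]
  cases h : s₀ ()
  · convert hU.ctrl_false using 3 with s
    cases s () <;> simp
  · exact hU.ctrl.mono (by omega)

theorem MuxCost.empty [IsEmpty S] : MuxCost S 0 := by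
  intro W _ _ F n hF
  have h := (hF default).onWires (Sum.inr : W → S ⊕ W) Sum.inr_injective
  rw [← mux_const] at h
  simp only [Fintype.sum_unique, add_zero]
  convert h using 2
  funext s
  rw [Subsingleton.elim s default]

theorem PointCost.empty [IsEmpty S] : PointCost S 0 := by
  intro W _ _ s₀ U n hU
  have h := hU.onWires (Sum.inr : W → S ⊕ W) Sum.inr_injective
  rw [← mux_const] at h
  simp only [add_zero]
  convert h using 3 with s
  rw [if_pos (Subsingleton.elim _ _)]

/-- The wires of a register of `r + 1` qubits: the lowest bit and the others. -/
def finSuccWires (r : ℕ) : Unit ⊕ Fin r ≃ Fin (r + 1) where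
  toFun := Sum.elim (fun _ => 0) Fin.succ
  invFun := Fin.cases (Sum.inl ()) Sum.inr
  left_inv := by rintro (_ | _) <;> rfl
  right_inv := by intro i; cases i using Fin.cases <;> rfl

/-- A full binary tree of depth r has `2 ^ r - 1` inner nodes, each of which costs 22. -/
theorem MuxCost.fin (r : ℕ) : MuxCost (Fin r) (22 * (2 ^ r - 1)) := by
  induction r with
  | zero => exact MuxCost.empty
  | succ r ih =>
    have h := (MuxCost.unit.sum ih).reindex (finSuccWires r)
    have hp : 0 < 2 ^ r := by positivity
    have : 22 + 2 ^ Fintype.card Unit * (22 * (2 ^ r - 1)) = 22 * (2 ^ (r + 1) - 1) := by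
      simp only [Fintype.card_unit, pow_succ]
      omega
    rwa [this] at h

theorem PointCost.fin (r : ℕ) : PointCost (Fin r) (12 * r) := by
  induction r with
  | zero => exact PointCost.empty
  | succ r ih =>
    have h := (PointCost.unit.sum ih).reindex (finSuccWires r)
    rwa [← mul_add_one] at h

end Gates

/-! ### State preparation -/

section Preparation

variable {S S' : Type} [Fintype S] [Fintype S'] [DecidableEq S] [DecidableEq S']

/-- A multiple of `v` is prepared from `|0⟩` by a unitary whose controlled version costs `n`. -/
def Prepable (v : (S → Bool) → ℂ) (n : ℕ) : Prop :=
  ∃ P ∈ unitaryGroup (S → Bool) ℂ, ∃ c : ℂ, (∀ x, v x = c * P x (zeroKet S)) ∧ CtrlCircuit P n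

theorem Prepable.mono {v : (S → Bool) → ℂ} {n n' : ℕ} (h : Prepable v n) (hn : n ≤ n') :
    Prepable v n' := by
  obtain ⟨P, hP, c, hc, hn'⟩ := h
  exact ⟨P, hP, c, hc, hn'.mono hn⟩

/-- The identity prepares multiples of |0⟩, the zero vector included, for free. This is what makes
the unsupported branches of a preparation tree cost nothing. -/
theorem Prepable.of_support {v : (S → Bool) → ℂ} (h : ∀ x, x ≠ zeroKet S → v x = 0) :
    Prepable v 0 := by
  refine ⟨1, one_mem _, v (zeroKet S), fun x => ?_, CtrlCircuit.one⟩
  by_cases hx : x = zeroKet S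
  · rw [hx, one_apply_eq, mul_one]
  · simp [hx, h x hx]

theorem Prepable.unit (v : (Unit → Bool) → ℂ) : Prepable v 1 := by
  set a := v fun _ => false with ha
  set b := v fun _ => true with hb
  have hv : ∀ x, v x = if x () then b else a := by
    intro x
    have hx : x = fun _ => x () := rfl
    rw [hx]
    cases x () <;> simp [ha, hb]
  by_cases h0 : ‖a‖ ^ 2 + ‖b‖ ^ 2 = 0
  · have ha0 : a = 0 := by
      have := sq_nonneg ‖a‖
      have := sq_nonneg ‖b‖
      exact norm_eq_zero.1 (pow_eq_zero_iff two_ne_zero |>.1 (by linarith))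
    have hb0 : b = 0 := by
      have := sq_nonneg ‖a‖
      have := sq_nonneg ‖b‖
      exact norm_eq_zero.1 (pow_eq_zero_iff two_ne_zero |>.1 (by linarith))
    refine (Prepable.of_support fun x _ => ?_).mono zero_le_one
    simp [hv, ha0, hb0]
  · set s : ℝ := Real.sqrt (‖a‖ ^ 2 + ‖b‖ ^ 2) with hs
    have hpos : 0 ≤ ‖a‖ ^ 2 + ‖b‖ ^ 2 := by positivity
    have hss : (s : ℂ) * s = (‖a‖ : ℂ) ^ 2 + (‖b‖ : ℂ) ^ 2 := by
      rw [← Complex.ofReal_mul, hs, Real.mul_self_sqrt hpos]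
      push_cast
      rfl
    have hs0 : (s : ℂ) ≠ 0 := by
      intro h
      apply h0
      have : s = 0 := by exact_mod_cast h
      exact (Real.sqrt_eq_zero hpos).1 (hs ▸ this)
    -- The normalized vector (a, b) is the first column; (-b̄, ā) completes it to a unitary.
    let M : Matrix Bool Bool ℂ := fun i j =>
      if j then (if i then star a / s else -star b / s) else if i then b / s else a / s
    have e1 : a * star a = (‖a‖ : ℂ) ^ 2 := by
      simp [Complex.mul_conj, Complex.normSq_eq_norm_sq]
    have e2 : b * star b = (‖b‖ : ℂ) ^ 2 := by
      simp [Complex.mul_conj, Complex.normSq_eq_norm_sq]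
    have hM : M ∈ unitaryGroup Bool ℂ := by
      rw [mem_unitaryGroup_iff]
      ext i j
      have hst : star (s : ℂ) = s := Complex.conj_ofReal s
      have m1 : M false false = a / s := rfl
      have m2 : M true false = b / s := rfl
      have m3 : M false true = -star b / s := rfl
      have m4 : M true true = star a / s := rfl
      cases i <;> cases j <;>
        simp only [m1, m2, m3, m4, mul_apply, star_apply, Fintype.sum_bool, if_true,
          if_false, star_div₀, star_neg, star_star, hst, one_apply, reduceCtorEq] <;>
        field_simp <;>
        (rw [pow_two, hss, ← e1, ← e2]; ring)
    refine ⟨oneQ M, oneQ_mem_unitary hM, s, fun x => ?_, CtrlCircuit.oneQ hM⟩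
    rw [hv]
    simp only [oneQ, M, zeroKet, Bool.false_eq_true, if_false]
    split_ifs <;> field_simp

theorem Prepable.reindex {v : (S' → Bool) → ℂ} {n : ℕ} (e : S ≃ S')
    (h : Prepable (fun x : S → Bool => v (x ∘ e.symm)) n) : Prepable v n := by
  obtain ⟨P, hP, c, hc, hn⟩ := h
  refine ⟨onWires e P, onWires_mem_unitary _ e.injective hP, c, fun x => ?_,
    hn.onWires e e.injective⟩
  have h1 : (x ∘ e) ∘ e.symm = x := by
    funext i
    simp
  rw [onWires_equiv]
  refine Eq.trans ?_ (hc (x ∘ e))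
  simp only [h1]

/-- The scalars `c s` left over by the conditional preparations form a vector on the first register.
Preparing that vector first and then multiplexing the conditional preparations gives `v`. Allowing
an arbitrary scalar in `Prepable` avoids normalizing conditional states, some of which may vanish.
-/
theorem Prepable.sum {v : (S ⊕ S' → Bool) → ℂ} {n κ : ℕ} {n' : (S → Bool) → ℕ}
    (hS : ∀ u : (S → Bool) → ℂ, Prepable u n) (hκ : MuxCost S κ)
    (h : ∀ s, Prepable (fun x => v (Sum.elim s x)) (n' s)) :
    Prepable v (∑ s, n' s + κ + n) := by
  choose P hP c hc hn using h
  replace hc : ∀ s x, v (Sum.elim s x) = c s * P s x (zeroKet S') := hc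
  obtain ⟨Q, hQ, c', hc', hn'⟩ := hS c
  refine ⟨mux P * onWires Sum.inl Q, mul_mem (mux_mem_unitary hP)
    (onWires_mem_unitary _ Sum.inl_injective hQ), c', fun x => ?_,
    (hκ _ _ _ hn).mul (hn'.onWires _ Sum.inl_injective)⟩
  obtain ⟨s, y, rfl⟩ : ∃ s y, x = Sum.elim s y := ⟨_, _, (Sum.elim_comp_inl_inr x).symm⟩
  have h0 : zeroKet (S ⊕ S') = Sum.elim (zeroKet S) (zeroKet S') := by
    funext i
    rcases i with i | i <;> rfl
  rw [hc s y, hc' s, h0, mul_apply, sum_sumArrow, Finset.sum_eq_single s,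
    Finset.sum_eq_single (zeroKet S')]
  · rw [mux_apply, onWires_inl_apply, if_pos rfl, if_pos rfl]
    ring
  · intro z _ hz
    rw [onWires_inl_apply, if_neg hz, mul_zero]
  · simp
  · intro t _ ht
    refine Finset.sum_eq_zero fun z _ => ?_
    rw [mux_apply, if_neg (Ne.symm ht), zero_mul]
  · simp

/-- Each node of the tree costs one single-qubit rotation and 22 gates of multiplexing. -/
theorem Prepable.fin (r : ℕ) (v : (Fin r → Bool) → ℂ) : Prepable v (23 * (2 ^ r - 1)) := by
  induction r with
  | zero => exact Prepable.of_support fun x hx => absurd (Subsingleton.elim _ _) hx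
  | succ r ih =>
    refine (Prepable.reindex (finSuccWires r)
      (Prepable.sum Prepable.unit MuxCost.unit fun s => ih _)).mono ?_
    have hp : 0 < 2 ^ r := by positivity
    simp only [Finset.sum_const, Finset.card_univ, Fintype.card_pi, Fintype.card_bool,
      Finset.prod_const, Fintype.card_unit, smul_eq_mul, pow_succ]
    omega

/-- The wires of `d + 1` registers of `r` qubits: the first register and the others. -/
def rowSuccWires (d r : ℕ) : Fin r ⊕ (Fin d × Fin r) ≃ Fin (d + 1) × Fin r where
  toFun := Sum.elim (fun i => (0, i)) fun p => (p.1.succ, p.2)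
  invFun p := Fin.cases (Sum.inl p.2) (fun μ => Sum.inr (μ, p.2)) p.1
  left_inv := by rintro (_ | _) <;> rfl
  right_inv := by
    rintro ⟨μ, i⟩
    cases μ using Fin.cases <;> rfl

/-- State preparation on `d` registers of `r` qubits, for a vector supported on at most `G` states
`good` of each register and on states in which all registers after one that is not `good` are
`0`. -/
theorem Prepable.rows {r G : ℕ} (hG : 2 ≤ G) (hr : 2 ^ r ≤ 2 * G) (good : Finset (Fin r → Bool))
    (hgood : good.card ≤ G) (d : ℕ) (v : (Fin d × Fin r → Bool) → ℂ)
    (hv : ∀ b, v b ≠ 0 → ∀ μ ν, μ < ν → (fun i => b (μ, i)) ∉ good → ∀ i, b (ν, i) = false) :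
    Prepable v (180 * (G ^ d - 1)) := by
  induction d with
  | zero => exact Prepable.of_support fun x hx => absurd (Subsingleton.elim _ _) hx
  | succ d ih =>
    -- If the first register is not good, the support condition forces all later registers to be
    -- zero, so the branch is free; only the good branches are charged.
    have key : ∀ s : Fin r → Bool,
        Prepable (fun x : Fin d × Fin r → Bool => v (Sum.elim s x ∘ (rowSuccWires d r).symm))
          (if s ∈ good then 180 * (G ^ d - 1) else 0) := by
      intro s
      split_ifs with hs
      · refine ih _ fun b hb μ ν hμν hμ i => ?_
        exact hv _ hb μ.succ ν.succ (Fin.succ_lt_succ_iff.2 hμν) hμ i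
      · refine Prepable.of_support fun x hx => ?_
        by_contra hne
        apply hx
        funext p
        exact hv _ hne 0 p.1.succ (Fin.succ_pos _) hs p.2
    refine (Prepable.reindex (rowSuccWires d r)
      (Prepable.sum (Prepable.fin r) (MuxCost.fin r) key)).mono ?_
    have h1 : ∑ s, (if s ∈ good then 180 * (G ^ d - 1) else 0) = good.card * (180 * (G ^ d - 1)) := by
      rw [Finset.sum_ite_mem, Finset.univ_inter, Finset.sum_const, smul_eq_mul]
    rw [h1]
    have hGd : 1 ≤ G ^ d := Nat.one_le_pow _ _ (by omega)
    obtain ⟨p, hp⟩ : ∃ p, G ^ d = p + 1 := ⟨G ^ d - 1, by omega⟩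
    have hp0 : 0 < 2 ^ r := by positivity
    have h2 : good.card * (180 * (G ^ d - 1)) ≤ 180 * (p * G) := by
      rw [hp, Nat.add_sub_cancel]
      calc good.card * (180 * p) ≤ G * (180 * p) := Nat.mul_le_mul_right _ hgood
        _ = 180 * (p * G) := by ring
    have h3 : G ^ (d + 1) = p * G + G := by rw [pow_succ, hp, add_mul, one_mul]
    -- With `G ^ d = p + 1` it remains to fit the overhead 22 + 23 = 45 times `2 ^ r - 1`, at most
    -- 45 (2G - 1), into 180 (G - 1). This holds because G ≥ 2.
    rw [h3]
    omega

/-- A column of a unitary has norm 1, so for normalized `v` the scalar is a phase. It is absorbed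
into the unitary at the price of one gate. -/
theorem Prepable.exists_unitary {v : (S → Bool) → ℂ} {n : ℕ} (h : Prepable v n)
    (hv : ∑ x, ‖v x‖ ^ 2 = 1) :
    ∃ P ∈ unitaryGroup (S → Bool) ℂ, (∀ x, P x (zeroKet S) = v x) ∧ CtrlCircuit P (n + 1) := by
  obtain ⟨P, hP, c, hc, hn⟩ := h
  have hcol : ∑ x, ‖P x (zeroKet S)‖ ^ 2 = 1 := by
    have h1 := congrFun (congrFun (mem_unitaryGroup_iff'.1 hP) (zeroKet S)) (zeroKet S)
    simp only [mul_apply, star_apply, one_apply_eq] at h1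
    have h2 : ∀ x, star (P x (zeroKet S)) * P x (zeroKet S) =
        ((‖P x (zeroKet S)‖ ^ 2 : ℝ) : ℂ) := by
      intro x
      rw [mul_comm]
      simp [Complex.mul_conj, Complex.normSq_eq_norm_sq]
    simp only [h2] at h1
    exact_mod_cast h1
  have hc1 : ‖c‖ = 1 := by
    simp only [hc, norm_mul, mul_pow, ← Finset.mul_sum, hcol, mul_one] at hv
    exact (pow_eq_one_iff_of_nonneg (norm_nonneg c) two_ne_zero).1 hv
  refine ⟨c • P, ?_, fun x => by simp [hc], hn.smul hc1⟩
  rw [mem_unitaryGroup_iff, star_eq_conjTranspose] at hP ⊢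
  rw [conjTranspose_smul, smul_mul_smul_comm, hP]
  simp [Complex.mul_conj, Complex.normSq_eq_norm_sq, hc1]

/-- State-preparation pairs exist; `j` is a junk state that takes up the slack. -/
theorem exists_prep_pair {B : Type} [Fintype B] [DecidableEq B] (g : B → ℂ) {α : ℝ}
    (hα : ∑ b, ‖g b‖ ≤ α) {j b₀ : B} (hj : j ≠ b₀) (hg : g j = 0) :
    ∃ vL vR : B → ℂ, ∑ b, ‖vL b‖ ^ 2 = 1 ∧ ∑ b, ‖vR b‖ ^ 2 = 1 ∧
      (∀ b, α * (star (vL b) * vR b) = g b) ∧ (∀ b, g b = 0 → star (vL b) * vR b = 0) ∧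
      (∀ b, vL b ≠ 0 → g b ≠ 0 ∨ b = j ∨ b = b₀) ∧
      (∀ b, vR b ≠ 0 → g b ≠ 0 ∨ b = j ∨ b = b₀) := by
  set s := ∑ b, ‖g b‖ with hs
  have hs0 : 0 ≤ s := Finset.sum_nonneg fun b _ => norm_nonneg _
  rcases hs0.eq_or_lt with h0 | hpos
  · have hz : ∀ b, g b = 0 := by
      intro b
      have := (Finset.sum_eq_zero_iff_of_nonneg fun b _ => norm_nonneg (g b)).1 (hs ▸ h0).symm b
        (Finset.mem_univ _)
      exact norm_eq_zero.1 this
    -- If all coefficients vanish, two basis vectors with disjoint supports, at `j` and at `b₀`,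
    -- serve for every `α`.
    have hp : ∀ b, star (if b = j then (1 : ℂ) else 0) * (if b = b₀ then (1 : ℂ) else 0) = 0 := by
      intro b
      by_cases hb : b = j
      · rw [if_neg (hb ▸ hj : b ≠ b₀), mul_zero]
      · rw [if_neg hb, star_zero, zero_mul]
    refine ⟨fun b => if b = j then 1 else 0, fun b => if b = b₀ then 1 else 0, ?_, ?_,
      fun b => by rw [hp, hz, mul_zero], fun b _ => hp b, ?_, ?_⟩
    · simp [apply_ite norm, ite_pow]
    · simp [apply_ite norm, ite_pow]
    · intro b hb
      right
      left
      by_contra h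
      simp [h] at hb
    · intro b hb
      right
      right
      by_contra h
      simp [h] at hb
  · have hα0 : 0 < α := hpos.trans_le hα
    have hle : s ^ 2 / α ^ 2 ≤ 1 := by
      rw [div_le_one (by positivity)]
      exact pow_le_pow_left₀ hs0 hα 2
    -- The left vector is already normalized and vanishes at `j`. The right one is chosen to give
    -- the product `g b / α`; off `j` its squared norm is only s² / α², and the rest is put at `j`,
    -- where it is invisible in the product.
    refine ⟨fun b => (Real.sqrt (‖g b‖ / s) : ℂ), fun b =>
      if b = j then (Real.sqrt (1 - s ^ 2 / α ^ 2) : ℂ) else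
        g b / (α * Real.sqrt (‖g b‖ / s)), ?_, ?_, ?_, ?_, ?_, ?_⟩
    · have : ∀ b, ‖((Real.sqrt (‖g b‖ / s) : ℝ) : ℂ)‖ ^ 2 = ‖g b‖ / s := by
        intro b
        rw [Complex.norm_real, Real.norm_eq_abs, sq_abs, Real.sq_sqrt (by positivity)]
      simp only [this]
      rw [← Finset.sum_div, ← hs, div_self hpos.ne']
    · have h1 : ∀ b, b ≠ j → ‖(if b = j then (Real.sqrt (1 - s ^ 2 / α ^ 2) : ℂ) else
        g b / (α * Real.sqrt (‖g b‖ / s)))‖ ^ 2 = ‖g b‖ * (s / α ^ 2) := by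
        intro b hb
        rw [if_neg hb, norm_div, norm_mul, Complex.norm_real, Complex.norm_real, div_pow, mul_pow,
          Real.norm_eq_abs, Real.norm_eq_abs, sq_abs, sq_abs, Real.sq_sqrt (by positivity)]
        by_cases hgb : ‖g b‖ = 0
        · simp [hgb]
        · field_simp
      rw [← Finset.add_sum_erase _ _ (Finset.mem_univ j),
        Finset.sum_congr rfl fun b hb => h1 b (Finset.ne_of_mem_erase hb), ← Finset.sum_mul]
      have h2 : ∑ b ∈ Finset.univ.erase j, ‖g b‖ = s := by
        rw [hs, ← Finset.add_sum_erase _ _ (Finset.mem_univ j), hg, norm_zero, zero_add]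
      simp only [if_true]
      rw [h2, Complex.norm_real, Real.norm_eq_abs, sq_abs,
        Real.sq_sqrt (sub_nonneg.2 hle)]
      ring
    all_goals
      have hsq : ∀ b, g b ≠ 0 → ((Real.sqrt (‖g b‖ / s) : ℝ) : ℂ) ≠ 0 := by
        intro b hb
        have : 0 < ‖g b‖ := norm_pos_iff.2 hb
        exact Complex.ofReal_ne_zero.2 (Real.sqrt_pos.2 (by positivity)).ne'
    · intro b
      by_cases hgb : g b = 0
      · simp [hgb]
      · have hbj : b ≠ j := by
          rintro rfl
          exact hgb hg
        have := hsq b hgb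
        have hαc : (α : ℂ) ≠ 0 := Complex.ofReal_ne_zero.2 hα0.ne'
        simp only [if_neg hbj]
        rw [show star ((Real.sqrt (‖g b‖ / s) : ℝ) : ℂ) = (Real.sqrt (‖g b‖ / s) : ℝ) from
          Complex.conj_ofReal _]
        field_simp
    · intro b hgb
      simp [hgb]
    · intro b hb
      left
      intro hgb
      simp [hgb] at hb
    · intro b hb
      by_cases hbj : b = j
      · exact Or.inr (Or.inl hbj)
      · left
        intro hgb
        simp [hgb, hbj] at hb

end Preparation

/-! ### Binary expansions -/

section Bits

theorem bitsVal_succ {r : ℕ} (b : Fin (r + 1) → Bool) :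
    bitsVal b = (if b 0 then 1 else 0) + 2 * bitsVal (b ∘ Fin.succ) := by
  simp only [bitsVal, Fin.sum_univ_succ, Finset.mul_sum, Fin.val_zero, pow_zero, Fin.val_succ,
    Function.comp_apply, mul_ite, mul_zero, pow_succ']

theorem bitsVal_lt {r : ℕ} (b : Fin r → Bool) : bitsVal b < 2 ^ r := by
  induction r with
  | zero => simp [bitsVal]
  | succ r ih =>
    rw [bitsVal_succ, pow_succ]
    have := ih (b ∘ Fin.succ)
    split_ifs <;> omega

theorem bitsVal_injective {r : ℕ} : Injective (bitsVal (r := r)) := by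
  induction r with
  | zero => exact fun _ _ _ => Subsingleton.elim _ _
  | succ r ih =>
    intro a b h
    rw [bitsVal_succ, bitsVal_succ] at h
    have h0 : a 0 = b 0 := by
      cases ha : a 0 <;> cases hb : b 0 <;> simp [ha, hb] at h ⊢ <;> omega
    have h1 : a ∘ Fin.succ = b ∘ Fin.succ := ih (by rw [h0] at h; omega)
    funext i
    cases i using Fin.cases with
    | zero => exact h0
    | succ i => exact congrFun h1 i

theorem exists_bitsVal {r n : ℕ} (h : n < 2 ^ r) : ∃ b : Fin r → Bool, bitsVal b = n := by
  have hb : Bijective fun b : Fin r → Bool => (⟨bitsVal b, bitsVal_lt b⟩ : Fin (2 ^ r)) := by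
    rw [Fintype.bijective_iff_injective_and_card]
    exact ⟨fun a b h => bitsVal_injective (Fin.mk.inj_iff.1 h), by simp⟩
  obtain ⟨b, hb⟩ := hb.surjective ⟨n, h⟩
  exact ⟨b, Fin.mk.inj_iff.1 hb⟩

theorem bitsVal_zero {r : ℕ} : bitsVal (fun _ : Fin r => false) = 0 := by
  simp [bitsVal]

theorem bitsVal_true {r : ℕ} : bitsVal (fun _ : Fin r => true) + 1 = 2 ^ r := by
  induction r with
  | zero => simp [bitsVal]
  | succ r ih =>
    have : (fun _ : Fin (r + 1) => true) ∘ Fin.succ = fun _ => true := rfl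
    rw [bitsVal_succ, this, pow_succ, ← ih]
    simp
    ring

/-- An odd number greater than 1 is not a power of two, so rounding up to a power of two leaves at
least one spare basis state. -/
theorem two_mul_add_two_le_pow_clog {N : ℕ} (hN : 1 ≤ N) :
    2 * N + 2 ≤ 2 ^ Nat.clog 2 (2 * N + 1) := by
  have h1 := Nat.le_pow_clog one_lt_two (2 * N + 1)
  have h2 : 0 < Nat.clog 2 (2 * N + 1) := Nat.clog_pos one_lt_two (by omega)
  obtain ⟨r, hr⟩ := Nat.exists_eq_succ_of_ne_zero h2.ne'
  rw [hr, Nat.succ_eq_add_one, pow_succ] at h1 ⊢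
  omega

theorem pow_clog_le {N : ℕ} (hN : 1 < N) : 2 ^ Nat.clog 2 N ≤ 2 * N := by
  have h1 := Nat.pow_pred_clog_lt_self one_lt_two hN
  have h2 : 0 < Nat.clog 2 N := Nat.clog_pos one_lt_two hN
  obtain ⟨r, hr⟩ := Nat.exists_eq_succ_of_ne_zero h2.ne'
  rw [hr, Nat.pred_succ] at h1
  rw [hr, pow_succ]
  omega

end Bits

/-! ### State preparation for the Fourier coefficients -/

section FourierPrep

variable {d K : ℕ}

theorem freqOf_injective : Injective (freqOf (d := d) (K := K)) := by
  intro a b h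
  have h1 : ∀ μ, (fun i => a (μ, i)) = fun i => b (μ, i) := by
    intro μ
    have := congrFun h μ
    simp only [freqOf] at this
    exact bitsVal_injective (by omega)
  funext p
  exact congrFun (h1 p.1) p.2

theorem freqOf_mem_freqs {b : FouW d K → Bool} :
    freqOf b ∈ freqs d K ↔ ∀ μ, bitsVal (fun i => b (μ, i)) ≤ 2 * K := by
  simp only [freqs, Fintype.mem_piFinset, Finset.mem_Icc, freqOf]
  refine forall_congr' fun μ => ?_
  omega

theorem exists_freqOf {k : Fin d → ℤ} (hk : k ∈ freqs d K) :
    ∃ b : FouW d K → Bool, freqOf b = k := by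
  simp only [freqs, Fintype.mem_piFinset, Finset.mem_Icc] at hk
  have h : ∀ μ, ∃ b : Fin (Nat.clog 2 (2 * K + 1)) → Bool, bitsVal b = (k μ + K).toNat := by
    intro μ
    apply exists_bitsVal
    have := Nat.le_pow_clog one_lt_two (2 * K + 1)
    have := hk μ
    omega
  choose b hb using h
  refine ⟨fun p => b p.1 p.2, ?_⟩
  funext μ
  simp only [freqOf, hb]
  have := hk μ
  omega

theorem sum_freqOf {M : Type} [AddCommMonoid M] (f : (Fin d → ℤ) → M) :
    ∑ b : FouW d K → Bool, (if freqOf b ∈ freqs d K then f (freqOf b) else 0) =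
      ∑ k ∈ freqs d K, f k := by
  rw [← Finset.sum_filter]
  refine Finset.sum_bij (fun b _ => freqOf b) ?_ ?_ ?_ ?_
  · intro b hb
    exact (Finset.mem_filter.1 hb).2
  · intro a _ b _ h
    exact freqOf_injective h
  · intro k hk
    obtain ⟨b, rfl⟩ := exists_freqOf hk
    exact ⟨b, Finset.mem_filter.2 ⟨Finset.mem_univ _, hk⟩, rfl⟩
  · intro b _
    rfl

/-- A state-preparation pair for LCU Fourier whose cost is proportional to the number of
frequencies. -/
theorem exists_fourierPrep (hd : 0 < d) (hK : 1 ≤ K) (c : (Fin d → ℤ) → ℂ) {α : ℝ}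
    (hc : ∑ k ∈ freqs d K, ‖c k‖ ≤ α) :
    ∃ PL PR : QOp (FouW d K), IsFourierPrep α c PL PR ∧
      CtrlCircuit PL (180 * (2 * K + 1) ^ d) ∧ CtrlCircuit PR (180 * (2 * K + 1) ^ d) := by
  let g : (FouW d K → Bool) → ℂ := fun b => if freqOf b ∈ freqs d K then c (freqOf b) else 0
  have hg : ∑ b, ‖g b‖ ≤ α := by
    refine le_trans (le_of_eq ?_) hc
    rw [← sum_freqOf]
    refine Finset.sum_congr rfl fun b _ => ?_
    simp only [g]
    split_ifs <;> simp
  -- The junk state has all ones in the first register, a value above 2K, and zeros in the others.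
  -- The zeros make it admissible for `Prepable.rows`.
  let j : FouW d K → Bool := fun p => decide (p.1.val = 0)
  have hpow := two_mul_add_two_le_pow_clog hK
  have hjbad : ¬ freqOf j ∈ freqs d K := by
    rw [freqOf_mem_freqs]
    intro h
    have h1 := h ⟨0, hd⟩
    have h2 : (fun i => j (⟨0, hd⟩, i)) = fun _ => true := by
      funext i
      simp [j]
    rw [h2] at h1
    have := bitsVal_true (r := Nat.clog 2 (2 * K + 1))
    omega
  have hj0 : j ≠ zeroKet (FouW d K) := by
    intro h
    have h1 : 0 < Nat.clog 2 (2 * K + 1) := Nat.clog_pos one_lt_two (by omega)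
    have := congrFun h (⟨0, hd⟩, ⟨0, h1⟩)
    simp [j, zeroKet] at this
  have hgj : g j = 0 := if_neg hjbad
  obtain ⟨vL, vR, hL, hR, h1, h2, hsL, hsR⟩ := exists_prep_pair g hg hj0 hgj
  let good : Finset (Fin (Nat.clog 2 (2 * K + 1)) → Bool) :=
    Finset.univ.filter fun s => bitsVal s ≤ 2 * K
  have hcard : good.card ≤ 2 * K + 1 := by
    refine le_of_le_of_eq ?_ (Finset.card_range (2 * K + 1))
    refine Finset.card_le_card_of_injOn bitsVal ?_ bitsVal_injective.injOn
    intro s hs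
    have := (Finset.mem_filter.1 hs).2
    simp
    omega
  have hsupp : ∀ v : (FouW d K → Bool) → ℂ,
      (∀ b, v b ≠ 0 → g b ≠ 0 ∨ b = j ∨ b = zeroKet (FouW d K)) →
      Prepable v (180 * ((2 * K + 1) ^ d - 1)) := by
    intro v hv
    refine Prepable.rows (by omega) (pow_clog_le (by omega)) good hcard d v ?_
    intro b hb μ ν hμν hμ i
    rcases hv b hb with h | h | h
    · exfalso
      have hf : freqOf b ∈ freqs d K := by
        by_contra hf
        exact h (if_neg hf)
      exact hμ (Finset.mem_filter.2 ⟨Finset.mem_univ _, freqOf_mem_freqs.1 hf μ⟩)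
    · rw [h]
      have : ν.val ≠ 0 := by
        have : μ.val < ν.val := hμν
        omega
      simp [j, this]
    · rw [h]
      rfl
  obtain ⟨PL, hPL, hPL0, hPLc⟩ := (hsupp vL hsL).exists_unitary hL
  obtain ⟨PR, hPR, hPR0, hPRc⟩ := (hsupp vR hsR).exists_unitary hR
  have hcost : 180 * ((2 * K + 1) ^ d - 1) + 1 ≤ 180 * (2 * K + 1) ^ d := by
    have : 1 ≤ (2 * K + 1) ^ d := Nat.one_le_pow _ _ (by omega)
    omega
  refine ⟨PL, PR, ⟨hPL, hPR, fun b => ⟨fun hb => ?_, fun hb => ?_⟩⟩, hPLc.mono hcost,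
    hPRc.mono hcost⟩
  · rw [hPL0, hPR0, h1]
    exact if_pos hb
  · rw [hPL0, hPR0]
    exact h2 b (if_neg hb)

end FourierPrep

/-! ### Circuits for diagonal phases -/

section Phases

variable {W ι : Type} [Fintype W] [DecidableEq W]

/-- The diagonal operator with phases `θ`. -/
noncomputable def phaseDiag (θ : (W → Bool) → ℝ) : QOp W :=
  diagonal fun z => Complex.exp (θ z * Complex.I)

theorem phaseDiag_sum_circuit (s : Finset ι) (θ : ι → (W → Bool) → ℝ) (n : ℕ)
    (h : ∀ i ∈ s, CtrlCircuit (phaseDiag (θ i)) n) :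
    CtrlCircuit (phaseDiag fun z => ∑ i ∈ s, θ i z) (s.card * n) := by
  classical
  induction s using Finset.induction_on with
  | empty =>
    have : phaseDiag (fun z : W → Bool => ∑ i ∈ (∅ : Finset ι), θ i z) = 1 := by
      simp [phaseDiag]
    rw [this, Finset.card_empty, zero_mul]
    exact CtrlCircuit.one
  | insert a s ha ih =>
    have h1 : phaseDiag (fun z => ∑ i ∈ insert a s, θ i z) =
        phaseDiag (fun z => ∑ i ∈ s, θ i z) * phaseDiag (θ a) := by
      simp only [phaseDiag, diagonal_mul_diagonal, Finset.sum_insert ha]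
      congr 1
      funext z
      rw [← Complex.exp_add]
      push_cast
      ring_nf
    rw [h1, Finset.card_insert_of_notMem ha, add_mul, one_mul]
    exact (ih fun i hi => h i (Finset.mem_insert_of_mem hi)).mul (h a (Finset.mem_insert_self _ _))

theorem phaseDiag_const_circuit (t : ℝ) : CtrlCircuit (phaseDiag fun _ : W → Bool => t) 1 := by
  have : phaseDiag (fun _ : W → Bool => t) = Complex.exp (t * Complex.I) • 1 := by
    rw [phaseDiag, smul_one_eq_diagonal]
  rw [this]
  exact CtrlCircuit.phase (Complex.norm_exp_ofReal_mul_I t)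

/-- The single-qubit phase gate. -/
noncomputable def phaseGate (t : ℝ) : Matrix Bool Bool ℂ :=
  diagonal fun b => if b then Complex.exp (t * Complex.I) else 1

theorem phaseGate_unitary (t : ℝ) : phaseGate t ∈ unitaryGroup Bool ℂ := by
  rw [mem_unitaryGroup_iff, star_eq_conjTranspose, phaseGate, diagonal_conjTranspose,
    diagonal_mul_diagonal, ← diagonal_one]
  congr 1
  funext b
  cases b
  · simp
  · simp [Complex.mul_conj, Complex.normSq_eq_norm_sq, Complex.norm_exp_ofReal_mul_I]

theorem onWires_diagonal {V : Type} [Fintype V] [DecidableEq V] (f : V → W)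
    (v : (V → Bool) → ℂ) :
    onWires f (diagonal v) = diagonal fun z => v (z ∘ f) := by
  ext x y
  simp only [onWires, diagonal_apply]
  by_cases h : x = y
  · simp [h]
  · rw [if_neg h]
    split_ifs with h1 h2
    · exfalso
      apply h
      funext w
      by_cases hw : ∀ v, f v ≠ w
      · exact h1 w hw
      · push Not at hw
        obtain ⟨v, rfl⟩ := hw
        exact congrFun h2 v
    · rfl
    · rfl

theorem oneQ_phaseGate (t : ℝ) :
    oneQ (phaseGate t) = phaseDiag fun z => if z () then t else 0 := by
  ext x y
  have : x = y ↔ x () = y () := ⟨fun h => congrFun h (), fun h => funext fun _ => h⟩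
  simp only [oneQ, phaseGate, phaseDiag, diagonal_apply, this]
  split_ifs <;> simp

theorem ctrl_phaseDiag (θ : (W → Bool) → ℝ) :
    ctrl (phaseDiag θ) = phaseDiag fun z => if z (Sum.inl ()) then θ (z ∘ Sum.inr) else 0 := by
  ext x y
  obtain ⟨a, x, rfl⟩ := exists_qcons x
  obtain ⟨b, y, rfl⟩ := exists_qcons y
  rw [ctrl_qcons]
  simp only [phaseDiag, diagonal_apply, qcons_inj]
  by_cases hab : a = b
  · subst hab
    by_cases hxy : x = y
    · cases a <;> simp [hxy, qcons]
    · cases a <;> simp [hxy]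
  · simp [hab]

theorem phaseDiag_bit_circuit (w : W) (t : ℝ) :
    CtrlCircuit (phaseDiag fun z : W → Bool => if z w then t else 0) 1 := by
  have h := (CtrlCircuit.oneQ (phaseGate_unitary t)).onWires (fun _ : Unit => w)
    (injective_of_subsingleton _)
  rw [oneQ_phaseGate, phaseDiag, onWires_diagonal] at h
  exact h

theorem phaseDiag_bit_bit_circuit {w w' : W} (hw : w ≠ w') (t : ℝ) :
    CtrlCircuit (phaseDiag fun z : W → Bool => if z w then (if z w' then t else 0) else 0) 11 := by
  have hinj : Injective (Sum.elim (fun _ => w) (fun _ => w') : Unit ⊕ Unit → W) := by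
    rintro (_ | _) (_ | _) h <;> simp_all
  have h := (CtrlCircuit.oneQ (phaseGate_unitary t)).ctrl.onWires _ hinj
  rw [oneQ_phaseGate, ctrl_phaseDiag, phaseDiag, onWires_diagonal] at h
  exact h

end Phases

/-! ### LCU Fourier: cost and block-encoding -/

section FourierSelect

variable {d m K : ℕ} (E : FirstOrderPDE d m) (L : Fin d → ℝ)

theorem fourierMode_norm (k : Fin d → ℤ) (x : Fin d → ℝ) : ‖fourierMode L k x‖ = 1 := by
  rw [fourierMode, show (2 * Real.pi * Complex.I * ((∑ μ, (k μ : ℝ) * x μ / L μ : ℝ) : ℂ)) =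
    ((2 * Real.pi * ∑ μ, (k μ : ℝ) * x μ / L μ : ℝ) : ℂ) * Complex.I by push_cast; ring]
  exact Complex.norm_exp_ofReal_mul_I _

theorem bitsVal_cast {r : ℕ} (b : Fin r → Bool) :
    (bitsVal b : ℝ) = ∑ i, if b i then (2 : ℝ) ^ (i : ℕ) else 0 := by
  simp only [bitsVal, Nat.cast_sum, Nat.cast_ite, Nat.cast_pow, Nat.cast_ofNat, Nat.cast_zero]

/-- The monomial of degree at most two belonging to at most one bit of each of two registers. -/
def bitMonomial {r m : ℕ} (w : Fin r → Bool) (w' : Fin m → Bool) :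
    Option (Fin r) × Option (Fin m) → ℝ → ℝ
  | (none, none), t => t
  | (some i, none), t => if w i then t else 0
  | (none, some j), t => if w' j then t else 0
  | (some i, some j), t => if w i then (if w' j then t else 0) else 0

/-- Expanding two affine functions of bits gives monomials with at most one bit from each register.
The index `none` stands for the constant term of a factor. -/
theorem affine_mul_affine_bits {r m : ℕ} (w : Fin r → Bool) (w' : Fin m → Bool) (k o h c : ℝ) :
    c * (((bitsVal w : ℝ) - k) * (o + h * (bitsVal w' : ℝ))) =
      ∑ p : Option (Fin r) × Option (Fin m), bitMonomial w w' p
        (c * ((p.1.elim (-k) fun i => 2 ^ (i : ℕ)) * p.2.elim o fun j => h * 2 ^ (j : ℕ))) := by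
  rw [Fintype.sum_prod_type, bitsVal_cast, bitsVal_cast]
  simp only [Fintype.sum_option, bitMonomial, Option.elim_none, Option.elim_some]
  have h1 : ∀ i : Fin r, (∑ j : Fin m, if w i then (if w' j then
      c * ((2 : ℝ) ^ (i : ℕ) * (h * 2 ^ (j : ℕ))) else 0) else 0) =
      c * (if w i then (2 : ℝ) ^ (i : ℕ) else 0) *
        (h * ∑ j, if w' j then (2 : ℝ) ^ (j : ℕ) else 0) := by
    intro i
    split_ifs
    · rw [Finset.mul_sum, Finset.mul_sum]
      refine Finset.sum_congr rfl fun j _ => ?_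
      split_ifs <;> ring
    · simp
  have h2 : (∑ j : Fin m, if w' j then c * (-k * (h * (2 : ℝ) ^ (j : ℕ))) else 0) =
      c * -k * (h * ∑ j, if w' j then (2 : ℝ) ^ (j : ℕ) else 0) := by
    rw [Finset.mul_sum, Finset.mul_sum]
    refine Finset.sum_congr rfl fun j _ => ?_
    split_ifs <;> ring
  have h3 : (∑ i : Fin r, if w i then c * ((2 : ℝ) ^ (i : ℕ) * o) else 0) =
      c * o * ∑ i, if w i then (2 : ℝ) ^ (i : ℕ) else 0 := by
    rw [Finset.mul_sum]
    refine Finset.sum_congr rfl fun j _ => ?_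
    split_ifs <;> ring
  simp only [Finset.sum_add_distrib, h1, h2, h3]
  rw [← Finset.sum_mul, ← Finset.mul_sum]
  ring

theorem fourierSelect_eq_phaseDiag : fourierSelect E L K = phaseDiag fun z =>
    ∑ q : Fin d × (Option (Fin (Nat.clog 2 (2 * K + 1))) × Option (Fin m)),
      bitMonomial (fun i => z (Sum.inl (q.1, i))) (fun j => z (Sum.inr (q.1, j))) q.2
        (2 * Real.pi / L q.1 * ((q.2.1.elim (-(K : ℝ)) fun i => 2 ^ (i : ℕ)) *
          q.2.2.elim (E.origin q.1) fun j => E.spacing q.1 * 2 ^ (j : ℕ))) := by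
  rw [fourierSelect, phaseDiag]
  congr 1
  funext z
  rw [fourierMode, show (2 * Real.pi * Complex.I * ((∑ μ, ((freqOf (K := K) (z ∘ Sum.inl)) μ : ℝ) *
    E.point (z ∘ Sum.inr) μ / L μ : ℝ) : ℂ)) =
    ((∑ μ, 2 * Real.pi / L μ * (((freqOf (K := K) (z ∘ Sum.inl)) μ : ℝ) *
      E.point (z ∘ Sum.inr) μ) : ℝ) : ℂ) * Complex.I by
      rw [show (∑ μ, 2 * Real.pi / L μ * (((freqOf (K := K) (z ∘ Sum.inl)) μ : ℝ) *
        E.point (z ∘ Sum.inr) μ)) = 2 * Real.pi * ∑ μ,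
          ((freqOf (K := K) (z ∘ Sum.inl)) μ : ℝ) * E.point (z ∘ Sum.inr) μ / L μ by
            rw [Finset.mul_sum]
            refine Finset.sum_congr rfl fun μ _ => ?_
            ring]
      push_cast
      ring]
  congr 3
  rw [Fintype.sum_prod_type]
  refine Finset.sum_congr rfl fun μ _ => ?_
  dsimp only
  rw [← affine_mul_affine_bits]
  simp only [freqOf, FirstOrderPDE.point, gridIdx, Function.comp_apply]
  push_cast
  rfl

/-- Each direction contributes `(r + 1) * (m + 1)` monomials for frequency registers of r qubits.
The dearest is a phase on two bits: one controlled phase gate plus 10 gates for the second control.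
-/
theorem fourierSelect_circuit : CtrlCircuit (fourierSelect (K := K) E L)
    (d * ((Nat.clog 2 (2 * K + 1) + 1) * (m + 1)) * 11) := by
  rw [fourierSelect_eq_phaseDiag]
  have h := phaseDiag_sum_circuit (W := FouW d K ⊕ SysW d m) Finset.univ
    (fun (q : Fin d × (Option (Fin (Nat.clog 2 (2 * K + 1))) × Option (Fin m))) z =>
      bitMonomial (fun i => z (Sum.inl (q.1, i))) (fun j => z (Sum.inr (q.1, j))) q.2
        (2 * Real.pi / L q.1 * ((q.2.1.elim (-(K : ℝ)) fun i => 2 ^ (i : ℕ)) *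
          q.2.2.elim (E.origin q.1) fun j => E.spacing q.1 * 2 ^ (j : ℕ)))) 11 ?_
  · simpa [Fintype.card_prod, Fintype.card_option] using h
  · rintro ⟨μ, i | i, j | j⟩ -
    · exact (phaseDiag_const_circuit _).mono (by norm_num)
    · exact (phaseDiag_bit_circuit (Sum.inr (μ, j)) _).mono (by norm_num)
    · exact (phaseDiag_bit_circuit (Sum.inl (μ, i)) _).mono (by norm_num)
    · exact phaseDiag_bit_bit_circuit (by simp) _

theorem fourierSelect_eq_mux : fourierSelect (K := K) E L = mux fun b : FouW d K → Bool =>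
    diagonal fun x => fourierMode L (freqOf b) (E.point x) := by
  apply qop_sum_ext
  intro s x t y
  rw [mux_apply]
  simp only [fourierSelect, diagonal_apply, sumElim_eq_iff, Sum.elim_comp_inl, Sum.elim_comp_inr]
  by_cases h : s = t <;> simp [h]

theorem fourierSelect_unitary :
    fourierSelect (K := K) E L ∈ unitaryGroup (FouW d K ⊕ SysW d m → Bool) ℂ := by
  rw [mem_unitaryGroup_iff, star_eq_conjTranspose, fourierSelect, diagonal_conjTranspose,
    diagonal_mul_diagonal, ← diagonal_one]
  congr 1
  funext z
  simp [Complex.mul_conj, Complex.normSq_eq_norm_sq, fourierMode_norm]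

theorem lcuFourier_unitary {PL PR : QOp (FouW d K)} {α : ℝ} {c : (Fin d → ℤ) → ℂ}
    (h : IsFourierPrep α c PL PR) :
    lcuFourier E L PL PR ∈ unitaryGroup (FouW d K ⊕ SysW d m → Bool) ℂ :=
  mul_mem (mul_mem (conjTranspose_mem_unitary (onWires_mem_unitary _ Sum.inl_injective h.1))
    (fourierSelect_unitary E L)) (onWires_mem_unitary _ Sum.inl_injective h.2.1)

/-- The zero block is the sum over ancilla states weighted by the products of the prepared
amplitudes. These vanish on out-of-range frequencies, so exactly the Fourier sum survives. -/
theorem smul_zeroBlock_lcuFourier {PL PR : QOp (FouW d K)} {α : ℝ} {c : (Fin d → ℤ) → ℂ}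
    (h : IsFourierPrep α c PL PR) : (α : ℂ) • zeroBlock (lcuFourier E L PL PR) =
      diagonal fun x : SysW d m → Bool => fourierSum L K c (E.point x) := by
  ext x y
  rw [lcuFourier, fourierSelect_eq_mux, Matrix.smul_apply]
  simp only [zeroBlock, lcu_apply, diagonal_apply, smul_eq_mul, Finset.mul_sum]
  by_cases hxy : x = y
  · simp only [hxy, if_true, fourierSum]
    rw [← sum_freqOf fun k => c k * fourierMode L k (E.point y)]
    refine Finset.sum_congr rfl fun b _ => ?_
    split_ifs with hb
    · rw [← mul_assoc, (h.2.2 b).1 hb]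
    · rw [(h.2.2 b).2 hb, zero_mul, mul_zero]
  · simp [hxy]

open scoped Matrix.Norms.L2Operator in
theorem lcuFourier_isBlockEncoding {PL PR : QOp (FouW d K)} {α ε : ℝ} {c : (Fin d → ℤ) → ℂ}
    {f : (Fin d → ℝ) → ℝ} (hf : IsFourierApprox E L K f c α ε) (h : IsFourierPrep α c PL PR) :
    IsBlockEncoding α (d * Nat.clog 2 (2 * K + 1)) ε (lcuFourier E L PL PR) (E.diagOp f) := by
  refine ⟨by simp, lcuFourier_unitary E L h, ?_⟩
  rw [smul_zeroBlock_lcuFourier E L h, FirstOrderPDE.diagOp, ← cstar_norm_def, diagonal_sub, l2_opNorm_diagonal]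
  -- The spectral norm of a diagonal matrix is the largest modulus of its entries, so the pointwise
  -- bound at the grid points suffices; evaluation at any one of them shows ε ≥ 0.
  rw [pi_norm_le_iff_of_nonneg ((norm_nonneg _).trans (hf.2 default))]
  exact hf.2

theorem lcuFourier_circuit {PL PR : QOp (FouW d K)} {α : ℝ} {c : (Fin d → ℤ) → ℂ} {n : ℕ}
    (h : IsFourierPrep α c PL PR) (hL : CtrlCircuit PL n) (hR : CtrlCircuit PR n) :
    CtrlCircuit (lcuFourier E L PL PR)
      (n + d * ((Nat.clog 2 (2 * K + 1) + 1) * (m + 1)) * 11 + n) :=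
  (((hL.onWires _ Sum.inl_injective).conjTranspose
    (onWires_mem_unitary _ Sum.inl_injective h.1)).mul (fourierSelect_circuit E L)).mul
      (hR.onWires _ Sum.inl_injective)

end FourierSelect

theorem sum_unitArrow {M : Type} [AddCommMonoid M] (f : (Unit → Bool) → M) :
    ∑ s, f s = f (fun _ => true) + f fun _ => false := by
  rw [← Fintype.sum_bool fun b => f fun _ => b]
  exact Fintype.sum_equiv (Equiv.funUnique Unit Bool) _ _ fun s => rfl

/-! ### The cyclic shift -/

section Increment

/-- Addition of `1` modulo `2 ^ r`. -/
def incBits : {r : ℕ} → (Fin r → Bool) → (Fin r → Bool)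
  | 0, x => x
  | _ + 1, x => Fin.cons (!x 0) (if x 0 then incBits (x ∘ Fin.succ) else x ∘ Fin.succ)

theorem bitsVal_incBits {r : ℕ} (x : Fin r → Bool) :
    bitsVal (incBits x) = if bitsVal x + 1 = 2 ^ r then 0 else bitsVal x + 1 := by
  induction r with
  | zero => simp [bitsVal]
  | succ r ih =>
    have h1 : incBits x 0 = !x 0 := rfl
    have h2 : incBits x ∘ Fin.succ = if x 0 then incBits (x ∘ Fin.succ) else x ∘ Fin.succ := rfl
    rw [bitsVal_succ, bitsVal_succ x, h1, h2, pow_succ]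
    cases x 0
    · simp only [Bool.not_false, if_true, Bool.false_eq_true, if_false]
      rw [if_neg (by omega)]
      omega
    · simp only [Bool.not_true, if_true, Bool.false_eq_true, if_false, ih]
      split_ifs <;> omega

theorem incBits_bijective {r : ℕ} : Bijective (incBits (r := r)) := by
  refine Finite.injective_iff_bijective.1 fun x y h => bitsVal_injective ?_
  have h1 := congrArg bitsVal h
  rw [bitsVal_incBits, bitsVal_incBits] at h1
  split_ifs at h1 <;> omega

/-- A carry reaches the higher bits exactly if the lowest bit is one before it is flipped. Hence the
controlled increment acts first, as the right-hand factor, and the flip second. Each bit costs one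
flip and one further control, 11 gates. -/
theorem permOp_incBits_succ (r : ℕ) : permOp (incBits (r := r + 1)) =
    onWires (finSuccWires r)
      (onWires Sum.inl (oneQ pauliX) * ctrl (permOp (incBits (r := r)))) := by
  rw [onWires_equiv, flip_eq_permOp]
  have hi : Involutive fun z : Unit ⊕ Fin r → Bool =>
      Sum.elim (fun _ => !z (Sum.inl ())) (z ∘ Sum.inr) := by
    intro z
    funext i
    rcases i with i | i <;> simp
  have hq : ∀ x : Fin (r + 1) → Bool, x ∘ finSuccWires r = qcons (x 0) (x ∘ Fin.succ) := by
    intro x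
    funext i
    rcases i with i | i <;> rfl
  ext x y
  rw [permOp_mul hi, hq, hq]
  have h1 : (Sum.elim (fun _ => !qcons (x 0) (x ∘ Fin.succ) (Sum.inl ()))
      (qcons (x 0) (x ∘ Fin.succ) ∘ Sum.inr) : Unit ⊕ Fin r → Bool) =
        qcons (!x 0) (x ∘ Fin.succ) := rfl
  rw [h1, ctrl_qcons]
  have h2 : x = incBits y ↔ x 0 = (!y 0) ∧
      x ∘ Fin.succ = if y 0 then incBits (y ∘ Fin.succ) else y ∘ Fin.succ := by
    constructor
    · rintro rfl
      exact ⟨rfl, rfl⟩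
    · rintro ⟨h0, h1⟩
      funext i
      cases i using Fin.cases with
      | zero => exact h0
      | succ i => exact congrFun h1 i
  simp only [permOp, h2]
  cases x 0 <;> cases y 0 <;> simp

theorem incBits_circuit (r : ℕ) : CtrlCircuit (permOp (incBits (r := r))) (11 * r) := by
  induction r with
  | zero =>
    have : permOp (incBits (r := 0)) = 1 := by
      ext x y
      simp only [permOp, incBits, one_apply]
      congr
    rw [this]
    exact CtrlCircuit.one
  | succ r ih =>
    rw [permOp_incBits_succ]
    exact ((CtrlCircuit.flip.mul ih.ctrl).onWires _ (Equiv.injective _)).mono (by omega)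

end Increment

/-! ### Block-encoding a weighted shift minus a diagonal -/

section Weights

variable {S : Type} [Fintype S] [DecidableEq S]

/-- A rotation with `c` on the diagonal. -/
noncomputable def rotGate (c : ℝ) : Matrix Bool Bool ℂ := fun i j =>
  if i = j then (c : ℂ) else if i then (Real.sqrt (1 - c ^ 2) : ℂ) else -(Real.sqrt (1 - c ^ 2) : ℂ)

theorem rotGate_unitary {c : ℝ} (hc : c ∈ Set.Icc (-1 : ℝ) 1) : rotGate c ∈ unitaryGroup Bool ℂ := by
  have h : 0 ≤ 1 - c ^ 2 := by nlinarith [hc.1, hc.2]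
  have hs : (Real.sqrt (1 - c ^ 2) : ℂ) * (Real.sqrt (1 - c ^ 2) : ℂ) = 1 - (c : ℂ) ^ 2 := by
    rw [← Complex.ofReal_mul, Real.mul_self_sqrt h]
    push_cast
    rfl
  rw [mem_unitaryGroup_iff]
  ext i j
  cases i <;> cases j <;>
    simp [rotGate, mul_apply, star_apply, one_apply, hs, -Complex.ofReal_pow] <;> ring

theorem rotGate_one : rotGate 1 = 1 := by
  ext i j
  cases i <;> cases j <;> simp [rotGate]

/-- Block-encoding of a diagonal operator with entries in `[-1, 1]` by one ancilla qubit. -/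
noncomputable def weightOp (w : (S → Bool) → ℝ) : QOp (S ⊕ Unit) :=
  mux fun x => oneQ (rotGate (w x))

theorem weightOp_unitary {w : (S → Bool) → ℝ} (hw : ∀ x, w x ∈ Set.Icc (-1 : ℝ) 1) :
    weightOp w ∈ unitaryGroup (S ⊕ Unit → Bool) ℂ :=
  mux_mem_unitary fun x => oneQ_mem_unitary (rotGate_unitary (hw x))

/-- The rotation for the weight 1 is the identity, so rotations are needed only at the two
exceptional basis states, and the multiplexer over all states is avoided. -/
theorem weightOp_circuit {κ : ℕ} (hκ : PointCost S κ) {p q : S → Bool} (hpq : p ≠ q) {a b : ℝ}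
    (ha : a ∈ Set.Icc (-1 : ℝ) 1) (hb : b ∈ Set.Icc (-1 : ℝ) 1) :
    CtrlCircuit (weightOp fun x => if x = p then a else if x = q then b else 1)
      (2 * (κ + 1)) := by
  have h := (hκ Unit p _ _ (CtrlCircuit.oneQ (rotGate_unitary ha))).mul
    (hκ Unit q _ _ (CtrlCircuit.oneQ (rotGate_unitary hb)))
  rw [mux_mul] at h
  have h1 : (fun x => (if x = p then oneQ (rotGate a) else 1) *
      if x = q then oneQ (rotGate b) else 1) =
        fun x => oneQ (rotGate (if x = p then a else if x = q then b else 1)) := by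
    funext x
    by_cases hp : x = p
    · have hq : x ≠ q := hp ▸ hpq
      simp [hp, hpq]
    · by_cases hq : x = q <;> simp [hp, hq, rotGate_one, oneQ_one, Ne.symm hpq]
  rw [h1] at h
  exact h.mono (by omega)

/-- Block-encoding of `± τ (diag w * Q - diag w')` by two ancilla qubits. -/
theorem exists_difference_circuit {Q : QOp S} (hQ : Q ∈ unitaryGroup (S → Bool) ℂ) {n n₁ n₂ : ℕ}
    (hQn : CtrlCircuit Q n) {w w' : (S → Bool) → ℝ} (hw : ∀ x, w x ∈ Set.Icc (-1 : ℝ) 1)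
    (hw' : ∀ x, w' x ∈ Set.Icc (-1 : ℝ) 1) (hwn : CtrlCircuit (weightOp w) n₁)
    (hwn' : CtrlCircuit (weightOp w') n₂) {τ σ : ℝ} (hτ : 0 ≤ τ) (hτ' : τ ≤ 1 / 2)
    (hσ : σ ^ 2 = 1) :
    ∃ U : QOp (Unit ⊕ (S ⊕ Unit)), U ∈ unitaryGroup (Unit ⊕ (S ⊕ Unit) → Bool) ℂ ∧
      CtrlCircuit U (n + n₁ + n₂ + 26) ∧ ∀ x y : S → Bool,
        U (Sum.elim (zeroKet Unit) (Sum.elim x (zeroKet Unit)))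
          (Sum.elim (zeroKet Unit) (Sum.elim y (zeroKet Unit))) =
        σ * τ * (w x * Q x y - if x = y then (w' x : ℂ) else 0) := by
  -- One selector qubit has no junk state, so the slack is produced by unequal amplitudes: (cos θ,
  -- sin θ) on the left and σ (sin θ, -cos θ) on the right give the products ± σ sin θ cos θ = ± σ
  -- τ. This is possible exactly because 2τ ≤ 1.
  set θ := Real.arcsin (2 * τ) / 2 with hθ
  have hsc : Real.sin θ * Real.cos θ = τ := by
    have h1 : Real.sin (2 * θ) = 2 * τ := by
      rw [hθ, mul_div_cancel₀ _ (two_ne_zero), Real.sin_arcsin (by linarith) (by linarith)]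
    rw [Real.sin_two_mul] at h1
    linarith
  have hn : Real.cos θ ^ 2 + Real.sin θ ^ 2 = 1 := Real.cos_sq_add_sin_sq θ
  obtain ⟨UL, hUL, hL, hLn⟩ := (Prepable.unit fun s =>
    if s () then (Real.sin θ : ℂ) else Real.cos θ).exists_unitary (by
      rw [sum_unitArrow]
      simp only [if_true, Bool.false_eq_true, if_false, Complex.norm_real, Real.norm_eq_abs, sq_abs]
      linarith)
  obtain ⟨UR, hUR, hR, hRn⟩ := (Prepable.unit fun s =>
    if s () then ((-(σ * Real.cos θ) : ℝ) : ℂ) else ((σ * Real.sin θ : ℝ) : ℂ)).exists_unitary (by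
      rw [sum_unitArrow]
      simp only [if_true, Bool.false_eq_true, if_false, Complex.norm_real, Real.norm_eq_abs, sq_abs]
      rw [neg_sq, mul_pow, mul_pow, hσ]
      linarith)
  let F : (Unit → Bool) → QOp (S ⊕ Unit) := fun s =>
    if s () then weightOp w' else weightOp w * onWires Sum.inl Q
  have hF : ∀ s, F s ∈ unitaryGroup (S ⊕ Unit → Bool) ℂ := by
    intro s
    simp only [F]
    split_ifs
    · exact weightOp_unitary hw'
    · exact mul_mem (weightOp_unitary hw) (onWires_mem_unitary _ Sum.inl_injective hQ)
  have hFn : CtrlCircuit (mux F) (n₂ + (n₁ + n) + 22) := by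
    have h1 : ∑ s : Unit → Bool, (if s () then n₂ else n₁ + n) = n₂ + (n₁ + n) := by
      rw [sum_unitArrow]
      simp
    rw [← h1]
    refine MuxCost.unit _ _ _ fun s => ?_
    simp only [F]
    split_ifs
    · exact hwn'
    · exact hwn.mul (hQn.onWires _ Sum.inl_injective)
  refine ⟨(onWires Sum.inl UL)ᴴ * mux F * onWires Sum.inl UR,
    mul_mem (mul_mem (conjTranspose_mem_unitary (onWires_mem_unitary _ Sum.inl_injective hUL))
      (mux_mem_unitary hF)) (onWires_mem_unitary _ Sum.inl_injective hUR),
    ((((hLn.onWires _ Sum.inl_injective).conjTranspose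
      (onWires_mem_unitary _ Sum.inl_injective hUL)).mul hFn).mul
        (hRn.onWires _ Sum.inl_injective)).mono (by omega), fun x y => ?_⟩
  have hrot : ∀ c : ℝ, oneQ (rotGate c) (zeroKet Unit) (zeroKet Unit) = c := by
    intro c
    simp [oneQ, rotGate]
  have h1 : weightOp w' (Sum.elim x (zeroKet Unit)) (Sum.elim y (zeroKet Unit)) =
      if x = y then (w' x : ℂ) else 0 := by
    rw [weightOp, mux_apply, hrot]
  have h0 : (weightOp w * onWires Sum.inl Q : QOp (S ⊕ Unit)) (Sum.elim x (zeroKet Unit))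
      (Sum.elim y (zeroKet Unit)) = w x * Q x y := by
    simp only [mul_apply, sum_sumArrow, weightOp, mux_apply, onWires_inl_apply]
    rw [Finset.sum_eq_single x, Finset.sum_eq_single (zeroKet Unit)]
    · rw [if_pos rfl, if_pos rfl, hrot]
    · intro z _ hz
      rw [if_neg hz, mul_zero]
    · simp
    · intro z _ hz
      exact Finset.sum_eq_zero fun _ _ => by rw [if_neg (Ne.symm hz), zero_mul]
    · simp
  rw [lcu_apply, sum_unitArrow]
  simp only [hL, hR, F, if_true, Bool.false_eq_true, if_false, h0, h1, ← hsc]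
  rw [show star (Real.sin θ : ℂ) = Real.sin θ from Complex.conj_ofReal _,
    show star (Real.cos θ : ℂ) = Real.cos θ from Complex.conj_ofReal _]
  push_cast
  ring

end Weights

/-! ### Exact block-encodings of the difference operators -/

section Differences

variable {d m a : ℕ}

/-- The wires of direction `μ` and the first two ancillas. -/
def directionWires (ha : 2 ≤ a) (μ : Fin d) : Unit ⊕ (Fin m ⊕ Unit) → Fin a ⊕ SysW d m :=
  Sum.elim (fun _ => Sum.inl ⟨0, by omega⟩)
    (Sum.elim (fun i => Sum.inr (μ, i)) fun _ => Sum.inl ⟨1, by omega⟩)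

theorem directionWires_injective (ha : 2 ≤ a) (μ : Fin d) :
    Injective (directionWires (m := m) ha μ) := by
  rintro (_ | _ | _) (_ | _ | _) h <;> simp_all [directionWires]

theorem zeroBlock_directionWires (ha : 2 ≤ a) (μ : Fin d) (U : QOp (Unit ⊕ (Fin m ⊕ Unit)))
    (x y : SysW d m → Bool) :
    zeroBlock (onWires (directionWires ha μ) U) x y =
      if ∀ ν, ν ≠ μ → gridIdx x ν = gridIdx y ν then
        U (Sum.elim (zeroKet Unit) (Sum.elim (fun i => x (μ, i)) (zeroKet Unit)))
          (Sum.elim (zeroKet Unit) (Sum.elim (fun i => y (μ, i)) (zeroKet Unit))) else 0 := by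
  have hc : ∀ x : SysW d m → Bool, Sum.elim (zeroKet (Fin a)) x ∘ directionWires ha μ =
      Sum.elim (zeroKet Unit) (Sum.elim (fun i => x (μ, i)) (zeroKet Unit)) := by
    intro x
    funext i
    rcases i with _ | _ | _ <;> rfl
  rw [zeroBlock, onWires_apply_of_iff (p := ∀ ν, ν ≠ μ → gridIdx x ν = gridIdx y ν), hc, hc]
  constructor
  · intro h ν hν
    refine congrArg bitsVal (funext fun i => ?_)
    refine h (Sum.inr (ν, i)) ?_
    rintro (_ | _ | _) <;> simp [directionWires, Ne.symm hν]
  · rintro h (i | ⟨ν, i⟩) hw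
    · rfl
    · have hν : ν ≠ μ := by
        rintro rfl
        exact hw (Sum.inr (Sum.inl i)) rfl
      exact congrFun (bitsVal_injective (h ν hν)) i

theorem bitsVal_eq_zero_iff {r : ℕ} (x : Fin r → Bool) :
    bitsVal x = 0 ↔ x = fun _ => false := by
  rw [← bitsVal_zero (r := r), bitsVal_injective.eq_iff]

theorem bitsVal_add_one_eq_iff {r : ℕ} (x : Fin r → Bool) :
    bitsVal x + 1 = 2 ^ r ↔ x = fun _ => true := by
  rw [← bitsVal_true (r := r), add_left_inj, bitsVal_injective.eq_iff]

theorem diag_eq (B : BoundaryClosure) (x : Fin m → Bool) : B.diag (2 ^ m) (bitsVal x) =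
    if x = (fun _ => false) then B.first else if x = (fun _ => true) then B.last else 1 := by
  simp only [BoundaryClosure.diag, bitsVal_eq_zero_iff, bitsVal_add_one_eq_iff]

theorem diag_mem (B : BoundaryClosure) (N i : ℕ) : B.diag N i ∈ Set.Icc (-1 : ℝ) 1 := by
  rw [BoundaryClosure.diag]
  split_ifs
  · exact B.first_mem
  · exact B.last_mem
  · norm_num

theorem diag_circuit (hm : 0 < m) (B : BoundaryClosure) :
    CtrlCircuit (weightOp fun x : Fin m → Bool => B.diag (2 ^ m) (bitsVal x))
      (2 * (12 * m + 1)) := by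
  simp only [diag_eq]
  refine weightOp_circuit (PointCost.fin m) ?_ B.first_mem B.last_mem
  intro h
  have := congrFun h ⟨0, hm⟩
  simp at this

theorem wrap_circuit (hm : 0 < m) (B : BoundaryClosure) (b : Bool) :
    CtrlCircuit (weightOp fun x : Fin m → Bool => if x = (fun _ => b) then B.wrap else 1)
      (2 * (12 * m + 1)) := by
  -- Only one row carries a wrap-around weight; the second exceptional point is a dummy with weight
  -- 1.
  have h := weightOp_circuit (PointCost.fin m) (p := fun _ => b) (q := fun _ => !b) ?_
    B.wrap_mem (b := 1) (by norm_num)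
  · simpa using h
  · intro h
    have := congrFun h ⟨0, hm⟩
    cases b <;> simp at this

theorem wrap_mem_Icc (B : BoundaryClosure) (p : Prop) [Decidable p] :
    (if p then B.wrap else 1) ∈ Set.Icc (-1 : ℝ) 1 := by
  split_ifs
  · exact B.wrap_mem
  · norm_num

/-- An operator that acts as a one-dimensional difference in direction `μ`. -/
theorem exists_direction_blockEncoding (ha : 2 ≤ a) (μ : Fin d) {Q : QOp (Fin m)}
    (hQ : Q ∈ unitaryGroup (Fin m → Bool) ℂ) (hQn : CtrlCircuit Q (11 * m))
    {w w' : (Fin m → Bool) → ℝ} (hw : ∀ x, w x ∈ Set.Icc (-1 : ℝ) 1)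
    (hw' : ∀ x, w' x ∈ Set.Icc (-1 : ℝ) 1) (hwn : CtrlCircuit (weightOp w) (2 * (12 * m + 1)))
    (hwn' : CtrlCircuit (weightOp w') (2 * (12 * m + 1))) {α h σ : ℝ} (hh : 0 < h)
    (hα : 2 / h ≤ α) (hσ : σ ^ 2 = 1) {D : QOp (SysW d m)}
    (hD : ∀ x y, D x y = if ∀ ν, ν ≠ μ → gridIdx x ν = gridIdx y ν then
      σ / h * (w (fun i => x (μ, i)) * Q (fun i => x (μ, i)) (fun i => y (μ, i)) -
        if (fun i => x (μ, i)) = (fun i => y (μ, i)) then (w' (fun i => x (μ, i)) : ℂ) else 0)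
      else 0) :
    ∃ U : QOp (Fin a ⊕ SysW d m), IsBlockEncoding α a 0 U D ∧ CtrlCircuit U (59 * m + 30) := by
  have hα0 : 0 < α := lt_of_lt_of_le (by positivity) hα
  -- The encoded factor is 1/h divided by the normalization; the bound 2 / h ≤ α says precisely that
  -- it is at most 1/2.
  have hτ' : 1 / (α * h) ≤ 1 / 2 := by
    rw [div_le_div_iff₀ (by positivity) (by norm_num)]
    rw [div_le_iff₀ hh] at hα
    linarith
  obtain ⟨U, hU, hUn, hU0⟩ := exists_difference_circuit hQ hQn hw hw' hwn hwn'
    (τ := 1 / (α * h)) (by positivity) hτ' hσ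
  have hinj := directionWires_injective (m := m) ha μ
  refine ⟨onWires (directionWires ha μ) U, ⟨by simp, onWires_mem_unitary _ hinj hU, ?_⟩,
    (hUn.onWires _ hinj).mono (by omega)⟩
  have hz : D - (α : ℂ) • zeroBlock (onWires (directionWires ha μ) U) = 0 := by
    rw [sub_eq_zero]
    ext x y
    rw [hD, Matrix.smul_apply, zeroBlock_directionWires, hU0, smul_eq_mul]
    have h1 : (α : ℂ) ≠ 0 := Complex.ofReal_ne_zero.2 hα0.ne'
    have h2 : (h : ℂ) ≠ 0 := Complex.ofReal_ne_zero.2 hh.ne'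
    rw [mul_ite, mul_zero]
    refine if_congr Iff.rfl ?_ rfl
    push_cast
    field_simp
  rw [hz, map_zero, norm_zero]

/-- The shift in a forward difference is the inverse of the increment. Its only entry that wraps
around lies in the last row, the state with all bits set, so reweighting that row reweights the
coupling. -/
theorem forwardEntry_eq (B : BoundaryClosure) (h : ℝ) (u v : Fin m → Bool) :
    (forwardEntry B (2 ^ m) h (bitsVal u) (bitsVal v) : ℂ) = ((1 : ℝ) : ℂ) / h *
      (((if u = (fun _ => true) then B.wrap else 1 : ℝ) : ℂ) * (permOp incBits)ᴴ u v -
        if u = v then (B.diag (2 ^ m) (bitsVal u) : ℂ) else 0) := by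
  rw [forwardEntry]
  simp only [conjTranspose_apply, permOp, ← bitsVal_injective.eq_iff (a := v),
    ← bitsVal_injective.eq_iff (a := u) (b := v), ← bitsVal_add_one_eq_iff, bitsVal_incBits]
  have hv := bitsVal_lt v
  push_cast
  rw [div_eq_inv_mul, one_div]
  congr 2
  · by_cases h1 : bitsVal u + 1 = 2 ^ m
    · rw [if_neg (by omega)]
      by_cases h2 : bitsVal v = 0 <;> simp [h1, h2]
    · by_cases h2 : bitsVal v = bitsVal u + 1 <;> simp [h1, h2]
  · split_ifs <;> rfl

/-- Here the shift is the increment itself, the wrap-around entry lies in row 0, and the overall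
sign is -1. -/
theorem backwardEntry_eq (B : BoundaryClosure) (h : ℝ) (u v : Fin m → Bool) :
    (backwardEntry B (2 ^ m) h (bitsVal u) (bitsVal v) : ℂ) = ((-1 : ℝ) : ℂ) / h *
      (((if u = (fun _ => false) then B.wrap else 1 : ℝ) : ℂ) * permOp incBits u v -
        if u = v then (B.diag (2 ^ m) (bitsVal u) : ℂ) else 0) := by
  rw [backwardEntry]
  simp only [permOp, ← bitsVal_injective.eq_iff (a := u) (b := incBits v),
    ← bitsVal_injective.eq_iff (a := u) (b := v), ← bitsVal_eq_zero_iff, bitsVal_incBits]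
  have hv := bitsVal_lt u
  push_cast
  rw [div_eq_inv_mul, neg_div, one_div, neg_mul, ← mul_neg, neg_sub]
  congr 2
  · split_ifs <;> rfl
  · by_cases h1 : bitsVal v + 1 = 2 ^ m
    · rw [if_neg (by omega)]
      by_cases h2 : bitsVal u = 0 <;> simp [h1, h2]
    · by_cases h2 : bitsVal u = bitsVal v + 1 <;> simp [h1, h2]

variable (E : FirstOrderPDE d m)

theorem exists_diffPlus_blockEncoding (hm : 0 < m) (ha : 2 ≤ a) (μ : Fin d) {α : ℝ}
    (hα : 2 / E.spacing μ ≤ α) : ∃ U : QOp (Fin a ⊕ SysW d m),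
      IsBlockEncoding α a 0 U (E.diffPlus μ) ∧ CtrlCircuit U (59 * m + 30) := by
  have hQ := permOp_mem_unitary (incBits_bijective (r := m))
  refine exists_direction_blockEncoding ha μ (conjTranspose_mem_unitary hQ)
    ((incBits_circuit m).conjTranspose hQ) (fun x => wrap_mem_Icc (E.bcPlus μ) _)
    (fun x => diag_mem (E.bcPlus μ) (2 ^ m) (bitsVal x)) (wrap_circuit hm (E.bcPlus μ) true)
    (diag_circuit hm _) (E.spacing_pos μ) hα (one_pow 2) fun x y => ?_
  rw [FirstOrderPDE.diffPlus]
  exact if_congr Iff.rfl (forwardEntry_eq _ _ _ _) rfl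

theorem exists_diffMinus_blockEncoding (hm : 0 < m) (ha : 2 ≤ a) (μ : Fin d) {α : ℝ}
    (hα : 2 / E.spacing μ ≤ α) : ∃ U : QOp (Fin a ⊕ SysW d m),
      IsBlockEncoding α a 0 U (E.diffMinus μ) ∧ CtrlCircuit U (59 * m + 30) := by
  have hQ := permOp_mem_unitary (incBits_bijective (r := m))
  refine exists_direction_blockEncoding ha μ hQ
    (incBits_circuit m) (fun x => wrap_mem_Icc (E.bcMinus μ) _)
    (fun x => diag_mem (E.bcMinus μ) (2 ^ m) (bitsVal x)) (wrap_circuit hm (E.bcMinus μ) false)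
    (diag_circuit hm _) (E.spacing_pos μ) hα (σ := -1) (by norm_num) fun x y => ?_
  rw [FirstOrderPDE.diffMinus]
  exact if_congr Iff.rfl (backwardEntry_eq _ _ _ _) rfl

end Differences

/-! ### Zero blocks of products and their norms -/

section ZeroBlock

variable {A A' S : Type} [Fintype A] [Fintype A'] [Fintype S] [DecidableEq A] [DecidableEq A']
  [DecidableEq S]

/-- The operator acts as the identity on all ancillas that are not in `Q`. -/
def ActsOnAncillas (Q : A → Prop) (M : QOp (A ⊕ S)) : Prop :=
  ∀ x y, M x y ≠ 0 → ∀ a, ¬ Q a → x (Sum.inl a) = y (Sum.inl a)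

/-- Each ancilla is left alone by at least one of the factors. Between two all-zero ancilla states
the intermediate state must therefore be all-zero too, and the sum over it collapses. -/
theorem zeroBlock_mul {Q Q' : A → Prop} {M M' : QOp (A ⊕ S)} (h : ActsOnAncillas Q M)
    (h' : ActsOnAncillas Q' M') (hQ : ∀ a, Q a → ¬ Q' a) :
    zeroBlock (M * M') = zeroBlock M * zeroBlock M' := by
  ext x y
  simp only [zeroBlock, mul_apply, sum_sumArrow]
  rw [Finset.sum_eq_single (zeroKet A)]
  · intro z _ hz
    refine Finset.sum_eq_zero fun w _ => ?_
    by_contra hne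
    apply hz
    funext a
    by_cases ha : Q a
    · exact h' _ _ (right_ne_zero_of_mul hne) a (hQ a ha)
    · exact (h _ _ (left_ne_zero_of_mul hne) a ha).symm
  · simp

theorem ActsOnAncillas.mul {Q Q' : A → Prop} {M M' : QOp (A ⊕ S)} (h : ActsOnAncillas Q M)
    (h' : ActsOnAncillas Q' M') : ActsOnAncillas (fun a => Q a ∨ Q' a) (M * M') := by
  intro x y hxy a ha
  push Not at ha
  rw [mul_apply] at hxy
  obtain ⟨z, _, hz⟩ := Finset.exists_ne_zero_of_sum_ne_zero hxy
  exact (h _ _ (left_ne_zero_of_mul hz) a ha.1).trans (h' _ _ (right_ne_zero_of_mul hz) a ha.2)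

theorem actsOnAncillas_onWires (g : A' → A) (U : QOp (A' ⊕ S)) :
    ActsOnAncillas (fun a => ∃ a', g a' = a) (onWires (Sum.map g id) U) := by
  intro x y hxy a ha
  rw [onWires] at hxy
  by_contra hne
  apply hxy
  rw [if_neg]
  intro h
  apply hne
  apply h
  rintro (a' | s)
  · intro h
    exact ha ⟨a', Sum.inl_injective h⟩
  · simp

theorem zeroBlock_onWires (g : A' → A) (U : QOp (A' ⊕ S)) :
    zeroBlock (onWires (Sum.map g id) U) = zeroBlock U := by
  ext x y
  have hc : ∀ x : S → Bool, Sum.elim (zeroKet A) x ∘ Sum.map g id = Sum.elim (zeroKet A') x := by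
    intro x
    funext i
    rcases i with _ | _ <;> rfl
  rw [zeroBlock, onWires, hc, hc, if_pos]
  · rfl
  · rintro (a | s) h
    · rfl
    · exact absurd rfl (h (Sum.inr s))

open scoped Matrix.Norms.L2Operator

theorem norm_le_one_of_isometry {m n : Type} [Fintype m] [Fintype n] [DecidableEq m]
    [DecidableEq n] [Nonempty n] {M : Matrix m n ℂ} (h : Mᴴ * M = 1) : ‖M‖ ≤ 1 := by
  have h1 := l2_opNorm_conjTranspose_mul_self M
  rw [h, norm_one] at h1
  nlinarith [norm_nonneg M]

/-- The zero block is the compression J†UJ of a unitary by the isometry J. -/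
theorem norm_zeroBlock_le {U : QOp (A ⊕ S)} (hU : U ∈ unitaryGroup (A ⊕ S → Bool) ℂ) :
    ‖zeroBlock U‖ ≤ 1 := by
  have hJ : (zeroInj A S)ᴴ * zeroInj A S = 1 := by
    ext x y
    simp only [mul_apply, conjTranspose_apply, zeroInj, one_apply, mul_ite, mul_one, mul_zero,
      Finset.sum_ite_eq', Finset.mem_univ, if_true, sumElim_eq_iff, true_and, apply_ite star,
      star_one, star_zero]
    simp only [eq_comm]
  have h : zeroBlock U = (zeroInj A S)ᴴ * U * zeroInj A S := by
    ext x y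
    simp [zeroBlock, mul_apply, zeroInj, apply_ite star]
  have hJn := norm_le_one_of_isometry hJ
  have hUn := norm_le_one_of_isometry (star_eq_conjTranspose U ▸ mem_unitaryGroup_iff'.1 hU)
  rw [h]
  calc _ ≤ ‖(zeroInj A S)ᴴ * U‖ * ‖zeroInj A S‖ := l2_opNorm_mul _ _
    _ ≤ (‖(zeroInj A S)ᴴ‖ * ‖U‖) * ‖zeroInj A S‖ := by
        gcongr
        exact l2_opNorm_mul _ _
    _ ≤ (1 * 1) * 1 := by
        rw [l2_opNorm_conjTranspose]
        gcongr
    _ = 1 := by norm_num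

theorem IsBlockEncoding.norm_sub_le {α ε : ℝ} {n : ℕ} {U : QOp (A ⊕ S)} {M : QOp S}
    (h : IsBlockEncoding α n ε U M) : ‖M - (α : ℂ) • zeroBlock U‖ ≤ ε := h.2.2

theorem IsBlockEncoding.eq_smul {α : ℝ} {n : ℕ} {U : QOp (A ⊕ S)} {M : QOp S}
    (h : IsBlockEncoding α n 0 U M) : (α : ℂ) • zeroBlock U = M :=
  (sub_eq_zero.1 (norm_le_zero_iff.1 h.norm_sub_le)).symm

/-- This bounds the factor by which an exactly encoded difference operator enlarges the error of a
coefficient. -/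
theorem IsBlockEncoding.norm_le {α : ℝ} (hα : 0 ≤ α) {n : ℕ} {U : QOp (A ⊕ S)} {M : QOp S}
    (h : IsBlockEncoding α n 0 U M) : ‖M‖ ≤ α := by
  rw [← h.eq_smul, norm_smul, Complex.norm_real, Real.norm_of_nonneg hα]
  exact mul_le_of_le_one_right hα (norm_zeroBlock_le h.2.1)

end ZeroBlock

/-! ### The terms and the selector state -/

section Terms

variable {d m K a : ℕ}

theorem termNum_lt (t : TermIdx d) : termNum t < 4 * d + 1 := by
  rcases t with (μ | μ) | (μ | μ) | _ <;> simp only [termNum] <;> omega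

theorem termNum_injective : Injective (termNum (d := d)) := by
  rintro ((μ | μ) | (μ | μ) | _) ((ν | ν) | (ν | ν) | _) h <;> simp only [termNum] at h <;>
    first
      | rfl
      | (exfalso; omega)
      | (have : μ = ν := Fin.ext (by omega)
         rw [this])

/-- There are 2d coefficients of modulus 1/2 and 2d + 1 of modulus 1. -/
theorem sum_abs_termCoeff {s : ℝ} (hs : s = 1 ∨ s = -1) :
    ∑ t : TermIdx d, |termCoeff s t| = 3 * d + 1 := by
  have h1 : |s| = 1 := by rcases hs with rfl | rfl <;> simp
  simp only [Fintype.sum_sum_type, termCoeff, abs_neg, h1]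
  simp
  ring

theorem sum_ite_termNum {M : Type} [AddCommMonoid M] (t : TermIdx d) (x : M) :
    ∑ b : SelW d → Bool, (if termNum t = bitsVal b then x else 0) = x := by
  obtain ⟨b, hb⟩ : ∃ b : SelW d → Bool, bitsVal b = termNum t :=
    exists_bitsVal ((termNum_lt t).trans_le (Nat.le_pow_clog one_lt_two _))
  rw [Finset.sum_eq_single b]
  · rw [if_pos hb.symm]
  · intro b' _ hb'
    rw [if_neg]
    intro h
    exact hb' (bitsVal_injective (h.symm.trans hb.symm))
  · simp

theorem termNorm_le_max {aKappa aBeta aGamma aDiff : ℝ} (t : TermIdx d) :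
    termNorm aKappa aBeta aGamma aDiff t ≤
      max (aKappa * aDiff ^ 2) (max (aBeta * aDiff) aGamma) := by
  rcases t with _ | _ | _ <;> simp [termNorm]

theorem termNorm_nonneg {aKappa aBeta aGamma aDiff : ℝ} (hκ : 0 ≤ aKappa) (hβ : 0 ≤ aBeta)
    (hγ : 0 ≤ aGamma) (hD : 0 ≤ aDiff) (t : TermIdx d) :
    0 ≤ termNorm aKappa aBeta aGamma aDiff t := by
  rcases t with _ | _ | _ <;> simp only [termNorm] <;> positivity

/-- The state-preparation pair of the selector. -/
theorem exists_selPrep (hd : 0 < d) {s : ℝ} (hs : s = 1 ∨ s = -1) {aKappa aBeta aGamma aDiff : ℝ}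
    (hκ : 0 ≤ aKappa) (hβ : 0 ≤ aBeta) (hγ : 0 ≤ aGamma) (hD : 0 ≤ aDiff) :
    ∃ UL UR : QOp (SelW d),
      (∀ V : Unitaries d m K a, V.selL = UL → V.selR = UR →
        V.IsSelPrep s aKappa aBeta aGamma aDiff) ∧
      CtrlCircuit UL (184 * (d + 1)) ∧ CtrlCircuit UR (184 * (d + 1)) := by
  set mx := max (aKappa * aDiff ^ 2) (max (aBeta * aDiff) aGamma) with hmx
  let y : TermIdx d → ℝ := fun t => termCoeff s t * (termNorm aKappa aBeta aGamma aDiff t / mx)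
  let g : (SelW d → Bool) → ℂ := fun b => ∑ t, if termNum t = bitsVal b then (y t : ℂ) else 0
  have hgt : ∀ b t, termNum t = bitsVal b → g b = y t := by
    intro b t h
    simp only [g]
    rw [Finset.sum_eq_single t]
    · rw [if_pos h]
    · intro t' _ ht'
      rw [if_neg]
      intro h'
      exact ht' (termNum_injective (h'.trans h.symm))
    · simp
  have hg0 : ∀ b, (∀ t : TermIdx d, termNum t ≠ bitsVal b) → g b = 0 := by
    intro b h
    exact Finset.sum_eq_zero fun t _ => if_neg (h t)
  have hy : ∀ t, |y t| ≤ |termCoeff s t| := by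
    intro t
    simp only [y]
    rw [abs_mul]
    refine mul_le_of_le_one_right (abs_nonneg _) ?_
    have h0 := termNorm_nonneg hκ hβ hγ hD t
    have h1 : termNorm aKappa aBeta aGamma aDiff t ≤ mx := termNorm_le_max t
    rw [abs_of_nonneg (div_nonneg h0 (h0.trans h1))]
    exact div_le_one_of_le₀ h1 (h0.trans h1)
  have hg : ∑ b, ‖g b‖ ≤ 3 * d + 1 := by
    calc ∑ b, ‖g b‖ ≤ ∑ b : SelW d → Bool, ∑ t, if termNum t = bitsVal b then |y t| else 0 := by
          refine Finset.sum_le_sum fun b _ => (norm_sum_le _ _).trans (le_of_eq ?_)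
          refine Finset.sum_congr rfl fun t _ => ?_
          split_ifs <;> simp
      _ = ∑ t, |y t| := by
          rw [Finset.sum_comm]
          exact Finset.sum_congr rfl fun t _ => sum_ite_termNum t _
      _ ≤ ∑ t : TermIdx d, |termCoeff s t| := Finset.sum_le_sum fun t _ => hy t
      _ = 3 * d + 1 := sum_abs_termCoeff hs
  -- Applied to 4d + 1 = 2 (2d) + 1, this shows that the all-ones selector state numbers no term and
  -- can serve as the junk state.
  have hpow := two_mul_add_two_le_pow_clog (N := 2 * d) (by omega)
  rw [← mul_assoc] at hpow
  norm_num at hpow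
  have hpow' := pow_clog_le (N := 4 * d + 1) (by omega)
  let j : SelW d → Bool := fun _ => true
  have htrue : bitsVal j + 1 = 2 ^ Nat.clog 2 (4 * d + 1) := bitsVal_true
  have hj : j ≠ zeroKet (SelW d) := by
    intro h
    have := congrArg bitsVal h
    rw [show bitsVal (zeroKet (SelW d)) = 0 from bitsVal_zero] at this
    omega
  have hgj : g j = 0 := by
    refine hg0 _ fun t ht => ?_
    have := termNum_lt t
    omega
  obtain ⟨vL, vR, hL, hR, h1, h2, -, -⟩ := exists_prep_pair g hg hj hgj
  obtain ⟨UL, hUL, hUL0, hULn⟩ := (Prepable.fin _ vL).exists_unitary hL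
  obtain ⟨UR, hUR, hUR0, hURn⟩ := (Prepable.fin _ vR).exists_unitary hR
  refine ⟨UL, UR, ?_, hULn.mono (by omega), hURn.mono (by omega)⟩
  rintro V rfl rfl
  refine ⟨hUL, hUR, fun b => ⟨fun t ht => ?_, fun h => ?_⟩⟩
  · rw [hUL0, hUR0]
    have := h1 b
    rw [hgt b t ht] at this
    rw [← this]
    push_cast
    rfl
  · rw [hUL0, hUR0]
    exact h2 b (hg0 b h)

end Terms

/-! ### The assembled unitary -/

namespace Unitaries

variable {d m K a : ℕ} (V : Unitaries d m K a)

/-- All wires, with the selector split off. -/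
def selEquiv (d m K a : ℕ) :
    SelW d ⊕ ((FouW d K ⊕ Fin a ⊕ Fin a) ⊕ SysW d m) ≃ AncW d K a ⊕ SysW d m :=
  (Equiv.sumAssoc _ _ _).symm

/-- The block-encoding of a term, without the wires of the selector. -/
noncomputable def restTerm : TermIdx d → QOp ((FouW d K ⊕ Fin a ⊕ Fin a) ⊕ SysW d m)
  | .inl (.inl μ) => onWires (Sum.map (Sum.inr ∘ Sum.inl) id) (V.uPlus μ) *
      onWires (Sum.map Sum.inl id) V.uKappa *
      onWires (Sum.map (Sum.inr ∘ Sum.inr) id) (V.uMinus μ)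
  | .inl (.inr μ) => onWires (Sum.map (Sum.inr ∘ Sum.inl) id) (V.uMinus μ) *
      onWires (Sum.map Sum.inl id) V.uKappa *
      onWires (Sum.map (Sum.inr ∘ Sum.inr) id) (V.uPlus μ)
  | .inr (.inl (.inl μ)) => onWires (Sum.map Sum.inl id) (V.uBetaPos μ) *
      onWires (Sum.map (Sum.inr ∘ Sum.inl) id) (V.uMinus μ)
  | .inr (.inl (.inr μ)) => onWires (Sum.map Sum.inl id) (V.uBetaNeg μ) *
      onWires (Sum.map (Sum.inr ∘ Sum.inl) id) (V.uPlus μ)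
  | .inr (.inr ()) => onWires (Sum.map Sum.inl id) V.uGamma

theorem onWires_fouWires (U : QOp (FouW d K ⊕ SysW d m)) : onWires (fouWires (a := a)) U =
    onWires (selEquiv d m K a) (onWires Sum.inr (onWires (Sum.map Sum.inl id) U)) := by
  rw [onWires_comp _ _ Sum.inr_injective, onWires_comp _ _ (Equiv.injective _)]
  congr 1
  funext i
  rcases i with i | i <;> rfl

theorem onWires_diffWires₁ (U : QOp (Fin a ⊕ SysW d m)) : onWires (diffWires₁ (K := K)) U =
    onWires (selEquiv d m K a) (onWires Sum.inr
      (onWires (Sum.map (Sum.inr ∘ Sum.inl) id) U)) := by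
  rw [onWires_comp _ _ Sum.inr_injective, onWires_comp _ _ (Equiv.injective _)]
  congr 1
  funext i
  rcases i with i | i <;> rfl

theorem onWires_diffWires₂ (U : QOp (Fin a ⊕ SysW d m)) : onWires (diffWires₂ (K := K)) U =
    onWires (selEquiv d m K a) (onWires Sum.inr
      (onWires (Sum.map (Sum.inr ∘ Sum.inr) id) U)) := by
  rw [onWires_comp _ _ Sum.inr_injective, onWires_comp _ _ (Equiv.injective _)]
  congr 1
  funext i
  rcases i with i | i <;> rfl

theorem term_eq (t : TermIdx d) :
    V.term t = onWires (selEquiv d m K a) (onWires Sum.inr (V.restTerm t)) := by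
  rcases t with (μ | μ) | (μ | μ) | _ <;>
    simp only [term, restTerm, onWires_mul _ Sum.inr_injective,
      onWires_mul _ (Equiv.injective _), onWires_fouWires, onWires_diffWires₁, onWires_diffWires₂]

/-- The operator applied to the other wires if the selector is in the state `b`. -/
noncomputable def selected (b : SelW d → Bool) : QOp ((FouW d K ⊕ Fin a ⊕ Fin a) ⊕ SysW d m) :=
  ∑ t : TermIdx d, (if bitsVal b = termNum t then V.restTerm t else 0) +
    (1 - ∑ t : TermIdx d, if bitsVal b = termNum t then 1 else 0)

theorem selected_of_eq {b : SelW d → Bool} {t : TermIdx d} (h : termNum t = bitsVal b) :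
    V.selected b = V.restTerm t := by
  have h1 : ∀ t' : TermIdx d, bitsVal b = termNum t' ↔ t' = t := by
    intro t'
    rw [← h, termNum_injective.eq_iff, eq_comm]
  simp [selected, h1]

theorem selected_of_ne {b : SelW d → Bool} (h : ∀ t : TermIdx d, termNum t ≠ bitsVal b) :
    V.selected b = 1 := by
  have h1 : ∀ t' : TermIdx d, ¬ bitsVal b = termNum t' := fun t' h' => h t' h'.symm
  simp [selected, h1]

/-- Once the selector is split off, the sum of projectors is block diagonal: the block of a selector
state is the term it numbers, or the identity if it numbers none. Cost, unitarity and zero block can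
then be treated blockwise. -/
theorem select_eq : V.select = onWires (selEquiv d m K a) (mux V.selected) := by
  have he : ∀ j, selProj d m K a j = onWires (selEquiv d m K a)
      (diagonal fun z => if bitsVal (z ∘ Sum.inl) = j then 1 else 0) := by
    intro j
    rw [onWires_diagonal]
    rfl
  have hs : ∀ (f : TermIdx d → QOp (SelW d ⊕ ((FouW d K ⊕ Fin a ⊕ Fin a) ⊕ SysW d m))),
      onWires (selEquiv d m K a) (∑ t, f t) = ∑ t, onWires (selEquiv d m K a) (f t) := by
    intro f
    ext x y
    rw [Matrix.sum_apply]
    simp only [onWires_equiv]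
    rw [Matrix.sum_apply]
  have ha : ∀ f g : QOp (SelW d ⊕ ((FouW d K ⊕ Fin a ⊕ Fin a) ⊕ SysW d m)),
      onWires (selEquiv d m K a) (f + (1 - g)) =
        onWires (selEquiv d m K a) f + (1 - onWires (selEquiv d m K a) g) := by
    intro f g
    rw [← onWires_one _ (Equiv.injective (selEquiv d m K a))]
    simp only [onWires_equiv]
    rfl
  simp only [select, he, term_eq, ← onWires_mul _ (Equiv.injective (selEquiv d m K a)), ← hs,
    ← ha]
  congr 1
  apply qop_sum_ext
  intro s x t y
  simp only [mux_apply, selected, Matrix.add_apply, Matrix.sub_apply, Matrix.sum_apply,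
    diagonal_mul, onWires_inr_apply, diagonal_apply, one_apply, sumElim_eq_iff]
  by_cases hst : s = t
  · subst hst
    simp only [if_true, true_and]
    congr 1
    · refine Finset.sum_congr rfl fun t _ => ?_
      have hc : bitsVal (Sum.elim s x ∘ Sum.inl) = bitsVal s := rfl
      by_cases h : bitsVal s = termNum t
      · rw [if_pos (hc.trans h), if_pos h, one_mul]
      · rw [if_neg (show ¬ bitsVal (Sum.elim s x ∘ Sum.inl) = termNum t from h), if_neg h, zero_mul, Matrix.zero_apply]
    · congr 1
      refine Finset.sum_congr rfl fun t _ => ?_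
      have hc : bitsVal (Sum.elim s x ∘ Sum.inl) = bitsVal s := rfl
      by_cases h : bitsVal s = termNum t
      · rw [if_pos (hc.trans h), if_pos h, one_apply]
      · rw [if_neg (show ¬ bitsVal (Sum.elim s x ∘ Sum.inl) = termNum t from h), if_neg h, ite_self, Matrix.zero_apply]
  · simp [hst]

theorem assembled_eq : V.assembled = onWires (selEquiv d m K a)
    ((onWires Sum.inl V.selL)ᴴ * mux V.selected * onWires Sum.inl V.selR) := by
  have h : ∀ U : QOp (SelW d), onWires (selWires (m := m) (K := K) (a := a)) U =
      onWires (selEquiv d m K a) (onWires Sum.inl U) := by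
    intro U
    rw [onWires_comp _ _ (Equiv.injective _)]
    congr 1
  rw [assembled, select_eq, h, h, onWires_mul _ (Equiv.injective _),
    onWires_mul _ (Equiv.injective _), onWires_conjTranspose]

theorem zeroBlock_assembled : zeroBlock V.assembled =
    ∑ b, (star (V.selL b (zeroKet _)) * V.selR b (zeroKet _)) • zeroBlock (V.selected b) := by
  ext x y
  have hc : ∀ x : SysW d m → Bool, Sum.elim (zeroKet (AncW d K a)) x ∘ selEquiv d m K a =
      Sum.elim (zeroKet (SelW d)) (Sum.elim (zeroKet (FouW d K ⊕ Fin a ⊕ Fin a)) x) := by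
    intro x
    funext i
    rcases i with i | i | i <;> rfl
  rw [zeroBlock, assembled_eq, onWires_equiv]
  simp only [hc, lcu_apply, Matrix.sum_apply, Matrix.smul_apply, smul_eq_mul, zeroBlock]

/-- A common case analysis for properties that are stable under products. It is applied to the gate
count, where the longest product has one coefficient and two difference operators, and to unitarity,
where the numbers are idle. -/
theorem restTerm_induction {P : QOp ((FouW d K ⊕ Fin a ⊕ Fin a) ⊕ SysW d m) → ℕ → Prop}
    {nF nD : ℕ} (hmul : ∀ A B n n', P A n → P B n' → P (A * B) (n + n'))
    (hmono : ∀ A n n', P A n → n ≤ n' → P A n')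
    (hκ : P (onWires (Sum.map Sum.inl id) V.uKappa) nF)
    (hγ : P (onWires (Sum.map Sum.inl id) V.uGamma) nF)
    (hβp : ∀ μ, P (onWires (Sum.map Sum.inl id) (V.uBetaPos μ)) nF)
    (hβm : ∀ μ, P (onWires (Sum.map Sum.inl id) (V.uBetaNeg μ)) nF)
    (hp₁ : ∀ μ, P (onWires (Sum.map (Sum.inr ∘ Sum.inl) id) (V.uPlus μ)) nD)
    (hm₁ : ∀ μ, P (onWires (Sum.map (Sum.inr ∘ Sum.inl) id) (V.uMinus μ)) nD)
    (hp₂ : ∀ μ, P (onWires (Sum.map (Sum.inr ∘ Sum.inr) id) (V.uPlus μ)) nD)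
    (hm₂ : ∀ μ, P (onWires (Sum.map (Sum.inr ∘ Sum.inr) id) (V.uMinus μ)) nD) (t : TermIdx d) :
    P (V.restTerm t) (nF + 2 * nD) := by
  rcases t with (μ | μ) | (μ | μ) | _
  · exact hmono _ _ _ (hmul _ _ _ _ (hmul _ _ _ _ (hp₁ μ) hκ) (hm₂ μ)) (by omega)
  · exact hmono _ _ _ (hmul _ _ _ _ (hmul _ _ _ _ (hm₁ μ) hκ) (hp₂ μ)) (by omega)
  · exact hmono _ _ _ (hmul _ _ _ _ (hβp μ) (hm₁ μ)) (by omega)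
  · exact hmono _ _ _ (hmul _ _ _ _ (hβm μ) (hp₁ μ)) (by omega)
  · exact hmono _ _ _ hγ (by omega)

theorem assembled_unitary (hL : V.selL ∈ unitaryGroup (SelW d → Bool) ℂ)
    (hR : V.selR ∈ unitaryGroup (SelW d → Bool) ℂ)
    (ht : ∀ t, V.restTerm t ∈ unitaryGroup ((FouW d K ⊕ Fin a ⊕ Fin a) ⊕ SysW d m → Bool) ℂ) :
    V.assembled ∈ unitaryGroup (AncW d K a ⊕ SysW d m → Bool) ℂ := by
  rw [assembled_eq]
  refine onWires_mem_unitary _ (Equiv.injective _) (mul_mem (mul_mem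
    (conjTranspose_mem_unitary (onWires_mem_unitary _ Sum.inl_injective hL))
    (mux_mem_unitary fun b => ?_)) (onWires_mem_unitary _ Sum.inl_injective hR))
  by_cases h : ∃ t : TermIdx d, termNum t = bitsVal b
  · obtain ⟨t, h⟩ := h
    rw [V.selected_of_eq h]
    exact ht t
  · push Not at h
    rw [V.selected_of_ne h]
    exact one_mem _

/-- Selector states that number no term are branches of cost 0, so at most 4d + 1 branches are
charged. The tree has fewer than 2 (4d + 1) nodes, whence the summand 44 (4d + 1); the last 2 gates
remove the outer control. -/
theorem assembled_circuit {n N : ℕ} (hL : V.selL ∈ unitaryGroup (SelW d → Bool) ℂ)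
    (hd : 0 < d) (hLn : CtrlCircuit V.selL n) (hRn : CtrlCircuit V.selR n)
    (ht : ∀ t, CtrlCircuit (V.restTerm t) N) :
    HasCircuit V.assembled ((4 * d + 1) * N + 44 * (4 * d + 1) + 2 * n + 2) := by
  have hsel : CtrlCircuit (mux V.selected) ((4 * d + 1) * N + 44 * (4 * d + 1)) := by
    have h := MuxCost.fin (Nat.clog 2 (4 * d + 1)) _ V.selected
      (fun b => if bitsVal b < 4 * d + 1 then N else 0) fun b => ?_
    · have h1 : ∑ b : SelW d → Bool, (if bitsVal b < 4 * d + 1 then N else 0) ≤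
          (4 * d + 1) * N := by
        rw [← Finset.sum_filter, Finset.sum_const, smul_eq_mul]
        refine Nat.mul_le_mul_right _ ?_
        refine le_of_le_of_eq ?_ (Finset.card_range (4 * d + 1))
        refine Finset.card_le_card_of_injOn bitsVal ?_ bitsVal_injective.injOn
        intro b hb
        simpa using hb
      have h2 := pow_clog_le (N := 4 * d + 1) (by omega)
      exact h.mono (add_le_add h1 (by omega))
    · by_cases h : ∃ t : TermIdx d, termNum t = bitsVal b
      · obtain ⟨t, h⟩ := h
        rw [V.selected_of_eq h, if_pos (h ▸ termNum_lt t)]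
        exact ht t
      · push Not at h
        rw [V.selected_of_ne h]
        exact CtrlCircuit.one.mono (Nat.zero_le _)
  rw [assembled_eq]
  refine (CtrlCircuit.hasCircuit ?_).onWires _ (Equiv.injective _)
  exact ((((hLn.onWires _ Sum.inl_injective).conjTranspose
    (onWires_mem_unitary _ Sum.inl_injective hL)).mul hsel).mul
      (hRn.onWires _ Sum.inl_injective)).mono (by omega)

theorem zeroBlock_restTerm (t : TermIdx d) : zeroBlock (V.restTerm t) = match t with
    | .inl (.inl μ) => zeroBlock (V.uPlus μ) * zeroBlock V.uKappa * zeroBlock (V.uMinus μ)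
    | .inl (.inr μ) => zeroBlock (V.uMinus μ) * zeroBlock V.uKappa * zeroBlock (V.uPlus μ)
    | .inr (.inl (.inl μ)) => zeroBlock (V.uBetaPos μ) * zeroBlock (V.uMinus μ)
    | .inr (.inl (.inr μ)) => zeroBlock (V.uBetaNeg μ) * zeroBlock (V.uPlus μ)
    | .inr (.inr ()) => zeroBlock V.uGamma := by
  have h3 : ∀ (A B : QOp (Fin a ⊕ SysW d m)) (F : QOp (FouW d K ⊕ SysW d m)),
      zeroBlock (onWires (Sum.map (Sum.inr ∘ Sum.inl) id) A * onWires (Sum.map Sum.inl id) F *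
        onWires (Sum.map (Sum.inr ∘ Sum.inr) id) B :
          QOp ((FouW d K ⊕ Fin a ⊕ Fin a) ⊕ SysW d m)) =
        zeroBlock A * zeroBlock F * zeroBlock B := by
    intro A B F
    rw [zeroBlock_mul ((actsOnAncillas_onWires _ _).mul (actsOnAncillas_onWires _ _))
      (actsOnAncillas_onWires _ _), zeroBlock_mul (actsOnAncillas_onWires _ _)
      (actsOnAncillas_onWires _ _), zeroBlock_onWires, zeroBlock_onWires, zeroBlock_onWires]
    · rintro c ⟨_, rfl⟩ ⟨_, h⟩
      simp at h
    · rintro c (⟨_, rfl⟩ | ⟨_, rfl⟩) ⟨_, h⟩ <;> simp at h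
  have h2 : ∀ (A : QOp (Fin a ⊕ SysW d m)) (F : QOp (FouW d K ⊕ SysW d m)),
      zeroBlock (onWires (Sum.map Sum.inl id) F * onWires (Sum.map (Sum.inr ∘ Sum.inl) id) A :
          QOp ((FouW d K ⊕ Fin a ⊕ Fin a) ⊕ SysW d m)) = zeroBlock F * zeroBlock A := by
    intro A F
    rw [zeroBlock_mul (actsOnAncillas_onWires _ _)
      (actsOnAncillas_onWires _ _), zeroBlock_onWires, zeroBlock_onWires]
    rintro c ⟨_, rfl⟩ ⟨_, h⟩
    simp at h
  rcases t with (μ | μ) | (μ | μ) | _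
  · exact h3 _ _ _
  · exact h3 _ _ _
  · exact h2 _ _
  · exact h2 _ _
  · exact zeroBlock_onWires _ _

end Unitaries

/-! ### The error of the assembled block-encoding -/

section Assembly

variable {d m K a : ℕ} (E : FirstOrderPDE d m)

/-- The operators whose linear combination is `A^(1st)`. -/
noncomputable def FirstOrderPDE.termOp : TermIdx d → QOp (SysW d m)
  | .inl (.inl μ) => E.diffPlus μ * E.diagOp E.kappa * E.diffMinus μ
  | .inl (.inr μ) => E.diffMinus μ * E.diagOp E.kappa * E.diffPlus μ
  | .inr (.inl (.inl μ)) => E.diagOp (E.betaPos μ) * E.diffMinus μ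
  | .inr (.inl (.inr μ)) => E.diagOp (E.betaNeg μ) * E.diffPlus μ
  | .inr (.inr ()) => E.diagOp E.gamma

theorem FirstOrderPDE.opA_eq_sum (s : ℝ) :
    E.opA s = ∑ t, (termCoeff s t : ℂ) • E.termOp t := by
  simp only [Fintype.sum_sum_type, termCoeff, FirstOrderPDE.termOp, FirstOrderPDE.opA,
    Finset.sum_add_distrib, ← Finset.smul_sum, Finset.univ_unique, Finset.sum_singleton]
  push_cast
  module

/-- The error of the block-encoding of a term. -/
noncomputable def termErr (eKappa eBeta eGamma aDiff : ℝ) : TermIdx d → ℝ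
  | .inl _ => aDiff ^ 2 * eKappa
  | .inr (.inl _) => aDiff * eBeta
  | .inr (.inr _) => eGamma

theorem termErr_le_max {eKappa eBeta eGamma aDiff : ℝ} (t : TermIdx d) :
    termErr eKappa eBeta eGamma aDiff t ≤
      max (aDiff ^ 2 * eKappa) (max (aDiff * eBeta) eGamma) := by
  rcases t with _ | _ | _ <;> simp [termErr]

open scoped Matrix.Norms.L2Operator

theorem qop_norm_mul_le {A B : QOp (SysW d m)} {p q : ℝ} (hA : ‖A‖ ≤ p) (hB : ‖B‖ ≤ q) :
    ‖A * B‖ ≤ p * q :=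
  (l2_opNorm_mul A B).trans (mul_le_mul hA hB (norm_nonneg _) ((norm_nonneg _).trans hA))

theorem Unitaries.norm_term_sub_le (V : Unitaries d m K a) {nF nD : ℕ}
    {aKappa aBeta aGamma aDiff eKappa eBeta eGamma : ℝ} (hD : 0 ≤ aDiff)
    (hκ : IsBlockEncoding aKappa nF eKappa V.uKappa (E.diagOp E.kappa))
    (hγ : IsBlockEncoding aGamma nF eGamma V.uGamma (E.diagOp E.gamma))
    (hβp : ∀ μ, IsBlockEncoding aBeta nF eBeta (V.uBetaPos μ) (E.diagOp (E.betaPos μ)))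
    (hβm : ∀ μ, IsBlockEncoding aBeta nF eBeta (V.uBetaNeg μ) (E.diagOp (E.betaNeg μ)))
    (hp : ∀ μ, IsBlockEncoding aDiff nD 0 (V.uPlus μ) (E.diffPlus μ))
    (hm : ∀ μ, IsBlockEncoding aDiff nD 0 (V.uMinus μ) (E.diffMinus μ)) (t : TermIdx d) :
    ‖E.termOp t - (termNorm aKappa aBeta aGamma aDiff t : ℂ) • zeroBlock (V.restTerm t)‖ ≤
      termErr eKappa eBeta eGamma aDiff t := by
  have h3 : ∀ (A B : QOp (Fin a ⊕ SysW d m)) (D D' C : QOp (SysW d m)) (F : QOp (SysW d m)),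
      IsBlockEncoding aDiff nD 0 A D → IsBlockEncoding aDiff nD 0 B D' →
      ‖C - (aKappa : ℂ) • F‖ ≤ eKappa →
      ‖D * C * D' - ((aKappa * aDiff ^ 2 : ℝ) : ℂ) • (zeroBlock A * F * zeroBlock B)‖ ≤
        aDiff ^ 2 * eKappa := by
    intro A B D D' C F hA hB hC
    -- Since the difference operators are encoded without error, the deviation factors with the
    -- coefficient error in the middle.
    have h : D * C * D' - ((aKappa * aDiff ^ 2 : ℝ) : ℂ) • (zeroBlock A * F * zeroBlock B) =
        D * (C - (aKappa : ℂ) • F) * D' := by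
      rw [Matrix.mul_sub, Matrix.sub_mul]
      congr 1
      rw [← hA.eq_smul, ← hB.eq_smul]
      simp only [Matrix.smul_mul, Matrix.mul_smul, smul_smul]
      push_cast
      ring_nf
    rw [h]
    refine (qop_norm_mul_le (qop_norm_mul_le (hA.norm_le hD) hC) (hB.norm_le hD)).trans
      (le_of_eq ?_)
    ring
  have h2 : ∀ (A : QOp (Fin a ⊕ SysW d m)) (D C : QOp (SysW d m)) (F : QOp (SysW d m)),
      IsBlockEncoding aDiff nD 0 A D → ‖C - (aBeta : ℂ) • F‖ ≤ eBeta →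
      ‖C * D - ((aBeta * aDiff : ℝ) : ℂ) • (F * zeroBlock A)‖ ≤ aDiff * eBeta := by
    intro A D C F hA hC
    have h : C * D - ((aBeta * aDiff : ℝ) : ℂ) • (F * zeroBlock A) =
        (C - (aBeta : ℂ) • F) * D := by
      rw [Matrix.sub_mul]
      congr 1
      rw [← hA.eq_smul]
      simp only [Matrix.smul_mul, Matrix.mul_smul, smul_smul]
      push_cast
      ring_nf
    rw [h]
    exact (qop_norm_mul_le hC (hA.norm_le hD)).trans (le_of_eq (mul_comm _ _))
  rw [V.zeroBlock_restTerm]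
  rcases t with (μ | μ) | (μ | μ) | _
  · exact h3 _ _ _ _ _ _ (hp μ) (hm μ) hκ.norm_sub_le
  · exact h3 _ _ _ _ _ _ (hm μ) (hp μ) hκ.norm_sub_le
  · exact h2 _ _ _ _ (hm μ) (hβp μ).norm_sub_le
  · exact h2 _ _ _ _ (hp μ) (hβm μ).norm_sub_le
  · exact hγ.norm_sub_le

theorem Unitaries.smul_zeroBlock_assembled (V : Unitaries d m K a)
    {s aKappa aBeta aGamma aDiff : ℝ} (hκ : 0 ≤ aKappa) (hβ : 0 ≤ aBeta)
    (hγ : 0 ≤ aGamma) (hD : 0 ≤ aDiff) (h : V.IsSelPrep s aKappa aBeta aGamma aDiff) :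
    (((3 * d + 1) * max (aKappa * aDiff ^ 2) (max (aBeta * aDiff) aGamma) : ℝ) : ℂ) •
      zeroBlock V.assembled = ∑ t, (termCoeff s t : ℂ) •
        (termNorm aKappa aBeta aGamma aDiff t : ℂ) • zeroBlock (V.restTerm t) := by
  set mx := max (aKappa * aDiff ^ 2) (max (aBeta * aDiff) aGamma) with hmx
  have hcancel : ∀ t : TermIdx d, mx * (termNorm aKappa aBeta aGamma aDiff t / mx) =
      termNorm aKappa aBeta aGamma aDiff t := by
    intro t
    -- If the maximum vanishes, division by it gives 0. Every term normalization lies between 0 and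
    -- the maximum, so the identity still holds.
    by_cases h0 : mx = 0
    · have h1 : termNorm aKappa aBeta aGamma aDiff t ≤ mx := termNorm_le_max t
      have h2 := termNorm_nonneg hκ hβ hγ hD t
      rw [h0] at h1 ⊢
      rw [zero_mul]
      exact le_antisymm h2 h1
    · field_simp
  rw [V.zeroBlock_assembled, Finset.smul_sum]
  have hb : ∀ b : SelW d → Bool, (((3 * d + 1) * mx : ℝ) : ℂ) •
      (star (V.selL b (zeroKet _)) * V.selR b (zeroKet _)) • zeroBlock (V.selected b) =
      ∑ t, if termNum t = bitsVal b then (termCoeff s t : ℂ) •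
        (termNorm aKappa aBeta aGamma aDiff t : ℂ) • zeroBlock (V.restTerm t) else 0 := by
    intro b
    by_cases hbt : ∃ t : TermIdx d, termNum t = bitsVal b
    · obtain ⟨t, ht⟩ := hbt
      rw [V.selected_of_eq ht, Finset.sum_eq_single t, if_pos ht, smul_smul, smul_smul]
      · congr 1
        have h1 := (h.2.2 b).1 t ht
        rw [← hmx] at h1
        rw [show (((3 * d + 1) * mx : ℝ) : ℂ) * (star (V.selL b (zeroKet _)) *
          V.selR b (zeroKet _)) = mx * ((3 * d + 1 : ℂ) * (star (V.selL b (zeroKet _)) *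
            V.selR b (zeroKet _))) by push_cast; ring, h1]
        rw [← Complex.ofReal_mul, ← Complex.ofReal_mul]
        congr 1
        rw [mul_left_comm, hcancel]
      · intro t' _ ht'
        rw [if_neg]
        intro h'
        exact ht' (termNum_injective (h'.trans ht.symm))
      · simp
    · push Not at hbt
      rw [(h.2.2 b).2 hbt, zero_smul, smul_zero]
      exact (Finset.sum_eq_zero fun t _ => if_neg (hbt t)).symm
  rw [Finset.sum_congr rfl fun b _ => hb b, Finset.sum_comm]
  exact Finset.sum_congr rfl fun t _ => sum_ite_termNum t _

theorem Unitaries.norm_opA_sub_le (V : Unitaries d m K a) {nF nD : ℕ}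
    {s aKappa aBeta aGamma aDiff eKappa eBeta eGamma : ℝ} (hs : s = 1 ∨ s = -1)
    (hκ0 : 0 ≤ aKappa) (hβ0 : 0 ≤ aBeta) (hγ0 : 0 ≤ aGamma) (hD : 0 ≤ aDiff)
    (hκ : IsBlockEncoding aKappa nF eKappa V.uKappa (E.diagOp E.kappa))
    (hγ : IsBlockEncoding aGamma nF eGamma V.uGamma (E.diagOp E.gamma))
    (hβp : ∀ μ, IsBlockEncoding aBeta nF eBeta (V.uBetaPos μ) (E.diagOp (E.betaPos μ)))
    (hβm : ∀ μ, IsBlockEncoding aBeta nF eBeta (V.uBetaNeg μ) (E.diagOp (E.betaNeg μ)))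
    (hp : ∀ μ, IsBlockEncoding aDiff nD 0 (V.uPlus μ) (E.diffPlus μ))
    (hm : ∀ μ, IsBlockEncoding aDiff nD 0 (V.uMinus μ) (E.diffMinus μ))
    (h : V.IsSelPrep s aKappa aBeta aGamma aDiff) :
    ‖E.opA s - (((3 * d + 1) * max (aKappa * aDiff ^ 2) (max (aBeta * aDiff) aGamma) : ℝ) : ℂ) •
      zeroBlock V.assembled‖ ≤
        (3 * d + 1) * max (aDiff ^ 2 * eKappa) (max (aDiff * eBeta) eGamma) := by
  rw [V.smul_zeroBlock_assembled hκ0 hβ0 hγ0 hD h, E.opA_eq_sum, ← Finset.sum_sub_distrib]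
  simp only [← smul_sub]
  rw [← sum_abs_termCoeff hs, Finset.sum_mul]
  refine (norm_sum_le _ _).trans (Finset.sum_le_sum fun t _ => ?_)
  rw [norm_smul, Complex.norm_real, Real.norm_eq_abs]
  exact mul_le_mul_of_nonneg_left ((V.norm_term_sub_le E hD hκ hγ hβp hβm hp hm t).trans
    (termErr_le_max t)) (abs_nonneg _)

end Assembly

/-! ### The final gate count -/

theorem clog_le_log {K : ℕ} (hK : 1 ≤ K) :
    (Nat.clog 2 (2 * K + 1) : ℝ) ≤ 3 + 2 * Real.log K := by
  have hK0 : (0 : ℝ) < K := by exact_mod_cast hK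
  -- Rounding up at most doubles, and 2 (2K + 1) ≤ 8K up to the parity of a power of two: the bound
  -- 4K + 2 ≤ 8K needs K ≥ 1. Taking logarithms gives the additive 3, which has to stay because log
  -- K vanishes for K = 1.
  have h1 : (2 : ℝ) ^ Nat.clog 2 (2 * K + 1) ≤ 2 ^ 3 * K := by
    have := pow_clog_le (N := 2 * K + 1) (by omega)
    have h2 : 2 ^ Nat.clog 2 (2 * K + 1) ≤ 2 ^ 3 * K := by omega
    exact_mod_cast h2
  have h2 := Real.log_le_log (by positivity) h1
  rw [Real.log_mul (by positivity) hK0.ne', Real.log_pow, Real.log_pow] at h2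
  have h3 : 1 / 2 ≤ Real.log 2 := by linarith [Real.log_two_gt_d9]
  have h4 : 0 ≤ Real.log K := Real.log_nonneg (by exact_mod_cast hK)
  by_contra hlt
  push Not at hlt
  push_cast at h2
  nlinarith

theorem gate_count_le {d m K : ℕ} (hd : 0 < d) (hm : 0 < m) (hK : 1 ≤ K) :
    (((4 * d + 1) * (180 * (2 * K + 1) ^ d + d * ((Nat.clog 2 (2 * K + 1) + 1) * (m + 1)) * 11 +
      180 * (2 * K + 1) ^ d + 2 * (59 * m + 30)) + 44 * (4 * d + 1) + 2 * (184 * (d + 1)) + 2 :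
        ℕ) : ℝ) ≤
      4000 * (d * (2 * K + 1) ^ d + d * (d * m) * Real.log K + (d * m) ^ 2) := by
  have hr := clog_le_log hK
  have hl : 0 ≤ Real.log K := Real.log_nonneg (by exact_mod_cast hK)
  have hd1 : (1 : ℝ) ≤ d := by exact_mod_cast hd
  have hm1 : (1 : ℝ) ≤ m := by exact_mod_cast hm
  have hG : (0 : ℝ) ≤ (2 * K + 1) ^ d := by positivity
  push_cast
  generalize (Nat.clog 2 (2 * K + 1) : ℝ) = r at hr ⊢
  generalize Real.log (K : ℝ) = l at hr hl ⊢
  generalize ((2 * (K : ℝ) + 1) ^ d) = G at hG ⊢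
  generalize (d : ℝ) = D at hd1 ⊢
  generalize (m : ℝ) = M at hm1 ⊢
  have hD0 : 0 ≤ D := by linarith
  have hM0 : 0 ≤ M := by linarith
  have h1 : D * ((r + 1) * (M + 1)) * 11 ≤ D * ((4 + 2 * l) * (2 * M)) * 11 := by
    have : (r + 1) * (M + 1) ≤ (4 + 2 * l) * (2 * M) := by
      calc (r + 1) * (M + 1) ≤ (4 + 2 * l) * (M + 1) :=
            mul_le_mul_of_nonneg_right (by linarith) (by linarith)
        _ ≤ (4 + 2 * l) * (2 * M) := mul_le_mul_of_nonneg_left (by linarith) (by linarith)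
    gcongr
  have h2 : (4 * D + 1) * (180 * G + D * ((r + 1) * (M + 1)) * 11 + 180 * G + 2 * (59 * M + 30)) ≤
      (5 * D) * (360 * G + D * ((4 + 2 * l) * (2 * M)) * 11 + 178 * M) := by
    calc _ ≤ (4 * D + 1) * (360 * G + D * ((4 + 2 * l) * (2 * M)) * 11 + 178 * M) :=
          mul_le_mul_of_nonneg_left (by linarith) (by linarith)
      _ ≤ _ := by
          have : 0 ≤ 360 * G + D * ((4 + 2 * l) * (2 * M)) * 11 + 178 * M := by positivity
          exact mul_le_mul_of_nonneg_right (by linarith) this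
  -- The contributions without log K and without the number of frequencies are at most of order D²M;
  -- as D, M ≥ 1, all of them are absorbed by n² = (DM)².
  have h3 : D ≤ (D * M) ^ 2 := by
    have : D ≤ D * M := le_mul_of_one_le_right hD0 hm1
    nlinarith
  have h4 : D * M ≤ (D * M) ^ 2 := by
    have : 1 ≤ D * M := one_le_mul_of_one_le_of_one_le hd1 hm1
    nlinarith
  have h5 : D * D * M ≤ (D * M) ^ 2 := by
    have : D * D * M * 1 ≤ D * D * M * M := by gcongr
    nlinarith
  have h6 : 0 ≤ D * G := by positivity
  have h7 : 0 ≤ D * (D * M) * l := by positivity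
  have h8 : (5 * D) * (360 * G + D * ((4 + 2 * l) * (2 * M)) * 11 + 178 * M) =
    1800 * (D * G) + 440 * (D * D * M) + 220 * (D * (D * M) * l) + 890 * (D * M) := by ring
  linarith

end

theorem theorem4 :
    ∃ c : ℝ, ∀ (d m K a : ℕ), 0 < d → 0 < m → 1 ≤ K → 2 ≤ a →
    ∀ (E : FirstOrderPDE d m) (L : Fin d → ℝ), (∀ μ, 0 < L μ) →
    ∀ (s : ℝ), (s = 1 ∨ s = -1) →
    ∀ (cKappa cGamma : (Fin d → ℤ) → ℂ) (cBetaPos cBetaNeg : Fin d → (Fin d → ℤ) → ℂ)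
      (aKappa aBeta aGamma aDiff eKappa eBeta eGamma : ℝ),
      IsFourierApprox E L K E.kappa cKappa aKappa eKappa →
      IsFourierApprox E L K E.gamma cGamma aGamma eGamma →
      (∀ μ, IsFourierApprox E L K (E.betaPos μ) (cBetaPos μ) aBeta eBeta) →
      (∀ μ, IsFourierApprox E L K (E.betaNeg μ) (cBetaNeg μ) aBeta eBeta) →
      (∀ μ, 2 / E.spacing μ ≤ aDiff) →
      ∃ V : Unitaries d m K a,
        -- the coefficients are block-encoded by LCU Fourier
        (IsLCUFourier E L aKappa cKappa V.uKappa ∧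
          IsBlockEncoding aKappa (d * Nat.clog 2 (2 * K + 1)) eKappa V.uKappa
            (E.diagOp E.kappa)) ∧
        (IsLCUFourier E L aGamma cGamma V.uGamma ∧
          IsBlockEncoding aGamma (d * Nat.clog 2 (2 * K + 1)) eGamma V.uGamma
            (E.diagOp E.gamma)) ∧
        (∀ μ, IsLCUFourier E L aBeta (cBetaPos μ) (V.uBetaPos μ) ∧
          IsBlockEncoding aBeta (d * Nat.clog 2 (2 * K + 1)) eBeta (V.uBetaPos μ)
            (E.diagOp (E.betaPos μ))) ∧
        (∀ μ, IsLCUFourier E L aBeta (cBetaNeg μ) (V.uBetaNeg μ) ∧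
          IsBlockEncoding aBeta (d * Nat.clog 2 (2 * K + 1)) eBeta (V.uBetaNeg μ)
            (E.diagOp (E.betaNeg μ))) ∧
        -- the difference operators are block-encoded exactly
        (∀ μ, IsBlockEncoding aDiff a 0 (V.uPlus μ) (E.diffPlus μ)) ∧
        (∀ μ, IsBlockEncoding aDiff a 0 (V.uMinus μ) (E.diffMinus μ)) ∧
        -- the assembled unitary is a block-encoding of `A^(1st)`
        V.IsSelPrep s aKappa aBeta aGamma aDiff ∧
        IsBlockEncoding ((3 * d + 1) * max (aKappa * aDiff ^ 2) (max (aBeta * aDiff) aGamma))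
          (d * Nat.clog 2 (2 * K + 1) + 2 * a + Nat.clog 2 (4 * d + 1))
          ((3 * d + 1) * max (aDiff ^ 2 * eKappa) (max (aDiff * eBeta) eGamma))
          V.assembled (E.opA s) ∧
        -- and it is implemented by a circuit with the claimed number of two-qubit gates
        ∃ (w : ℕ) (C : List (TwoQubitGate (Fin w ⊕ (AncW d K a ⊕ SysW d m)))),
          Implements C V.assembled ∧
          (C.length : ℝ) ≤ c * (d * (2 * K + 1) ^ d + d * (d * m) * Real.log K + (d * m) ^ 2) := by
  refine ⟨4000, ?_⟩
  intro d m K a hd hm hK ha E L _ s hs cKappa cGamma cBetaPos cBetaNeg aKappa aBeta aGamma aDiff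
    eKappa eBeta eGamma hκ hγ hβp hβm hD
  have hκ0 : 0 ≤ aKappa := (Finset.sum_nonneg fun k _ => norm_nonneg _).trans hκ.1
  have hγ0 : 0 ≤ aGamma := (Finset.sum_nonneg fun k _ => norm_nonneg _).trans hγ.1
  -- `aBeta` and `aDiff` are constrained only through the directions, so their signs use that there
  -- is at least one.
  have hβ0 : 0 ≤ aBeta := (Finset.sum_nonneg fun k _ => norm_nonneg _).trans (hβp ⟨0, hd⟩).1
  have hD0 : 0 ≤ aDiff :=
    (div_nonneg zero_le_two (E.spacing_pos ⟨0, hd⟩).le).trans (hD ⟨0, hd⟩)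
  have hF : ∀ {c α ε f}, IsFourierApprox E L K f c α ε →
      ∃ U : QOp (FouW d K ⊕ SysW d m), (IsLCUFourier E L α c U ∧
        IsBlockEncoding α (d * Nat.clog 2 (2 * K + 1)) ε U (E.diagOp f)) ∧
        CtrlCircuit U (180 * (2 * K + 1) ^ d + d * ((Nat.clog 2 (2 * K + 1) + 1) * (m + 1)) * 11 +
          180 * (2 * K + 1) ^ d) := by
    intro c α ε f hf
    obtain ⟨PL, PR, hP, hL, hR⟩ := exists_fourierPrep hd hK c hf.1
    exact ⟨lcuFourier E L PL PR, ⟨⟨PL, PR, hP, rfl⟩, lcuFourier_isBlockEncoding E L hf hP⟩,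
      lcuFourier_circuit E L hP hL hR⟩
  obtain ⟨uKappa, hUκ, hUκn⟩ := hF hκ
  obtain ⟨uGamma, hUγ, hUγn⟩ := hF hγ
  choose uBetaPos hUβp hUβpn using fun μ => hF (hβp μ)
  choose uBetaNeg hUβm hUβmn using fun μ => hF (hβm μ)
  choose uPlus hUp hUpn using fun μ => exists_diffPlus_blockEncoding E hm ha μ (hD μ)
  choose uMinus hUm hUmn using fun μ => exists_diffMinus_blockEncoding E hm ha μ (hD μ)
  obtain ⟨selL, selR, hsel, hLn, hRn⟩ :=
    exists_selPrep (m := m) (K := K) (a := a) hd hs hκ0 hβ0 hγ0 hD0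
  let V : Unitaries d m K a := ⟨uKappa, uGamma, uBetaPos, uBetaNeg, uPlus, uMinus, selL, selR⟩
  have hV : V.IsSelPrep s aKappa aBeta aGamma aDiff := hsel V rfl rfl
  have i0 : Function.Injective (Sum.map Sum.inl id :
      FouW d K ⊕ SysW d m → (FouW d K ⊕ Fin a ⊕ Fin a) ⊕ SysW d m) :=
    Sum.inl_injective.sumMap Function.injective_id
  have i1 : Function.Injective (Sum.map (Sum.inr ∘ Sum.inl) id :
      Fin a ⊕ SysW d m → (FouW d K ⊕ Fin a ⊕ Fin a) ⊕ SysW d m) :=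
    (Sum.inr_injective.comp Sum.inl_injective).sumMap Function.injective_id
  have i2 : Function.Injective (Sum.map (Sum.inr ∘ Sum.inr) id :
      Fin a ⊕ SysW d m → (FouW d K ⊕ Fin a ⊕ Fin a) ⊕ SysW d m) :=
    (Sum.inr_injective.comp Sum.inr_injective).sumMap Function.injective_id
  have hcost := V.restTerm_induction (P := fun A n => CtrlCircuit A n)
    (fun _ _ _ _ h h' => h.mul h') (fun _ _ _ h h' => h.mono h')
    (hUκn.onWires _ i0) (hUγn.onWires _ i0) (fun μ => (hUβpn μ).onWires _ i0)
    (fun μ => (hUβmn μ).onWires _ i0) (fun μ => (hUpn μ).onWires _ i1)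
    (fun μ => (hUmn μ).onWires _ i1) (fun μ => (hUpn μ).onWires _ i2)
    (fun μ => (hUmn μ).onWires _ i2)
  have hunit := V.restTerm_induction (nF := 0) (nD := 0)
    (P := fun A _ => A ∈ Matrix.unitaryGroup _ ℂ)
    (fun _ _ _ _ h h' => mul_mem h h') (fun _ _ _ h _ => h)
    (onWires_mem_unitary _ i0 hUκ.2.2.1) (onWires_mem_unitary _ i0 hUγ.2.2.1)
    (fun μ => onWires_mem_unitary _ i0 (hUβp μ).2.2.1)
    (fun μ => onWires_mem_unitary _ i0 (hUβm μ).2.2.1)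
    (fun μ => onWires_mem_unitary _ i1 (hUp μ).2.1)
    (fun μ => onWires_mem_unitary _ i1 (hUm μ).2.1)
    (fun μ => onWires_mem_unitary _ i2 (hUp μ).2.1)
    (fun μ => onWires_mem_unitary _ i2 (hUm μ).2.1)
  refine ⟨V, hUκ, hUγ, hUβp, hUβm, hUp, hUm, hV, ⟨?_, V.assembled_unitary hV.1 hV.2.1 hunit, ?_⟩, ?_⟩
  · simp only [Fintype.card_sum, Fintype.card_prod, Fintype.card_fin]
    ring
  · exact V.norm_opA_sub_le E hs hκ0 hβ0 hγ0 hD0 hUκ.2 hUγ.2 (fun μ => (hUβp μ).2)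
      (fun μ => (hUβm μ).2) hUp hUm hV
  · obtain ⟨w, C, hC, hlen⟩ := (V.assembled_circuit hV.1 hd hLn hRn hcost).of_fin
    exact ⟨w, C, hC, (Nat.cast_le.2 hlen).trans (gate_count_le hd hm hK)⟩
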